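/- **Setting.** Let $n,K,d\ge 1$, $B,R>0$, $0<\delta<1$, and let $(x_1,y_1),\dots,(x_n,y_n)$ be an arbitrary fixed sequence with $x_t\in\mathbb R^{d}$, $\|x_t\|\le R$, $y_t\in\{1,\dots,K\}$. For $z\in\mathbb R^K$ let $\sigma(z)_k=e^{z_k}/\sum_j e^{z_j}$ and $\ell(z,y)=-\log\sigma(z)_y$. For $x\in\mathbb R^d$ let $\Phi(x)\in\mathbb R^{Kd\times K}$ be the matrix whose $k$-th column is $x$ placed in the $k$-th block, and for $\theta\in\mathbb R^{Kd}$ put $\ell_{x,y}(\theta)=\ell(\Phi(x)^\top\theta,y)$. For predictions $\tilde y_t\in\mathbb R^K$ the regret is $R_n(\theta)=\sum_{t=1}^n\ell(\tilde y_t,y_t)-\sum_{t=1}^n\ell_{x_t,y_t}(\theta)$. **Efficient-GAF** with parameters $\lambda,\beta,\mu$ and $m\ge1$ starts from $A_0=\lambda I$, $b_0=0$, $\theta_1=0$. In round $t$ it draws (independently of everything before) i.i.d. samples $\omega_1,\dots,\omega_m\sim\mathcal N\big(\Phi(x_t)^\top\theta_t,\ \Phi(x_t)^\top A_{t-1}^{-1}\Phi(x_t)\big)$,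 predicts $$\tilde y_{t,k}=\log\Big((1-\mu)\tfrac1m\sum_{i=1}^m\sigma(\omega_i)_k+\tfrac{\mu}{K}\Big),\qquad k=1,\dots,K,$$ receives $y_t$, and updates $$\theta_{t+1}=\operatorname*{argmin}_{\theta\in\mathbb R^{Kd}}\ b_{t-1}^\top\theta+\theta^\top A_{t-1}\theta+\ell_{x_t,y_t}(\theta),$$ $$b_t=b_{t-1}+\nabla\ell_{x_t,y_t}(\theta_{t+1})-\beta\nabla^2\ell_{x_t,y_t}(\theta_{t+1})\theta_{t+1},\qquad A_t=A_{t-1}+\tfrac\beta2\nabla^2\ell_{x_t,y_t}(\theta_{t+1}).$$ Say that it is run with *accuracy* $\varepsilon\ge0$ if in each round $\theta_{t+1}$ is allowed to be any point at Euclidean distance at most $\varepsilon$ from the argmin ($\varepsilon=0$: the exact algorithm). Computational cost is the number of steps on a real RAM: memory cells holding real numbers, arranged in arrays, unit-cost operations $+,-,\times,\div,\exp,\log,\sqrt{\ }$, counted loops, and unit cost for reading an input, writing an output and drawing a standard Gaussian number. **Proposition.** Let $\lambda=32dKR^2$, $\beta=(\log(K)/2+BR+1)^{-1}$, $\mu=(\log(n/\delta)/m)^{1/3}$,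 and $$\mathcal B_n=dKB^2R^2+dK\,[\log K+BR]\,\log\Big(1+\frac{n}{dK(\log K+BR)}\Big).$$ There are a universal constant $C>0$ and one program for the real RAM, the same for all values of the quantities above, such that the following hold. 1. For all $m\ge1$, the program implements Efficient-GAF with accuracy $e^{-m}/R$, and its cost over the $n$ rounds is at most $C\,(nK^3d^2+K^2nm)$. 2. For all $m\ge1$ with $\mu\le1$ (that is, $m\ge\log(n/\delta)$), Efficient-GAF, run exactly or with accuracy $e^{-m}/R$, and in particular the program, satisfies with probability at least $1-\delta$, for all $\theta\in\mathbb R^{Kd}$ with $\|\theta\|\le B$ simultaneously, $$R_n(\theta)\le C\Big(\mathcal B_n+n\Big(\frac Km\log\frac n\delta\Big)^{1/3}\Big)+C .$$ 3. For $m=\lceil n^3\log(n/\delta)\rceil$, Efficient-GAF, run exactly or with accuracy $e^{-m}/R$, and in particular the program, satisfies with probability at least $1-\delta$, for all $\|\theta\|\le B$ simultaneously, $R_n(\theta)\le C\,\mathcal B_n+C$, and the cost of the program is at most $C\,\big(nK^3d^2+K^2n^4\log(n/\delta)\big)$. -/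

import Mathlib

open MeasureTheory ProbabilityTheory

namespace EfficientGAF

/-! ### Multiclass logistic regression -/

/-- Parameters `θ ∈ ℝ^{K d}`, indexed by pairs (class, coordinate); the norm is the Euclidean norm,
that is, the Frobenius norm of the associated `K × d` matrix. -/
abbrev Param (K d : ℕ) : Type := EuclideanSpace ℝ (Fin K × Fin d)

/-- The softmax `σ(z)_k = e^{z_k} / ∑_j e^{z_j}`. -/
noncomputable def softmax {K : ℕ} (z : Fin K → ℝ) (k : Fin K) : ℝ :=
  Real.exp (z k) / ∑ j, Real.exp (z j)

/-- The logistic loss `ℓ(z, y) = -log σ(z)_y` of a prediction `z ∈ ℝ^K`. -/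
noncomputable def logisticLoss {K : ℕ} (z : Fin K → ℝ) (y : Fin K) : ℝ :=
  -Real.log (softmax z y)

/-- The block feature matrix `Φ(x) ∈ ℝ^{K d × K}`, whose `j`-th column is `x` placed in block `j`. -/
def feature {K d : ℕ} (x : EuclideanSpace ℝ (Fin d)) : Matrix (Fin K × Fin d) (Fin K) ℝ :=
  Matrix.of fun p j => if p.1 = j then x p.2 else 0

/-- The linear prediction `f_θ(x) = Φ(x)ᵀ θ ∈ ℝ^K`. -/
noncomputable def linPred {K d : ℕ} (θ : Param K d) (x : EuclideanSpace ℝ (Fin d)) : Fin K → ℝ :=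
  Matrix.mulVec (feature x).transpose θ.ofLp

/-- The loss `ℓ_{x,y}(θ) = ℓ(f_θ(x), y)`. -/
noncomputable def paramLoss {K d : ℕ} (x : EuclideanSpace ℝ (Fin d)) (y : Fin K)
    (θ : Param K d) : ℝ :=
  logisticLoss (linPred θ x) y

/-- The regret of the predictions `pred` against the linear predictor `θ`. -/
noncomputable def regret {n K d : ℕ} (x : Fin n → EuclideanSpace ℝ (Fin d)) (y : Fin n → Fin K)
    (pred : Fin n → Fin K → ℝ) (θ : Param K d) : ℝ :=
  ∑ t, logisticLoss (pred t) (y t) - ∑ t, paramLoss (x t) (y t) θ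

/-! ### The algorithm -/

/-- The Hessian matrix `(∂_i ∂_j f(θ))_{i,j}`. -/
noncomputable def hessian {ι : Type} [Fintype ι] [DecidableEq ι]
    (f : EuclideanSpace ℝ ι → ℝ) (θ : EuclideanSpace ℝ ι) : Matrix ι ι ℝ :=
  Matrix.of fun i j =>
    fderiv ℝ (fun u => fderiv ℝ f u (EuclideanSpace.single j 1)) θ (EuclideanSpace.single i 1)

/-- The objective `bᵀ θ + θᵀ A θ + ℓ_{x,y}(θ)` minimized in the update step. -/
noncomputable def objective {K d : ℕ} (A : Matrix (Fin K × Fin d) (Fin K × Fin d) ℝ)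
    (b : Param K d) (x : EuclideanSpace ℝ (Fin d)) (y : Fin K) (θ : Param K d) : ℝ :=
  b.ofLp ⬝ᵥ θ.ofLp + θ.ofLp ⬝ᵥ Matrix.mulVec A θ.ofLp + paramLoss x y θ

/-- `(A_t, b_t, θ_{t+1})_{0 ≤ t ≤ n}` (here `θ t` is the estimator available after `t` rounds) is
the sequence of states of Efficient-GAF on the data `x, y`, where each argmin in the update step is
computed up to the Euclidean error `ε`; for `ε = 0` it is computed exactly. -/
structure IsRun {n K d : ℕ} (lam β ε : ℝ) (x : Fin n → EuclideanSpace ℝ (Fin d))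
    (y : Fin n → Fin K) (A : ℕ → Matrix (Fin K × Fin d) (Fin K × Fin d) ℝ)
    (b θ : ℕ → Param K d) : Prop where
  A_zero : A 0 = lam • (1 : Matrix (Fin K × Fin d) (Fin K × Fin d) ℝ)
  b_zero : b 0 = 0
  θ_zero : θ 0 = 0
  θ_succ : ∀ t : Fin n, ∃ θs : Param K d,
    (∀ θ' : Param K d, objective (A t) (b t) (x t) (y t) θs ≤ objective (A t) (b t) (x t) (y t) θ')
      ∧ ‖θ (t + 1) - θs‖ ≤ ε
  b_succ : ∀ t : Fin n, b (t + 1) = b t + gradient (paramLoss (x t) (y t)) (θ (t + 1))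
    - β • WithLp.toLp 2
        (Matrix.mulVec (hessian (paramLoss (x t) (y t)) (θ (t + 1))) (θ (t + 1)).ofLp)
  A_succ : ∀ t : Fin n, A (t + 1) = A t + (β / 2) • hessian (paramLoss (x t) (y t)) (θ (t + 1))

/-- The covariance `Φ(x)ᵀ A⁻¹ Φ(x)` of the samples. -/
noncomputable def sampleCov {K d : ℕ} (A : Matrix (Fin K × Fin d) (Fin K × Fin d) ℝ)
    (x : EuclideanSpace ℝ (Fin d)) : Matrix (Fin K) (Fin K) ℝ :=
  Matrix.transpose (feature (K := K) x) * A⁻¹ * feature (K := K) x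

/-- The smoothing `smooth_μ(p) = (1 - μ) p + μ 𝟏 / K`. -/
noncomputable def smooth {K : ℕ} (μ : ℝ) (p : Fin K → ℝ) (k : Fin K) : ℝ :=
  (1 - μ) * p k + μ / K

/-- The prediction `σ⁺(smooth_μ((1/m) ∑_i σ(ω_i)))` with `σ⁺(p)_k = log p_k`. -/
noncomputable def prediction {K m : ℕ} (μ : ℝ) (ω : Fin m → Fin K → ℝ) (k : Fin K) : ℝ :=
  Real.log (smooth μ (fun j => (1 / (m : ℝ)) * ∑ i, softmax (ω i) j) k)

/-- The joint law of all the samples drawn along a run: they are independent, and the `m` samples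
of round `t` are `𝓝(θ_tᵀ Φ(x_t), Φ(x_t)ᵀ A_{t-1}⁻¹ Φ(x_t))`. -/
noncomputable def sampleLaw {n K d : ℕ} (m : ℕ) (x : Fin n → EuclideanSpace ℝ (Fin d))
    (A : ℕ → Matrix (Fin K × Fin d) (Fin K × Fin d) ℝ) (θ : ℕ → Param K d) :
    Measure (Fin n → Fin m → EuclideanSpace ℝ (Fin K)) :=
  Measure.pi fun t : Fin n => Measure.pi fun _ : Fin m =>
    multivariateGaussian (WithLp.toLp 2 (linPred (θ t) (x t))) (sampleCov (A t) (x t))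

/-! ### Machine model: a real RAM with counted loops and a unit-cost count of the operations

The memory consists of arrays of real numbers, which are named by natural numbers and whose cells
are addressed by (multi-)indices. Natural-number variables hold the size parameters, the current
label and the loop counters. There is no branching on real numbers. -/

/-- Index expressions. -/
inductive Index : Type
  | const (c : ℕ)
  | var (v : ℕ)
  | add (a b : Index)
  | sub (a b : Index)

def Index.eval (env : ℕ → ℕ) : Index → ℕ
  | .const c => c
  | .var v => env v
  | .add a b => a.eval env + b.eval env
  | .sub a b => a.eval env - b.eval env

/-- A reference to a memory cell: the name of an array and a multi-index. -/
structure Cell : Type where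
  array : ℕ
  index : List Index

abbrev Memory : Type := ℕ → List ℕ → ℝ

def Cell.read (env : ℕ → ℕ) (M : Memory) (c : Cell) : ℝ :=
  M c.array (c.index.map (Index.eval env))

def Cell.write (env : ℕ → ℕ) (M : Memory) (c : Cell) (r : ℝ) : Memory :=
  Function.update M c.array
    (Function.update (M c.array) (c.index.map (Index.eval env)) r)

inductive UnOp : Type
  | exp | log | sqrt

noncomputable def UnOp.eval : UnOp → ℝ → ℝ
  | .exp, r => Real.exp r
  | .log, r => Real.log r
  | .sqrt, r => Real.sqrt r

inductive BinOp : Type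
  | add | sub | mul | div

noncomputable def BinOp.eval : BinOp → ℝ → ℝ → ℝ
  | .add, r, s => r + s
  | .sub, r, s => r - s
  | .mul, r, s => r * s
  | .div, r, s => r / s

/-- Programs. `forLoop v e c` runs `c` for the values `0, 1, …, e - 1` of the variable `v`. -/
inductive Cmd : Type
  | skip
  | rat (dst : Cell) (q : ℚ)
  | ofIndex (dst : Cell) (e : Index)
  | unary (f : UnOp) (dst src : Cell)
  | binary (f : BinOp) (dst src₁ src₂ : Cell)
  | seq (c₁ c₂ : Cmd)
  | forLoop (v : ℕ) (e : Index) (c : Cmd)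

/-- The effect of a program on the memory. -/
noncomputable def Cmd.exec : Cmd → (ℕ → ℕ) → Memory → Memory
  | .skip, _, M => M
  | .rat dst q, env, M => dst.write env M (q : ℝ)
  | .ofIndex dst e, env, M => dst.write env M (e.eval env : ℝ)
  | .unary f dst src, env, M => dst.write env M (f.eval (src.read env M))
  | .binary f dst src₁ src₂, env, M =>
      dst.write env M (f.eval (src₁.read env M) (src₂.read env M))
  | .seq c₁ c₂, env, M => c₂.exec env (c₁.exec env M)
  | .forLoop v e c, env, M =>
      (List.range (e.eval env)).foldl (fun M' i => c.exec (Function.update env v i) M') M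

/-- The number of steps of a program: one for each elementary instruction, for each entry into a
loop and for each iteration of a loop. It does not depend on the real numbers in the memory. -/
def Cmd.cost : Cmd → (ℕ → ℕ) → ℕ
  | .skip, _ => 1
  | .rat _ _, _ => 1
  | .ofIndex _ _, _ => 1
  | .unary _ _ _, _ => 1
  | .binary _ _ _ _, _ => 1
  | .seq c₁ c₂, env => c₁.cost env + c₂.cost env
  | .forLoop v e c, env =>
      1 + ∑ i ∈ Finset.range (e.eval env), (1 + c.cost (Function.update env v i))

/-- A randomized online learner on this machine: `start` is run once, `predict` when `x_t` and the
fresh random numbers of the round are available, `update` when `y_t` has been revealed. -/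
structure Learner : Type where
  start : Cmd
  predict : Cmd
  update : Cmd

/-- Write a vector into the cells `[0], …, [k-1]` of an array. -/
def storeVec {k : ℕ} (M : Memory) (a : ℕ) (v : Fin k → ℝ) : Memory :=
  Function.update M a fun l =>
    match l with
    | [i] => if h : i < k then v ⟨i, h⟩ else M a [i]
    | l' => M a l'

/-- Write a matrix into the cells `[i, j]`, `i < p`, `j < q`, of an array. -/
def storeMat {p q : ℕ} (M : Memory) (a : ℕ) (v : Fin p → Fin q → ℝ) : Memory :=
  Function.update M a fun l =>
    match l with
    | [i, j] => if h : i < p ∧ j < q then v ⟨i, h.1⟩ ⟨j, h.2⟩ else M a [i, j]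
    | l' => M a l'

/-- The natural-number variables `0, 1, 2, 3` hold `n, K, d, m`, and variable `4` holds the label
(which is `0` as long as no label of the round has been revealed). -/
def sizeEnv (n K d m label : ℕ) : ℕ → ℕ
  | 0 => n
  | 1 => K
  | 2 => d
  | 3 => m
  | 4 => label
  | _ => 0

/-- The memory at the beginning of round `t` (counted from `0`). Array `0` initially holds the
parameters `λ, β, μ`, all other cells hold `0`. In each round `x_t` is stored in array `1` and the
`m × K` random numbers `g_t` of the round in array `2`. -/
noncomputable def Learner.memory {n K d m : ℕ} (P : Learner) (lam β μ : ℝ)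
    (x : Fin n → EuclideanSpace ℝ (Fin d)) (y : Fin n → Fin K) (g : Fin n → Fin m → Fin K → ℝ) :
    ℕ → Memory
  | 0 => P.start.exec (sizeEnv n K d m 0) (storeVec (fun _ _ => 0) 0 ![lam, β, μ])
  | t + 1 =>
      if h : t < n then
        P.update.exec (sizeEnv n K d m (y ⟨t, h⟩)) (P.predict.exec (sizeEnv n K d m 0)
          (storeMat (storeVec (P.memory lam β μ x y g t) 1 (x ⟨t, h⟩).ofLp) 2 (g ⟨t, h⟩)))
      else P.memory lam β μ x y g t

/-- The prediction of round `t`, read from array `3` after `predict` has been run. -/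
noncomputable def Learner.output {n K d m : ℕ} (P : Learner) (lam β μ : ℝ)
    (x : Fin n → EuclideanSpace ℝ (Fin d)) (y : Fin n → Fin K) (g : Fin n → Fin m → Fin K → ℝ)
    (t : Fin n) (k : Fin K) : ℝ :=
  P.predict.exec (sizeEnv n K d m 0)
    (storeMat (storeVec (P.memory lam β μ x y g t) 1 (x t).ofLp) 2 (g t)) 3 [(k : ℕ)]

/-- The total number of steps over the `n` rounds, including the steps for receiving the parameters
and, in each round, for receiving `x_t` and `y_t`, for drawing the `m K` standard Gaussian numbers
and for outputting the prediction. -/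
def Learner.totalCost {n K : ℕ} (P : Learner) (d m : ℕ) (y : Fin n → Fin K) : ℕ :=
  7 + P.start.cost (sizeEnv n K d m 0) +
    ∑ t, (d + m * K + P.predict.cost (sizeEnv n K d m 0) + K + 1
      + P.update.cost (sizeEnv n K d m (y t)))

/-- The law of `n × m × K` independent standard Gaussian numbers. -/
noncomputable def noiseLaw (n m K : ℕ) : Measure (Fin n → Fin m → Fin K → ℝ) :=
  Measure.pi fun _ => Measure.pi fun _ => Measure.pi fun _ => gaussianReal 0 1

/-- On every source of noise, the learner `P` carries out Efficient-GAF, with each argmin computed up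
to the error `ε`; its samples are `ω_{t,i} = θ_tᵀ Φ(x_t) + S_t g_{t,i}`, where `S_t S_tᵀ` is the
covariance matrix prescribed by the algorithm. -/
def Learner.Implements {n K d : ℕ} (P : Learner) (m : ℕ) (lam β μ ε : ℝ)
    (x : Fin n → EuclideanSpace ℝ (Fin d)) (y : Fin n → Fin K) : Prop :=
  ∃ (A : ℕ → Matrix (Fin K × Fin d) (Fin K × Fin d) ℝ) (b θ : ℕ → Param K d)
    (S : Fin n → Matrix (Fin K) (Fin K) ℝ),
    IsRun lam β ε x y A b θ ∧
    (∀ t : Fin n, S t * (S t).transpose = sampleCov (A t) (x t)) ∧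
    ∀ (g : Fin n → Fin m → Fin K → ℝ) (t : Fin n), P.output lam β μ x y g t =
      prediction μ (fun i => linPred (θ t) (x t) + Matrix.mulVec (S t) (g t i))

/-! ### The guarantee -/

/-- The regret bound of exact GAF for logistic regression (up to constants). -/
noncomputable def logisticBound (n K d : ℕ) (B R : ℝ) : ℝ :=
  d * K * B ^ 2 * R ^ 2 +
    d * K * (Real.log K + B * R) * Real.log (1 + n / (d * K * (Real.log K + B * R)))

/-- Against every `θ` in the ball of radius `B`, Efficient-GAF with parameters `λ, β, μ, m` has regret
at most `r` with probability at least `1 - δ`, whenever each argmin is computed exactly or up to the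
error `ε`; and so does the learner `P`. -/
def RegretGuarantee {n K d : ℕ} (P : Learner) (m : ℕ) (lam β μ ε δ B r : ℝ)
    (x : Fin n → EuclideanSpace ℝ (Fin d)) (y : Fin n → Fin K) : Prop :=
  (∀ (A : ℕ → Matrix (Fin K × Fin d) (Fin K × Fin d) ℝ) (b θ : ℕ → Param K d),
    IsRun lam β ε x y A b θ →
      1 - δ ≤ (sampleLaw m x A θ).real {ω | ∀ u : Param K d, ‖u‖ ≤ B →
        regret x y (fun t => prediction μ (fun i => (ω t i).ofLp)) u ≤ r}) ∧
  1 - δ ≤ (noiseLaw n m K).real {g | ∀ u : Param K d, ‖u‖ ≤ B →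
    regret x y (P.output lam β μ x y g) u ≤ r}

end EfficientGAF

open scoped Matrix

namespace EfficientGAF

/-! ### Softmax and logistic loss -/

section Softmax

variable {K : ℕ}

/-! The run `A, b, θ` is deterministic: samples enter only the predictions. The analysis therefore
bounds the loss of the ideal forecast `p_t = E softmax(ω)_{y_t}` without reference to samples, and
afterwards pays for replacing `p_t` by a smoothed empirical mean.

Curvature. The logistic loss lies above its tangent at an arbitrary `z` by a multiple of the
variance of `w - z` under `softmax z`, as soon as `w` is bounded (`logisticLoss_ge_quadratic`). The
resulting quadratic surrogates, expanded at `θ_{t+1}`, add up to `λ‖θ‖²` plus the cumulative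
surrogate loss, which is `b_tᵀθ + θᵀA_tθ` up to a constant. Each round raises the minimum of this
quadratic by at least `gain` (`surrogate_round`), so the gains sum to at most `λB²` plus the loss of
any comparator (`IsRun.sum_gain_le`).

Mixability. With `g` the loss gradient at `z = Φᵀθ_{t+1}` and `S` the sampling covariance, the
optimality condition gives `Φᵀθ_t ≈ z + S g / 2`: the exact minimizer is the center of the next
quadratic. Cauchy-Schwarz with an exponential tilt bounds the mixture loss `-log p_t` by `mixBound`
(`HasNormalMgf.exp_neg_mixBound_le`). For the tilt `-(3/4) g` the terms linear in the deviations
`e_k - p` cancel, and `mixBound` is at most `gain + spread` plus an error linear in the accuracy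
(`mixBound_le`, `IsRun.roundBound_le`). The spread is the trace of `S` against the softmax Hessian.
Since `A_{t+1} - A_t` is that Hessian in parameter space times `β/2`, spreads telescope against `log
det A_t` (`spread_le_log_det`, `IsRun.sum_spread_le`). This yields the logarithmic term of the
regret.

Sampling. The choice of `λ` makes `S` small enough that the second moment of a sampled probability
is at most twice its squared mean. An empirical mean then falls below `(1 - s) p_t` with probability
at most `exp(-m s²/4)`, and `s = 2 μ^{3/2}` makes this `δ/n`. Outside the union of these events
smoothing costs `O(μ)` per round, or at most `log K + log 2` when `μ ≥ 1/2`.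

Computation. Linearizing the loss turns the argmin into a fixed point of a `1/32`-contraction on the
`K` predictions, so `m` iterations of cost `O(K²)` reach error `e^{-m}/R`. The inverse of `A_t` is
maintained by `K` Sherman-Morrison updates of cost `O(K²d²)` per round, and the covariance is
factored by successive Schur complements. A small compiler from array assignments to the machine
language, with a correctness theorem (`fill_spec`) and an exact cost formula (`cost_fill`), reduces
the program to a list of array formulas. -/

theorem sum_exp_pos [NeZero K] (z : Fin K → ℝ) : 0 < ∑ j, Real.exp (z j) :=
  Finset.sum_pos (fun _ _ => Real.exp_pos _) Finset.univ_nonempty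

theorem softmax_pos [NeZero K] (z : Fin K → ℝ) (k : Fin K) : 0 < softmax z k :=
  div_pos (Real.exp_pos _) (sum_exp_pos z)

theorem sum_softmax [NeZero K] (z : Fin K → ℝ) : ∑ k, softmax z k = 1 := by
  simp only [softmax, ← Finset.sum_div]
  exact div_self (sum_exp_pos z).ne'

theorem softmax_le_one [NeZero K] (z : Fin K → ℝ) (k : Fin K) : softmax z k ≤ 1 := by
  rw [← sum_softmax z]
  exact Finset.single_le_sum (fun i _ => (softmax_pos z i).le) (Finset.mem_univ k)

theorem log_softmax [NeZero K] (z : Fin K → ℝ) (k : Fin K) :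
    Real.log (softmax z k) = z k - Real.log (∑ j, Real.exp (z j)) := by
  rw [softmax, Real.log_div (Real.exp_pos _).ne' (sum_exp_pos z).ne', Real.log_exp]

theorem logisticLoss_eq [NeZero K] (z : Fin K → ℝ) (y : Fin K) :
    logisticLoss z y = Real.log (∑ j, Real.exp (z j)) - z y := by
  rw [logisticLoss, log_softmax]; ring

/-- The variance of `u` under the weights `p`. -/
noncomputable def wvar (p u : Fin K → ℝ) : ℝ := ∑ k, p k * (u k - ∑ l, p l * u l) ^ 2

theorem wvar_nonneg {p : Fin K → ℝ} (hp : ∀ k, 0 ≤ p k) (u : Fin K → ℝ) : 0 ≤ wvar p u :=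
  Finset.sum_nonneg fun k _ => mul_nonneg (hp k) (sq_nonneg _)

theorem wvar_eq {p : Fin K → ℝ} (hp : ∑ k, p k = 1) (u : Fin K → ℝ) :
    wvar p u = ∑ k, p k * u k ^ 2 - (∑ k, p k * u k) ^ 2 := by
  have : ∀ c : ℝ, ∑ k, p k * (u k - c) ^ 2 =
      ∑ k, p k * u k ^ 2 - 2 * c * ∑ k, p k * u k + c ^ 2 * ∑ k, p k := by
    intro c
    rw [Finset.mul_sum, Finset.mul_sum, ← Finset.sum_sub_distrib, ← Finset.sum_add_distrib]
    exact Finset.sum_congr rfl fun k _ => by ring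
  rw [wvar, this, hp]; ring

theorem wvar_le_sum_sq {p : Fin K → ℝ} (hp : ∑ k, p k = 1) (u : Fin K → ℝ) :
    wvar p u ≤ ∑ k, p k * u k ^ 2 := by
  rw [wvar_eq hp]; nlinarith [sq_nonneg (∑ k, p k * u k)]

theorem wvar_neg_add_const {p : Fin K → ℝ} (hp : ∑ k, p k = 1) (u : Fin K → ℝ) (c : ℝ) :
    wvar p (fun k => -u k + c) = wvar p u := by
  have : ∑ l, p l * (-u l + c) = -∑ l, p l * u l + c := by
    simp only [mul_add, mul_neg, Finset.sum_add_distrib, Finset.sum_neg_distrib,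
      ← Finset.sum_mul, hp, one_mul]
  simp only [wvar, this]
  exact Finset.sum_congr rfl fun k _ => by ring

/-- For `r ≤ 0` the second factor is already at least `r² / 2`. For `r ≥ 0` it is enough to take `a
= r`, and the claim becomes `2 - r ≤ (r + 2) e^{-r}`, an equality at `0` that persists by
monotonicity. -/
theorem sq_le_mul_sub_one_add_exp_neg {a r : ℝ} (ha : 0 ≤ a) (hr : r ≤ a) :
    r ^ 2 ≤ (a + 2) * (r - 1 + Real.exp (-r)) := by
  have hmono : 0 ≤ r - 1 + Real.exp (-r) := by linarith [Real.add_one_le_exp (-r)]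
  rcases le_total r 0 with h | h
  · have := Real.quadratic_le_exp_of_nonneg (neg_nonneg.2 h)
    nlinarith
  · have key : 2 - r ≤ (r + 2) * Real.exp (-r) := by
      have hanti : AntitoneOn (fun s : ℝ => 2 - s - (s + 2) * Real.exp (-s)) (Set.Ici 0) := by
        have hd : ∀ s : ℝ, HasDerivAt (fun s : ℝ => 2 - s - (s + 2) * Real.exp (-s))
            (-1 + (s + 1) * Real.exp (-s)) s := by
          intro s
          have h1 : HasDerivAt (fun s : ℝ => Real.exp (-s)) (Real.exp (-s) * (-1)) s :=
            (hasDerivAt_neg s).exp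
          refine (((hasDerivAt_id s).const_sub 2).sub
            (((hasDerivAt_id s).add_const 2).mul h1)).congr_deriv ?_
          simp only [id]
          ring
        refine antitoneOn_of_deriv_nonpos (convex_Ici 0)
          (fun s _ => (hd s).continuousAt.continuousWithinAt)
          (fun s _ => (hd s).differentiableAt.differentiableWithinAt) fun s _ => ?_
        rw [(hd s).deriv]
        have := Real.add_one_le_exp s
        have h2 : Real.exp s * Real.exp (-s) = 1 := by rw [← Real.exp_add]; simp
        nlinarith [Real.exp_pos (-s)]
      have := hanti (Set.mem_Ici.2 le_rfl) (Set.mem_Ici.2 h) h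
      norm_num at this
      linarith
    nlinarith

/-- A quadratic lower bound of the logistic loss, valid for bounded first arguments. -/
theorem logisticLoss_ge_quadratic [NeZero K] {w z : Fin K → ℝ} {M : ℝ} (hw : ∀ k, |w k| ≤ M)
    (y : Fin K) :
    logisticLoss z y + (∑ k, softmax z k * (w k - z k) - (w y - z y))
      + (Real.log K + 2 * M + 2)⁻¹ * wvar (softmax z) (fun k => w k - z k) ≤ logisticLoss w y := by
  set lz := Real.log (∑ j, Real.exp (z j))
  set lw := Real.log (∑ j, Real.exp (w j))
  set p := softmax z
  have hp1 : ∑ k, p k = 1 := sum_softmax z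
  have hp0 : ∀ k, 0 < p k := softmax_pos z
  -- `r k` is the log-ratio of `softmax z` to `softmax w`. Its mean under `p` is a Kullback-Leibler
  -- divergence and equals the gap between the loss at `w` and its tangent at `z`.
  let r : Fin K → ℝ := fun k => -(w k - z k) + (lw - lz)
  have hM : 0 ≤ M := (abs_nonneg _).trans (hw y)
  have hK : (1 : ℝ) ≤ K := by exact_mod_cast NeZero.one_le
  have hlK : 0 ≤ Real.log K := Real.log_nonneg hK
  have hlw : lw ≤ Real.log K + M := by
    rw [Real.log_le_iff_le_exp (sum_exp_pos w), Real.exp_add, Real.exp_log (by linarith)]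
    calc ∑ j, Real.exp (w j) ≤ ∑ _j : Fin K, Real.exp M :=
          Finset.sum_le_sum fun k _ => Real.exp_le_exp.2 ((le_abs_self _).trans (hw k))
      _ = K * Real.exp M := by simp
  -- Only an upper bound on the log-ratio is needed. The part depending on `z` is a log-probability,
  -- hence nonpositive, so `z` may be unbounded.
  have hr : ∀ k, r k ≤ Real.log K + 2 * M := by
    intro k
    have h1 : z k - lz ≤ 0 := by
      rw [← log_softmax]; exact Real.log_nonpos (hp0 k).le (softmax_le_one z k)
    have h2 := (abs_le.1 (hw k)).1
    simp only [r]; linarith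
  have hexp : ∀ k, p k * Real.exp (-r k) = softmax w k := by
    intro k
    rw [← Real.exp_log (hp0 k), ← Real.exp_log (softmax_pos w k), ← Real.exp_add, log_softmax,
      log_softmax]
    congr 1; simp only [r]; ring
  have hsum : ∑ k, p k * r k ^ 2 ≤ (Real.log K + 2 * M + 2) * ∑ k, p k * r k := by
    calc ∑ k, p k * r k ^ 2
        ≤ ∑ k, p k * ((Real.log K + 2 * M + 2) * (r k - 1 + Real.exp (-r k))) :=
          Finset.sum_le_sum fun k _ => mul_le_mul_of_nonneg_left
            (sq_le_mul_sub_one_add_exp_neg (by positivity) (hr k)) (hp0 k).le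
      _ = (Real.log K + 2 * M + 2) * ∑ k, (p k * r k - p k + p k * Real.exp (-r k)) := by
          rw [Finset.mul_sum]; exact Finset.sum_congr rfl fun k _ => by ring
      _ = _ := by
          simp only [hexp, Finset.sum_add_distrib, Finset.sum_sub_distrib, hp1, sum_softmax]
          ring
  have hvar : wvar p (fun k => w k - z k) ≤ ∑ k, p k * r k ^ 2 := by
    rw [← wvar_neg_add_const hp1 (fun k => w k - z k) (lw - lz)]
    exact wvar_le_sum_sq hp1 r
  have hmean : ∑ k, p k * r k = lw - lz - ∑ k, p k * (w k - z k) := by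
    simp only [r, mul_add, Finset.sum_add_distrib, mul_neg, Finset.sum_neg_distrib,
      ← Finset.sum_mul, hp1]
    ring
  have hpos : 0 < Real.log K + 2 * M + 2 := by positivity
  have := hvar.trans hsum
  rw [← inv_mul_le_iff₀ hpos, hmean] at this
  rw [logisticLoss_eq, logisticLoss_eq]
  change lz - z y + _ + _ ≤ lw - w y
  linarith

/-- The gradient of the logistic loss. -/
noncomputable def lossGrad (z : Fin K → ℝ) (y : Fin K) (k : Fin K) : ℝ :=
  softmax z k - if k = y then 1 else 0

theorem lossGrad_dotProduct (z : Fin K → ℝ) (y : Fin K) (u : Fin K → ℝ) :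
    lossGrad z y ⬝ᵥ u = ∑ k, softmax z k * u k - u y := by
  simp [dotProduct, lossGrad, sub_mul, Finset.sum_sub_distrib]

theorem sum_abs_lossGrad_le [NeZero K] (z : Fin K → ℝ) (y : Fin K) :
    ∑ k, |lossGrad z y k| ≤ 2 := by
  calc ∑ k, |lossGrad z y k| ≤ ∑ k, (softmax z k + if k = y then (1 : ℝ) else 0) := by
        refine Finset.sum_le_sum fun k _ => (abs_sub _ _).trans ?_
        rw [abs_of_pos (softmax_pos z k)]
        split_ifs <;> simp
    _ = 2 := by rw [Finset.sum_add_distrib, sum_softmax]; norm_num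

theorem logisticLoss_ge_linear [NeZero K] (w z : Fin K → ℝ) (y : Fin K) :
    logisticLoss z y + lossGrad z y ⬝ᵥ (w - z) ≤ logisticLoss w y := by
  have h := logisticLoss_ge_quadratic (z := z) (fun k => norm_le_pi_norm w k) y
  have hK : (1 : ℝ) ≤ K := by exact_mod_cast NeZero.one_le
  have h2 : 0 ≤ (Real.log K + 2 * ‖w‖ + 2)⁻¹ * wvar (softmax z) (fun k => w k - z k) :=
    mul_nonneg (inv_nonneg.2 (by have := Real.log_nonneg hK; positivity))
      (wvar_nonneg (fun k => (softmax_pos z k).le) _)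
  rw [lossGrad_dotProduct]
  simp only [Pi.sub_apply]
  linarith

theorem hasDerivAt_softmax_line [NeZero K] (z u : Fin K → ℝ) (k : Fin K) (s : ℝ) :
    HasDerivAt (fun s : ℝ => softmax (z + s • u) k)
      (softmax (z + s • u) k * (u k - ∑ l, softmax (z + s • u) l * u l)) s := by
  have h1 : ∀ k, HasDerivAt (fun s : ℝ => Real.exp ((z + s • u) k))
      (Real.exp ((z + s • u) k) * u k) s := by
    intro k
    have : HasDerivAt (fun s : ℝ => (z + s • u) k) (u k) s := by
      simpa using ((hasDerivAt_id s).mul_const (u k)).const_add (z k)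
    exact this.exp
  have h2 : HasDerivAt (fun s : ℝ => ∑ l, Real.exp ((z + s • u) l))
      (∑ l, Real.exp ((z + s • u) l) * u l) s := HasDerivAt.fun_sum fun l _ => h1 l
  have hne := (sum_exp_pos (z + s • u)).ne'
  refine ((h1 k).div h2 hne).congr_deriv ?_
  simp only [softmax, div_mul_eq_mul_div, ← Finset.sum_div]
  field_simp

/-- Along the segment from `z` to `w` the derivative is a covariance under the softmax of `a` and `w
- z`. Dually, softmax is 2-Lipschitz from the supremum norm to the `ℓ¹` norm. -/
theorem abs_sum_mul_softmax_sub_le [NeZero K] {a : Fin K → ℝ} {α : ℝ} (ha : ∀ k, |a k| ≤ α)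
    (z w : Fin K → ℝ) :
    |∑ k, a k * (softmax w k - softmax z k)| ≤ 2 * α * ‖w - z‖ := by
  set u := w - z
  have hα : 0 ≤ α := (abs_nonneg _).trans (ha 0)
  have hd : ∀ s : ℝ, HasDerivAt (fun s : ℝ => ∑ k, a k * softmax (z + s • u) k)
      (∑ k, a k * (softmax (z + s • u) k * (u k - ∑ l, softmax (z + s • u) l * u l))) s :=
    fun s => HasDerivAt.fun_sum fun k _ => (hasDerivAt_softmax_line z u k s).const_mul (a k)
  have hb : ∀ s : ℝ,
      ‖∑ k, a k * (softmax (z + s • u) k * (u k - ∑ l, softmax (z + s • u) l * u l))‖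
        ≤ 2 * α * ‖u‖ := by
    intro s
    set p := softmax (z + s • u)
    have hp0 : ∀ k, 0 ≤ p k := fun k => (softmax_pos _ k).le
    have hp1 : ∑ k, p k = 1 := sum_softmax _
    have hmean : |∑ l, p l * u l| ≤ ‖u‖ := by
      refine (Finset.abs_sum_le_sum_abs _ _).trans ?_
      calc ∑ l, |p l * u l| ≤ ∑ l, p l * ‖u‖ := Finset.sum_le_sum fun l _ => by
            rw [abs_mul, abs_of_nonneg (hp0 l)]
            exact mul_le_mul_of_nonneg_left (norm_le_pi_norm u l) (hp0 l)
        _ = ‖u‖ := by rw [← Finset.sum_mul, hp1, one_mul]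
    refine (norm_sum_le _ _).trans ?_
    calc ∑ k, ‖a k * (p k * (u k - ∑ l, p l * u l))‖ ≤ ∑ k, p k * (2 * α * ‖u‖) := by
          refine Finset.sum_le_sum fun k _ => ?_
          rw [Real.norm_eq_abs, abs_mul, abs_mul, abs_of_nonneg (hp0 k), mul_left_comm]
          refine mul_le_mul_of_nonneg_left ?_ (hp0 k)
          have h1 : |u k - ∑ l, p l * u l| ≤ 2 * ‖u‖ := by
            have h0 : |u k| ≤ ‖u‖ := norm_le_pi_norm u k
            linarith [abs_sub (u k) (∑ l, p l * u l)]
          calc |a k| * |u k - ∑ l, p l * u l| ≤ α * (2 * ‖u‖) :=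
                mul_le_mul (ha k) h1 (abs_nonneg _) hα
            _ = _ := by ring
      _ = _ := by rw [← Finset.sum_mul, hp1, one_mul]
  have := norm_image_sub_le_of_norm_deriv_le_segment_01'
    (fun s _ => (hd s).hasDerivWithinAt) (fun s _ => hb s)
  have he : z + u = w := by simp [u]
  simpa [he, mul_sub, Finset.sum_sub_distrib] using this

end Softmax

/-! ### Gradient and Hessian of the loss -/

section Calculus

variable {K d : ℕ}

theorem linPred_apply (θ : Param K d) (x : EuclideanSpace ℝ (Fin d)) (k : Fin K) :
    linPred θ x k = ∑ i, x i * θ (k, i) := by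
  simp only [linPred, Matrix.mulVec, dotProduct, Matrix.transpose_apply, feature, Matrix.of_apply,
    Fintype.sum_prod_type]
  rw [Finset.sum_eq_single k]
  · simp
  · intro l _ hl; simp [hl]
  · simp

theorem feature_mulVec (x : EuclideanSpace ℝ (Fin d)) (w : Fin K → ℝ) (q : Fin K × Fin d) :
    (feature x *ᵥ w) q = w q.1 * x q.2 := by
  simp [Matrix.mulVec, dotProduct, feature, mul_comm]

/-- The coordinate `k` of the linear prediction as a functional of the parameters. -/
noncomputable def predCLM (x : EuclideanSpace ℝ (Fin d)) (k : Fin K) : Param K d →L[ℝ] ℝ :=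
  ∑ i, x i • EuclideanSpace.proj (𝕜 := ℝ) (k, i)

theorem predCLM_apply (x : EuclideanSpace ℝ (Fin d)) (k : Fin K) (θ : Param K d) :
    predCLM x k θ = linPred θ x k := by
  simp [predCLM, linPred_apply]

theorem predCLM_single (x : EuclideanSpace ℝ (Fin d)) (k : Fin K) (q : Fin K × Fin d) :
    predCLM x k (EuclideanSpace.single q 1) = if k = q.1 then x q.2 else 0 := by
  obtain ⟨l, j⟩ := q
  simp only [predCLM_apply, linPred_apply, PiLp.single_apply, Prod.mk.injEq]
  by_cases h : k = l <;> simp [h]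

theorem hasFDerivAt_softmax_linPred [NeZero K] (x : EuclideanSpace ℝ (Fin d)) (k : Fin K)
    (θ : Param K d) :
    HasFDerivAt (fun θ : Param K d => softmax (linPred θ x) k)
      (softmax (linPred θ x) k • (predCLM x k - ∑ l, softmax (linPred θ x) l • predCLM x l)) θ := by
  have h1 : ∀ k, HasFDerivAt (fun θ : Param K d => Real.exp (linPred θ x k))
      (Real.exp (linPred θ x k) • predCLM x k) θ := by
    intro k
    have : HasFDerivAt (fun θ : Param K d => linPred θ x k) (predCLM x k) θ := by
      exact (predCLM x k).hasFDerivAt.congr_of_eventuallyEq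
        (Filter.Eventually.of_forall fun θ => (predCLM_apply x k θ).symm)
    exact this.exp
  have h2 : HasFDerivAt (fun θ : Param K d => ∑ l, Real.exp (linPred θ x l))
      (∑ l, Real.exp (linPred θ x l) • predCLM x l) θ := HasFDerivAt.fun_sum fun l _ => h1 l
  have hne := (sum_exp_pos (linPred θ x)).ne'
  have h3 := (h1 k).mul ((hasDerivAt_inv hne).comp_hasFDerivAt θ h2)
  refine (h3.congr_of_eventuallyEq (Filter.Eventually.of_forall fun θ => ?_)).congr_fderiv ?_
  · simp [softmax, div_eq_mul_inv]
  · ext v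
    simp only [softmax, add_apply, smul_apply,
      sub_apply, sum_apply, smul_eq_mul,
      Function.comp_apply, div_mul_eq_mul_div, ← Finset.sum_div]
    field_simp
    ring

theorem hasFDerivAt_paramLoss [NeZero K] (x : EuclideanSpace ℝ (Fin d)) (y : Fin K)
    (θ : Param K d) :
    HasFDerivAt (paramLoss x y) (∑ l, lossGrad (linPred θ x) y l • predCLM x l) θ := by
  have h1 := ((hasFDerivAt_softmax_linPred x y θ).log (softmax_pos _ y).ne').neg
  refine h1.congr_fderiv ?_
  have hne := (softmax_pos (linPred θ x) y).ne'
  ext v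
  simp only [lossGrad, sub_mul, Finset.sum_sub_distrib, ite_mul, one_mul, zero_mul,
    Finset.sum_ite_eq', Finset.mem_univ, if_true, neg_apply, sum_apply,
    sub_apply, smul_apply, smul_eq_mul]
  field_simp
  ring

theorem gradient_paramLoss [NeZero K] (x : EuclideanSpace ℝ (Fin d)) (y : Fin K) (θ : Param K d) :
    gradient (paramLoss x y) θ = WithLp.toLp 2 (feature x *ᵥ lossGrad (linPred θ x) y) := by
  have : ∀ q, (gradient (paramLoss x y) θ) q = (feature x *ᵥ lossGrad (linPred θ x) y) q := by
    intro q
    have h1 : inner ℝ (gradient (paramLoss x y) θ) (EuclideanSpace.single q 1)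
        = fderiv ℝ (paramLoss x y) θ (EuclideanSpace.single q 1) := by
      rw [gradient, InnerProductSpace.toDual_symm_apply]
    rw [EuclideanSpace.inner_single_right, (hasFDerivAt_paramLoss x y θ).fderiv] at h1
    simp only [one_mul, conj_trivial] at h1
    rw [h1, feature_mulVec]
    simp [sum_apply, predCLM_single]
  ext q
  exact this q

/-- The matrix `diag(p) - p pᵀ`. -/
noncomputable def softHess (p : Fin K → ℝ) : Matrix (Fin K) (Fin K) ℝ :=
  Matrix.of fun k l => p k * ((if k = l then 1 else 0) - p l)

theorem softHess_mulVec (p u : Fin K → ℝ) (k : Fin K) :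
    (softHess p *ᵥ u) k = p k * (u k - ∑ l, p l * u l) := by
  simp only [softHess, Matrix.mulVec, dotProduct, Matrix.of_apply, mul_assoc, ← Finset.mul_sum,
    sub_mul, Finset.sum_sub_distrib]
  simp

theorem hessian_paramLoss [NeZero K] (x : EuclideanSpace ℝ (Fin d)) (y : Fin K) (θ : Param K d) :
    hessian (paramLoss x y) θ =
      feature (K := K) x * softHess (softmax (linPred θ x)) * (feature (K := K) x)ᵀ := by
  ext ⟨k, i⟩ ⟨l, j⟩
  have hR : (feature (K := K) x * softHess (softmax (linPred θ x)) * (feature (K := K) x)ᵀ) (k, i) (l, j)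
      = softHess (softmax (linPred θ x)) k l * x i * x j := by
    simp only [Matrix.mul_apply, feature, Matrix.of_apply, Matrix.transpose_apply]
    simp
    ring_nf
    simp
  have hf : (fun u => fderiv ℝ (paramLoss x y) u (EuclideanSpace.single (l, j) 1))
      = fun u : Param K d => lossGrad (linPred u x) y l * x j := by
    funext u
    rw [(hasFDerivAt_paramLoss x y u).fderiv]
    simp [sum_apply, predCLM_single]
  have hd : HasFDerivAt (fun u : Param K d => lossGrad (linPred u x) y l * x j)
      ((x j) • (softmax (linPred θ x) l •
        (predCLM x l - ∑ q, softmax (linPred θ x) q • predCLM x q))) θ :=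
    ((hasFDerivAt_softmax_linPred x l θ).sub_const _).mul_const (x j)
  rw [hR, hessian, Matrix.of_apply, hf, hd.fderiv]
  simp only [smul_apply, sub_apply,
    sum_apply, predCLM_single, smul_eq_mul, softHess, Matrix.of_apply,
    mul_ite, mul_zero, Finset.sum_ite_eq', Finset.mem_univ, if_true]
  by_cases h : k = l
  · subst h; simp; ring
  · simp [h, Ne.symm h]; ring

end Calculus

/-! ### Symmetric matrices bounded below -/

section Dominates

variable {ι : Type*} [Fintype ι] [DecidableEq ι]

/-- `A` is symmetric and `lam I ≤ A`. -/
structure Dominates (lam : ℝ) (A : Matrix ι ι ℝ) : Prop where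
  symm : Aᵀ = A
  le : ∀ v : ι → ℝ, lam * (v ⬝ᵥ v) ≤ v ⬝ᵥ A *ᵥ v

theorem dotProduct_self_nonneg' (v : ι → ℝ) : 0 ≤ v ⬝ᵥ v :=
  Finset.sum_nonneg fun i _ => mul_self_nonneg (v i)

theorem dotProduct_mulVec_of_symm {A : Matrix ι ι ℝ} (hA : Aᵀ = A) (u v : ι → ℝ) :
    u ⬝ᵥ A *ᵥ v = v ⬝ᵥ A *ᵥ u := by
  rw [Matrix.dotProduct_mulVec, dotProduct_comm, ← Matrix.mulVec_transpose, hA]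

theorem dotProduct_sq_le (u v : ι → ℝ) : (u ⬝ᵥ v) ^ 2 ≤ (u ⬝ᵥ u) * (v ⬝ᵥ v) := by
  simpa only [dotProduct, sq] using Finset.sum_mul_sq_le_sq_mul_sq Finset.univ u v

namespace Dominates

variable {lam : ℝ} {A : Matrix ι ι ℝ}

theorem posDef (h : Dominates lam A) (hl : 0 < lam) : A.PosDef := by
  refine Matrix.PosDef.of_dotProduct_mulVec_pos ?_ fun v hv => ?_
  · rw [Matrix.IsHermitian, Matrix.conjTranspose_eq_transpose_of_trivial, h.symm]
  · have h1 : 0 < v ⬝ᵥ v := lt_of_le_of_ne (dotProduct_self_nonneg' v)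
      fun h0 => hv (dotProduct_self_eq_zero.1 h0.symm)
    simpa using (mul_pos hl h1).trans_le (h.le v)

theorem mul_inv (h : Dominates lam A) (hl : 0 < lam) : A * A⁻¹ = 1 :=
  Matrix.mul_nonsing_inv A (h.posDef hl).det_pos.ne'.isUnit

theorem inv_mul (h : Dominates lam A) (hl : 0 < lam) : A⁻¹ * A = 1 :=
  Matrix.nonsing_inv_mul A (h.posDef hl).det_pos.ne'.isUnit

theorem mulVec_inv_mulVec (h : Dominates lam A) (hl : 0 < lam) (v : ι → ℝ) :
    A *ᵥ (A⁻¹ *ᵥ v) = v := by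
  rw [Matrix.mulVec_mulVec, h.mul_inv hl, Matrix.one_mulVec]

theorem inv_mulVec_mulVec (h : Dominates lam A) (hl : 0 < lam) (v : ι → ℝ) :
    A⁻¹ *ᵥ (A *ᵥ v) = v := by
  rw [Matrix.mulVec_mulVec, h.inv_mul hl, Matrix.one_mulVec]

theorem inv_symm (h : Dominates lam A) : (A⁻¹)ᵀ = A⁻¹ := by
  rw [Matrix.transpose_nonsing_inv, h.symm]

theorem dot_inv_eq (h : Dominates lam A) (hl : 0 < lam) (v : ι → ℝ) :
    v ⬝ᵥ A⁻¹ *ᵥ v = (A⁻¹ *ᵥ v) ⬝ᵥ A *ᵥ (A⁻¹ *ᵥ v) := by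
  rw [h.mulVec_inv_mulVec hl, dotProduct_comm]

theorem dot_nonneg (h : Dominates lam A) (hl : 0 < lam) (v : ι → ℝ) :
    0 ≤ v ⬝ᵥ A *ᵥ v :=
  (mul_nonneg hl.le (dotProduct_self_nonneg' v)).trans (h.le v)

theorem dot_inv_nonneg (h : Dominates lam A) (hl : 0 < lam) (v : ι → ℝ) :
    0 ≤ v ⬝ᵥ A⁻¹ *ᵥ v := by
  rw [h.dot_inv_eq hl]; exact h.dot_nonneg hl _

/-- With `w = A⁻¹ v`, one has `lam |w|² ≤ v · w ≤ |v| |w|`. -/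
theorem inv_sq_le (h : Dominates lam A) (hl : 0 < lam) (v : ι → ℝ) :
    lam ^ 2 * ((A⁻¹ *ᵥ v) ⬝ᵥ (A⁻¹ *ᵥ v)) ≤ v ⬝ᵥ v := by
  set w := A⁻¹ *ᵥ v
  have h1 : lam * (w ⬝ᵥ w) ≤ v ⬝ᵥ w := by
    have := h.le w
    rwa [← h.dot_inv_eq hl] at this
  have h2 := dotProduct_sq_le v w
  have h3 := dotProduct_self_nonneg' w
  have h4 := dotProduct_self_nonneg' v
  rcases h3.eq_or_lt with h0 | h0
  · rw [← h0]; simpa using h4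
  · have h5 : (lam * (w ⬝ᵥ w)) ^ 2 ≤ (v ⬝ᵥ v) * (w ⬝ᵥ w) :=
      (pow_le_pow_left₀ (by positivity) h1 2).trans h2
    refine le_of_mul_le_mul_right ?_ h0
    nlinarith

theorem sq_dot_inv_le (h : Dominates lam A) (hl : 0 < lam) (u v : ι → ℝ) :
    lam ^ 2 * (u ⬝ᵥ A⁻¹ *ᵥ v) ^ 2 ≤ (u ⬝ᵥ u) * (v ⬝ᵥ v) := by
  have h1 := dotProduct_sq_le u (A⁻¹ *ᵥ v)
  have h2 := h.inv_sq_le hl v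
  have h3 := dotProduct_self_nonneg' u
  nlinarith [mul_le_mul_of_nonneg_left h2 h3, mul_le_mul_of_nonneg_left h1 (sq_nonneg lam)]

end Dominates

theorem dominates_smul_one (lam : ℝ) : Dominates lam (lam • (1 : Matrix ι ι ℝ)) :=
  ⟨by simp, fun v => by simp [Matrix.smul_mulVec]⟩

theorem Dominates.add {lam : ℝ} {A N : Matrix ι ι ℝ} (h : Dominates lam A) (hN : Nᵀ = N)
    (hN0 : ∀ v : ι → ℝ, 0 ≤ v ⬝ᵥ N *ᵥ v) : Dominates lam (A + N) :=
  ⟨by rw [Matrix.transpose_add, h.symm, hN], fun v => by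
    rw [Matrix.add_mulVec, dotProduct_add]; linarith [h.le v, hN0 v]⟩

end Dominates

/-! ### Features -/

section Feature

variable {K d : ℕ}

theorem norm_sq_eq_dotProduct {ι : Type*} [Fintype ι] (v : EuclideanSpace ℝ ι) :
    ‖v‖ ^ 2 = v.ofLp ⬝ᵥ v.ofLp := by
  rw [EuclideanSpace.real_norm_sq_eq]
  exact Finset.sum_congr rfl fun i _ => sq _

theorem linPred_eq (θ : Param K d) (x : EuclideanSpace ℝ (Fin d)) :
    linPred θ x = (feature x)ᵀ *ᵥ θ.ofLp := rfl

theorem linPred_sub (θ θ' : Param K d) (x : EuclideanSpace ℝ (Fin d)) :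
    linPred (θ - θ') x = linPred θ x - linPred θ' x := by
  simp [linPred_eq, Matrix.mulVec_sub]

theorem feature_dotProduct (x : EuclideanSpace ℝ (Fin d)) (w : Fin K → ℝ) (θ : Param K d) :
    (feature x *ᵥ w) ⬝ᵥ θ.ofLp = w ⬝ᵥ linPred θ x := by
  rw [linPred_eq, Matrix.dotProduct_mulVec, Matrix.vecMul_transpose]

theorem feature_dotProduct_self (x : EuclideanSpace ℝ (Fin d)) (w : Fin K → ℝ) :
    (feature x *ᵥ w) ⬝ᵥ (feature x *ᵥ w) = ‖x‖ ^ 2 * (w ⬝ᵥ w) := by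
  simp only [dotProduct, feature_mulVec, Fintype.sum_prod_type, EuclideanSpace.real_norm_sq_eq]
  rw [Finset.sum_mul_sum, Finset.sum_comm]
  refine Finset.sum_congr rfl fun k _ => Finset.sum_congr rfl fun i _ => by ring

theorem abs_linPred_le (θ : Param K d) (x : EuclideanSpace ℝ (Fin d)) (k : Fin K) :
    |linPred θ x k| ≤ ‖x‖ * ‖θ‖ := by
  rw [linPred_apply]
  refine abs_le_of_sq_le_sq ?_ (by positivity)
  refine (Finset.sum_mul_sq_le_sq_mul_sq Finset.univ _ _).trans ?_
  rw [mul_pow, EuclideanSpace.real_norm_sq_eq, EuclideanSpace.real_norm_sq_eq,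
    Fintype.sum_prod_type]
  refine mul_le_mul_of_nonneg_left ?_ (Finset.sum_nonneg fun i _ => sq_nonneg _)
  exact Finset.single_le_sum (f := fun k => ∑ i, θ.ofLp (k, i) ^ 2)
    (fun k _ => Finset.sum_nonneg fun i _ => sq_nonneg _) (Finset.mem_univ k)

theorem norm_linPred_le (θ : Param K d) (x : EuclideanSpace ℝ (Fin d)) :
    ‖linPred θ x‖ ≤ ‖x‖ * ‖θ‖ :=
  (pi_norm_le_iff_of_nonneg (by positivity)).2 fun k => abs_linPred_le θ x k

theorem dotProduct_self_le_sum_abs_sq (w : Fin K → ℝ) : w ⬝ᵥ w ≤ (∑ k, |w k|) ^ 2 := by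
  have := Finset.sum_sq_le_sq_sum_of_nonneg (s := Finset.univ) (f := fun k => |w k|)
    (fun k _ => abs_nonneg _)
  simpa [dotProduct, sq_abs, ← sq] using this

theorem abs_dotProduct_le (u w : Fin K → ℝ) : |u ⬝ᵥ w| ≤ (∑ k, |u k|) * ‖w‖ := by
  refine (Finset.abs_sum_le_sum_abs _ _).trans ?_
  rw [Finset.sum_mul]
  refine Finset.sum_le_sum fun k _ => ?_
  rw [abs_mul]
  exact mul_le_mul_of_nonneg_left (norm_le_pi_norm w k) (abs_nonneg _)

theorem dot_sampleCov (A : Matrix (Fin K × Fin d) (Fin K × Fin d) ℝ)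
    (x : EuclideanSpace ℝ (Fin d)) (u w : Fin K → ℝ) :
    u ⬝ᵥ sampleCov A x *ᵥ w = (feature x *ᵥ u) ⬝ᵥ A⁻¹ *ᵥ (feature x *ᵥ w) := by
  rw [sampleCov, ← Matrix.mulVec_mulVec, ← Matrix.mulVec_mulVec, Matrix.dotProduct_mulVec u,
    Matrix.vecMul_transpose]

theorem sampleCov_mulVec (A : Matrix (Fin K × Fin d) (Fin K × Fin d) ℝ)
    (x : EuclideanSpace ℝ (Fin d)) (w : Fin K → ℝ) :
    sampleCov A x *ᵥ w = linPred (WithLp.toLp 2 (A⁻¹ *ᵥ (feature x *ᵥ w))) x := by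
  rw [sampleCov, ← Matrix.mulVec_mulVec, ← Matrix.mulVec_mulVec]; rfl

theorem sampleCov_symm {lam : ℝ} {A : Matrix (Fin K × Fin d) (Fin K × Fin d) ℝ}
    (hA : Dominates lam A) (x : EuclideanSpace ℝ (Fin d)) :
    (sampleCov A x)ᵀ = sampleCov A x := by
  rw [sampleCov, Matrix.transpose_mul, Matrix.transpose_mul, hA.inv_symm,
    Matrix.transpose_transpose, Matrix.mul_assoc]

theorem sampleCov_posSemidef {lam : ℝ} (hl : 0 < lam)
    {A : Matrix (Fin K × Fin d) (Fin K × Fin d) ℝ}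
    (hA : Dominates lam A) (x : EuclideanSpace ℝ (Fin d)) :
    (sampleCov A x).PosSemidef := by
  refine Matrix.PosSemidef.of_dotProduct_mulVec_nonneg ?_ fun v => ?_
  · rw [Matrix.IsHermitian, Matrix.conjTranspose_eq_transpose_of_trivial, sampleCov_symm hA]
  · rw [star_trivial, dot_sampleCov]
    exact hA.dot_inv_nonneg hl _

/-- `A⁻¹` has norm at most `1 / lam` and `Φ(x)` multiplies Euclidean norms by `‖x‖`. The `ℓ¹` form
is the useful one: loss gradients and deviations `e_k - p` have `ℓ¹` norm at most 2 whatever `K` is.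
-/
theorem abs_dot_sampleCov_le {lam : ℝ} (hl : 0 < lam)
    {A : Matrix (Fin K × Fin d) (Fin K × Fin d) ℝ} (hA : Dominates lam A)
    {x : EuclideanSpace ℝ (Fin d)} (hx : 32 * ‖x‖ ^ 2 ≤ lam) (u w : Fin K → ℝ) :
    |u ⬝ᵥ sampleCov A x *ᵥ w| ≤ (∑ k, |u k|) * (∑ k, |w k|) / 32 := by
  have hu : 0 ≤ ∑ k, |u k| := Finset.sum_nonneg fun k _ => abs_nonneg _
  have hw : 0 ≤ ∑ k, |w k| := Finset.sum_nonneg fun k _ => abs_nonneg _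
  refine abs_le_of_sq_le_sq ?_ (by positivity)
  rw [dot_sampleCov]
  have h1 := hA.sq_dot_inv_le hl (feature x *ᵥ u) (feature x *ᵥ w)
  rw [feature_dotProduct_self, feature_dotProduct_self] at h1
  have h2 : (u ⬝ᵥ u) * (w ⬝ᵥ w) ≤ (∑ k, |u k|) ^ 2 * (∑ k, |w k|) ^ 2 :=
    mul_le_mul (dotProduct_self_le_sum_abs_sq u) (dotProduct_self_le_sum_abs_sq w)
      (dotProduct_self_nonneg' w) (sq_nonneg _)
  have h3 : (32 * ‖x‖ ^ 2) ^ 2 ≤ lam ^ 2 := pow_le_pow_left₀ (by positivity) hx 2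
  set q := (feature x *ᵥ u) ⬝ᵥ A⁻¹ *ᵥ (feature x *ᵥ w)
  set a := (∑ k, |u k|) ^ 2 * (∑ k, |w k|) ^ 2
  have h4 : lam ^ 2 * (32 ^ 2 * q ^ 2) ≤ lam ^ 2 * a := by
    have : lam ^ 2 * q ^ 2 ≤ (‖x‖ ^ 2) ^ 2 * a := by
      calc lam ^ 2 * q ^ 2 ≤ (‖x‖ ^ 2) ^ 2 * ((u ⬝ᵥ u) * (w ⬝ᵥ w)) := by linarith
        _ ≤ _ := mul_le_mul_of_nonneg_left h2 (sq_nonneg _)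
    have ha : 0 ≤ a := by positivity
    nlinarith [mul_le_mul_of_nonneg_right h3 ha]
  have h5 := le_of_mul_le_mul_left h4 (by positivity)
  rw [div_pow, mul_pow, le_div_iff₀ (by positivity)]
  linarith

end Feature

/-! ### The update step -/

section Argmin

variable {K d : ℕ}

theorem sum_abs_softmax_sub_le [NeZero K] (z w : Fin K → ℝ) :
    ∑ k, |softmax w k - softmax z k| ≤ 2 * ‖w - z‖ := by
  have h := abs_sum_mul_softmax_sub_le (α := 1)
    (a := fun k => if 0 ≤ softmax w k - softmax z k then 1 else -1)
    (fun k => by split_ifs <;> simp) z w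
  rw [mul_one] at h
  refine le_trans (le_of_eq ?_) ((le_abs_self _).trans h)
  refine Finset.sum_congr rfl fun k _ => ?_
  split_ifs with hk
  · rw [abs_of_nonneg hk, one_mul]
  · rw [abs_of_neg (not_le.1 hk), neg_one_mul]

theorem sum_abs_softmax_sub_le_two [NeZero K] (z w : Fin K → ℝ) :
    ∑ k, |softmax w k - softmax z k| ≤ 2 := by
  calc ∑ k, |softmax w k - softmax z k| ≤ ∑ k, (softmax w k + softmax z k) :=
        Finset.sum_le_sum fun k _ => (abs_sub _ _).trans
          (by rw [abs_of_pos (softmax_pos w k), abs_of_pos (softmax_pos z k)])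
    _ = 2 := by rw [Finset.sum_add_distrib, sum_softmax, sum_softmax]; norm_num

theorem sum_abs_softHess_mulVec_le {p : Fin K → ℝ} (hp0 : ∀ k, 0 ≤ p k) (hp1 : ∑ k, p k = 1)
    (u : Fin K → ℝ) : ∑ k, |(softHess p *ᵥ u) k| ≤ 2 * ‖u‖ := by
  have hmean : |∑ l, p l * u l| ≤ ‖u‖ := by
    have := abs_dotProduct_le p u
    simpa [dotProduct, abs_of_nonneg (hp0 _), hp1] using this
  calc ∑ k, |(softHess p *ᵥ u) k| ≤ ∑ k, p k * (2 * ‖u‖) := by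
        refine Finset.sum_le_sum fun k _ => ?_
        rw [softHess_mulVec, abs_mul, abs_of_nonneg (hp0 k)]
        refine mul_le_mul_of_nonneg_left ?_ (hp0 k)
        have h0 : |u k| ≤ ‖u‖ := norm_le_pi_norm u k
        linarith [abs_sub (u k) (∑ l, p l * u l)]
    _ = _ := by rw [← Finset.sum_mul, hp1, one_mul]

theorem dot_softHess {p : Fin K → ℝ} (hp : ∑ k, p k = 1) (u : Fin K → ℝ) :
    u ⬝ᵥ softHess p *ᵥ u = wvar p u := by
  rw [wvar_eq hp]
  simp only [dotProduct, softHess_mulVec]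
  rw [sq (∑ k, p k * u k), Finset.sum_mul, ← Finset.sum_sub_distrib]
  exact Finset.sum_congr rfl fun k _ => by ring

theorem softHess_symm (p : Fin K → ℝ) : (softHess p)ᵀ = softHess p := by
  ext k l
  simp only [softHess, Matrix.transpose_apply, Matrix.of_apply, eq_comm (a := l) (b := k)]
  split_ifs with h
  · rw [h]
  · ring

theorem Dominates.add_hessian {lam c : ℝ} (hc : 0 ≤ c) {p : Fin K → ℝ} (hp0 : ∀ k, 0 ≤ p k)
    (hp1 : ∑ k, p k = 1) {A : Matrix (Fin K × Fin d) (Fin K × Fin d) ℝ} (hA : Dominates lam A)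
    (x : EuclideanSpace ℝ (Fin d)) :
    Dominates lam (A + c • (feature (K := K) x * softHess p * (feature (K := K) x)ᵀ)) := by
  refine hA.add ?_ fun v => ?_
  · simp [Matrix.transpose_mul, softHess_symm, Matrix.mul_assoc]
  · rw [Matrix.smul_mulVec, dotProduct_smul, smul_eq_mul, ← Matrix.mulVec_mulVec,
      ← Matrix.mulVec_mulVec, Matrix.dotProduct_mulVec v, ← Matrix.mulVec_transpose,
      dot_softHess hp1]
    exact mul_nonneg hc (wvar_nonneg hp0 _)

/-- One step of the fixed point iteration for the argmin: the minimizer after linearization of the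
loss at the prediction `z`. -/
noncomputable def argminStep (A : Matrix (Fin K × Fin d) (Fin K × Fin d) ℝ) (b : Param K d)
    (x : EuclideanSpace ℝ (Fin d)) (y : Fin K) (z : Fin K → ℝ) : Param K d :=
  WithLp.toLp 2 (-(1 / 2 : ℝ) • (A⁻¹ *ᵥ (b.ofLp + feature x *ᵥ lossGrad z y)))

theorem norm_inv_feature_le {lam : ℝ} (hl : 0 < lam)
    {A : Matrix (Fin K × Fin d) (Fin K × Fin d) ℝ} (hA : Dominates lam A)
    (x : EuclideanSpace ℝ (Fin d)) (w : Fin K → ℝ) :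
    ‖(WithLp.toLp 2 (A⁻¹ *ᵥ (feature x *ᵥ w)) : Param K d)‖ ≤ ‖x‖ / lam * ∑ k, |w k| := by
  have hw : 0 ≤ ∑ k, |w k| := Finset.sum_nonneg fun k _ => abs_nonneg _
  refine le_of_sq_le_sq ?_ (by positivity)
  rw [norm_sq_eq_dotProduct, mul_pow, div_pow, div_mul_eq_mul_div, le_div_iff₀ (by positivity)]
  have h1 := hA.inv_sq_le hl (feature x *ᵥ w)
  rw [feature_dotProduct_self] at h1
  have h2 := mul_le_mul_of_nonneg_left (dotProduct_self_le_sum_abs_sq w) (sq_nonneg ‖x‖)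
  dsimp only
  linarith

theorem argminStep_sub (A : Matrix (Fin K × Fin d) (Fin K × Fin d) ℝ) (b : Param K d)
    (x : EuclideanSpace ℝ (Fin d)) (y : Fin K) (z w : Fin K → ℝ) :
    argminStep A b x y w - argminStep A b x y z = (-(1 / 2 : ℝ)) •
      (WithLp.toLp 2 (A⁻¹ *ᵥ (feature x *ᵥ fun k => softmax w k - softmax z k)) : Param K d) := by
  have : (fun k => softmax w k - softmax z k) = lossGrad w y - lossGrad z y := by
    funext k; simp [lossGrad]
  rw [this, argminStep, argminStep, ← WithLp.toLp_sub, ← WithLp.toLp_smul, ← smul_sub,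
    ← Matrix.mulVec_sub, Matrix.mulVec_sub (feature x), add_sub_add_left_eq_sub]

theorem norm_argminStep_sub_le {lam : ℝ} (hl : 0 < lam)
    {A : Matrix (Fin K × Fin d) (Fin K × Fin d) ℝ} (hA : Dominates lam A) (b : Param K d)
    (x : EuclideanSpace ℝ (Fin d)) (y : Fin K) (z w : Fin K → ℝ) :
    ‖argminStep A b x y w - argminStep A b x y z‖ ≤
      ‖x‖ / lam * ((∑ k, |softmax w k - softmax z k|) / 2) := by
  rw [argminStep_sub, norm_smul, norm_neg, Real.norm_of_nonneg (by norm_num)]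
  have := norm_inv_feature_le hl hA x fun k => softmax w k - softmax z k
  linarith

/-- The fixed-point map factors through `softmax z`. Leaving the `ℓ¹` distance of the softmax
vectors in the bound allows two uses: Lipschitz continuity for the contraction, and the crude bound
2 for the first iterate. -/
theorem norm_linPred_argminStep_sub_le [NeZero K] {lam : ℝ} (hl : 0 < lam)
    {A : Matrix (Fin K × Fin d) (Fin K × Fin d) ℝ} (hA : Dominates lam A) (b : Param K d)
    {x : EuclideanSpace ℝ (Fin d)} (hx : 32 * ‖x‖ ^ 2 ≤ lam) (y : Fin K) (z w : Fin K → ℝ) :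
    ‖linPred (argminStep A b x y w) x - linPred (argminStep A b x y z) x‖ ≤
      (1 / 32) * ((∑ k, |softmax w k - softmax z k|) / 2) := by
  have hs : 0 ≤ ∑ k, |softmax w k - softmax z k| := Finset.sum_nonneg fun k _ => abs_nonneg _
  rw [← linPred_sub]
  refine (norm_linPred_le _ _).trans ?_
  refine (mul_le_mul_of_nonneg_left (norm_argminStep_sub_le hl hA b x y z w)
    (norm_nonneg _)).trans ?_
  rw [← mul_assoc]
  refine mul_le_mul_of_nonneg_right ?_ (by positivity)
  rw [← mul_div_assoc, div_le_iff₀ hl]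
  linarith [sq ‖x‖]

/-- Banach's theorem is applied to the `K` predictions, not to the parameters; the parameter is
recovered by one more step. -/
theorem exists_argminStep_fixed [NeZero K] {lam : ℝ} (hl : 0 < lam)
    {A : Matrix (Fin K × Fin d) (Fin K × Fin d) ℝ} (hA : Dominates lam A) (b : Param K d)
    {x : EuclideanSpace ℝ (Fin d)} (hx : 32 * ‖x‖ ^ 2 ≤ lam) (y : Fin K) :
    ∃ θ, argminStep A b x y (linPred θ x) = θ := by
  have hc : ContractingWith (1 / 32) (fun z => linPred (argminStep A b x y z) x) := by
    refine ⟨by rw [div_lt_one (by norm_num)]; norm_num, LipschitzWith.of_dist_le_mul fun w z => ?_⟩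
    rw [dist_eq_norm, dist_eq_norm]
    refine (norm_linPred_argminStep_sub_le hl hA b hx y z w).trans ?_
    have := sum_abs_softmax_sub_le z w
    push_cast
    linarith
  refine ⟨argminStep A b x y (ContractingWith.fixedPoint _ hc), ?_⟩
  exact congrArg _ hc.fixedPoint_isFixedPt

theorem stationary_of_fixed {lam : ℝ} (hl : 0 < lam)
    {A : Matrix (Fin K × Fin d) (Fin K × Fin d) ℝ} (hA : Dominates lam A) {b : Param K d}
    {x : EuclideanSpace ℝ (Fin d)} {y : Fin K} {θ : Param K d}
    (h : argminStep A b x y (linPred θ x) = θ) :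
    (2 : ℝ) • (A *ᵥ θ.ofLp) + b.ofLp + feature x *ᵥ lossGrad (linPred θ x) y = 0 := by
  have h1 := congrArg (fun θ : Param K d => (2 : ℝ) • (A *ᵥ θ.ofLp)) h
  simp only [argminStep, Matrix.mulVec_smul, hA.mulVec_inv_mulVec hl, smul_smul] at h1
  norm_num at h1
  rw [← h1]; abel

/-- At a stationary point the quadratic part contributes exactly the displayed growth and convexity
of the loss makes its contribution nonnegative. This gives both minimality and uniqueness of the
minimizer. -/
theorem objective_sub_ge [NeZero K] {lam : ℝ}
    {A : Matrix (Fin K × Fin d) (Fin K × Fin d) ℝ} (hA : Dominates lam A) {b : Param K d}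
    {x : EuclideanSpace ℝ (Fin d)} {y : Fin K} {θ : Param K d}
    (h : (2 : ℝ) • (A *ᵥ θ.ofLp) + b.ofLp + feature x *ᵥ lossGrad (linPred θ x) y = 0)
    (θ' : Param K d) :
    objective A b x y θ + (θ' - θ).ofLp ⬝ᵥ A *ᵥ (θ' - θ).ofLp ≤ objective A b x y θ' := by
  have h1 := logisticLoss_ge_linear (linPred θ' x) (linPred θ x) y
  rw [← linPred_sub, ← feature_dotProduct] at h1
  have h2 := congrArg (fun v => v ⬝ᵥ (θ' - θ).ofLp) h
  simp only [add_dotProduct, smul_dotProduct, zero_dotProduct, smul_eq_mul] at h2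
  have h3 : (A *ᵥ θ.ofLp) ⬝ᵥ (θ' - θ).ofLp
      = θ'.ofLp ⬝ᵥ A *ᵥ θ.ofLp - θ.ofLp ⬝ᵥ A *ᵥ θ.ofLp := by
    rw [dotProduct_comm, WithLp.ofLp_sub, sub_dotProduct]
  have h4 := dotProduct_mulVec_of_symm hA.symm θ'.ofLp θ.ofLp
  simp only [objective, paramLoss, WithLp.ofLp_sub, Matrix.mulVec_sub, dotProduct_sub,
    sub_dotProduct] at *
  linarith

theorem isMin_of_fixed [NeZero K] {lam : ℝ} (hl : 0 < lam)
    {A : Matrix (Fin K × Fin d) (Fin K × Fin d) ℝ} (hA : Dominates lam A) {b : Param K d}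
    {x : EuclideanSpace ℝ (Fin d)} {y : Fin K} {θ : Param K d}
    (h : argminStep A b x y (linPred θ x) = θ) (θ' : Param K d) :
    objective A b x y θ ≤ objective A b x y θ' := by
  have := objective_sub_ge hA (stationary_of_fixed hl hA h) θ'
  linarith [hA.dot_nonneg hl (θ' - θ).ofLp]

theorem fixed_of_isMin [NeZero K] {lam : ℝ} (hl : 0 < lam)
    {A : Matrix (Fin K × Fin d) (Fin K × Fin d) ℝ} (hA : Dominates lam A) {b : Param K d}
    {x : EuclideanSpace ℝ (Fin d)} (hx : 32 * ‖x‖ ^ 2 ≤ lam) {y : Fin K} {θ : Param K d}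
    (h : ∀ θ', objective A b x y θ ≤ objective A b x y θ') :
    argminStep A b x y (linPred θ x) = θ := by
  obtain ⟨θs, hs⟩ := exists_argminStep_fixed hl hA b hx y
  have h1 := objective_sub_ge hA (stationary_of_fixed hl hA hs) θ
  have h2 := hA.le (θ - θs).ofLp
  have h3 : (θ - θs).ofLp ⬝ᵥ (θ - θs).ofLp ≤ 0 := by
    by_contra h0
    push Not at h0
    have := mul_pos hl h0
    linarith [h θs]
  rw [← norm_sq_eq_dotProduct] at h3
  have h4 : θ - θs = 0 := by
    rw [← norm_eq_zero]; exact pow_eq_zero_iff two_ne_zero |>.1 (le_antisymm h3 (sq_nonneg _))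
  rw [sub_eq_zero.1 h4, hs]

end Argmin

/-! ### Determinants -/

section Det

variable {ι : Type*} [Fintype ι] [DecidableEq ι]

theorem one_add_sum_le_prod_one_add {s : Finset ι} {f : ι → ℝ} (hf : ∀ i, 0 ≤ f i) :
    1 + ∑ i ∈ s, f i ≤ ∏ i ∈ s, (1 + f i) := by
  induction s using Finset.induction_on with
  | empty => simp
  | insert a s ha ih =>
    rw [Finset.sum_insert ha, Finset.prod_insert ha]
    have h1 : 0 ≤ ∑ i ∈ s, f i := Finset.sum_nonneg fun i _ => hf i
    nlinarith [hf a, mul_nonneg (hf a) h1]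

/-- Expanding the product of `1 + λ_i` over the nonnegative eigenvalues leaves at least `1 + ∑ λ_i`.
-/
theorem one_add_trace_le_det {N : Matrix ι ι ℝ} (hN : N.PosSemidef) :
    1 + N.trace ≤ (1 + N).det := by
  have hH := hN.isHermitian
  have h1 : (1 + N).det = ∏ i, (1 + hH.eigenvalues i) := by
    -- The characteristic polynomial at `-1` is `det (1 + N)` up to a sign that occurs on both
    -- sides.
    have h2 := congrArg (Polynomial.eval (-1)) hH.charpoly_eq
    rw [Matrix.eval_charpoly, Polynomial.eval_prod] at h2
    have h3 : Matrix.scalar ι (-1 : ℝ) - N = -(1 + N) := by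
      rw [map_neg, map_one]; abel
    rw [h3, Matrix.det_neg] at h2
    have h4 : ∀ i, Polynomial.eval (-1) (Polynomial.X - Polynomial.C ((hH.eigenvalues i : ℝ)))
        = -1 * (1 + hH.eigenvalues i) := fun i => by simp; ring
    simp only [RCLike.ofReal_real_eq_id, id, h4, Finset.prod_mul_distrib, Finset.prod_const,
      Finset.card_univ] at h2
    exact mul_left_cancel₀ (pow_ne_zero _ (by norm_num)) h2
  rw [h1, hH.trace_eq_sum_eigenvalues]
  simpa using one_add_sum_le_prod_one_add (s := Finset.univ) fun i => hN.eigenvalues_nonneg i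

/-- The arithmetic-geometric mean inequality for the eigenvalues, by bounding the logarithm by its
tangent at their average. -/
theorem log_det_le {A : Matrix ι ι ℝ} (hA : A.PosDef) [Nonempty ι] :
    Real.log A.det ≤ Fintype.card ι * Real.log (A.trace / Fintype.card ι) := by
  have hH := hA.isHermitian
  have hpos := hA.eigenvalues_pos
  have hc : (0 : ℝ) < Fintype.card ι := by exact_mod_cast Fintype.card_pos
  have htr : A.trace = ∑ i, hH.eigenvalues i := by simpa using hH.trace_eq_sum_eigenvalues
  have htr0 : 0 < A.trace := by
    rw [htr]; exact Finset.sum_pos (fun i _ => hpos i) Finset.univ_nonempty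
  set s := A.trace / Fintype.card ι
  have hs : 0 < s := div_pos htr0 hc
  rw [hH.det_eq_prod_eigenvalues]
  simp only [RCLike.ofReal_real_eq_id, id]
  rw [Real.log_prod fun i _ => (hpos i).ne']
  have h1 : ∀ i, Real.log (hH.eigenvalues i) ≤ Real.log s + (hH.eigenvalues i / s - 1) := by
    intro i
    have := Real.log_le_sub_one_of_pos (div_pos (hpos i) hs)
    rw [Real.log_div (hpos i).ne' hs.ne'] at this
    linarith
  refine (Finset.sum_le_sum fun i _ => h1 i).trans (le_of_eq ?_)
  rw [Finset.sum_add_distrib, Finset.sum_sub_distrib, ← Finset.sum_div, ← htr]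
  have : A.trace / s = Fintype.card ι := by
    simp only [s]; field_simp
  rw [this]
  simp

/-- The determinant lemma moves the perturbation to `1 + Vᵀ A⁻¹ V`, whose determinant is at least
one plus its trace. -/
theorem det_add_mul_transpose_ge {κ : Type*} [Fintype κ] [DecidableEq κ] {lam : ℝ} (hl : 0 < lam)
    {A : Matrix ι ι ℝ} (hA : Dominates lam A) (V : Matrix ι κ ℝ) :
    A.det * (1 + (Vᵀ * A⁻¹ * V).trace) ≤ (A + V * Vᵀ).det := by
  have hpos := (hA.posDef hl).det_pos
  rw [Matrix.det_add_mul _ _ hpos.ne'.isUnit]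
  refine mul_le_mul_of_nonneg_left (one_add_trace_le_det ?_) hpos.le
  refine Matrix.PosSemidef.of_dotProduct_mulVec_nonneg ?_ fun v => ?_
  · rw [Matrix.IsHermitian, Matrix.conjTranspose_eq_transpose_of_trivial, Matrix.transpose_mul,
      Matrix.transpose_mul, hA.inv_symm, Matrix.transpose_transpose, Matrix.mul_assoc]
  · rw [star_trivial, ← Matrix.mulVec_mulVec, ← Matrix.mulVec_mulVec, Matrix.dotProduct_mulVec v,
      Matrix.vecMul_transpose]
    exact hA.dot_inv_nonneg hl _

end Det

/-! ### The spread of the sampling covariance and the determinant potential -/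

section Spread

variable {K d : ℕ}

/-- The deviation `e_k - p`. -/
def dev (p : Fin K → ℝ) (k : Fin K) : Fin K → ℝ := Pi.single k 1 - p

/-- `∑_k p_k (e_k - p)ᵀ S (e_k - p)`. -/
noncomputable def spread (S : Matrix (Fin K) (Fin K) ℝ) (p : Fin K → ℝ) : ℝ :=
  ∑ k, p k * (dev p k ⬝ᵥ S *ᵥ dev p k)

theorem sum_abs_dev_le {p : Fin K → ℝ} (hp0 : ∀ k, 0 ≤ p k) (hp1 : ∑ k, p k = 1) (k : Fin K) :
    ∑ l, |dev p k l| ≤ 2 := by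
  calc ∑ l, |dev p k l| ≤ ∑ l, ((Pi.single k 1 : Fin K → ℝ) l + p l) := by
        refine Finset.sum_le_sum fun l _ => (abs_sub _ _).trans ?_
        rw [abs_of_nonneg (hp0 l), abs_of_nonneg]
        by_cases h : l = k
        · subst h; simp
        · simp [h]
    _ = 2 := by rw [Finset.sum_add_distrib, hp1]; norm_num

/-- A square root of `c (diag(p) - p pᵀ)`. -/
noncomputable def devRoot (c : ℝ) (p : Fin K → ℝ) : Matrix (Fin K) (Fin K) ℝ :=
  Matrix.of fun l k => Real.sqrt (c * p k) * dev p k l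

theorem devRoot_mul_transpose {c : ℝ} (hc : 0 ≤ c) {p : Fin K → ℝ} (hp0 : ∀ k, 0 ≤ p k)
    (hp1 : ∑ k, p k = 1) : devRoot c p * (devRoot c p)ᵀ = c • softHess p := by
  ext l m
  have h : ∀ k, Real.sqrt (c * p k) * dev p k l * (Real.sqrt (c * p k) * dev p k m)
      = c * (p k * ((if k = l then 1 else 0) * (if k = m then 1 else 0))
        - p m * (p k * (if k = l then 1 else 0)) - p l * (p k * (if k = m then 1 else 0))
          + p l * p m * p k) := by
    intro k
    have h1 : Real.sqrt (c * p k) * Real.sqrt (c * p k) = c * p k :=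
      Real.mul_self_sqrt (mul_nonneg hc (hp0 k))
    have h2 : ∀ l, dev p k l = (if k = l then 1 else 0) - p l := fun l => by
      simp [dev, Pi.single_apply, eq_comm (a := k)]
    rw [h2, h2]
    linear_combination ((if k = l then 1 else 0) - p l) * ((if k = m then 1 else 0) - p m) * h1
  simp only [Matrix.mul_apply, devRoot, Matrix.transpose_apply, Matrix.of_apply, h,
    Matrix.smul_apply, softHess, smul_eq_mul, ← Finset.mul_sum, Finset.sum_add_distrib,
    Finset.sum_sub_distrib, hp1]
  simp only [mul_ite, mul_one, mul_zero, Finset.sum_ite_eq', Finset.mem_univ, if_true]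
  by_cases h : l = m
  · subst h
    simp only [if_true]
    ring
  · simp only [h, Ne.symm h, if_false]
    ring

theorem trace_devRoot {c : ℝ} (hc : 0 ≤ c) {p : Fin K → ℝ} (hp0 : ∀ k, 0 ≤ p k)
    (S : Matrix (Fin K) (Fin K) ℝ) :
    ((devRoot c p)ᵀ * S * devRoot c p).trace = c * spread S p := by
  simp only [Matrix.trace, Matrix.diag_apply, spread, Finset.mul_sum]
  refine Finset.sum_congr rfl fun k _ => ?_
  have h1 : Real.sqrt (c * p k) * Real.sqrt (c * p k) = c * p k :=
    Real.mul_self_sqrt (mul_nonneg hc (hp0 k))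
  have h2 : ((devRoot c p)ᵀ * S * devRoot c p) k k
      = (fun l => devRoot c p l k) ⬝ᵥ S *ᵥ (fun l => devRoot c p l k) := by
    rw [Matrix.dotProduct_mulVec]; rfl
  have h3 : (fun l => devRoot c p l k) = Real.sqrt (c * p k) • dev p k := by
    funext l; simp [devRoot]
  rw [h2, h3, Matrix.mulVec_smul, dotProduct_smul, smul_dotProduct, smul_eq_mul, smul_eq_mul,
    ← mul_assoc, h1, mul_assoc]

theorem det_add_hessian_ge {lam c : ℝ} (hl : 0 < lam) (hc : 0 ≤ c) {p : Fin K → ℝ}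
    (hp0 : ∀ k, 0 ≤ p k) (hp1 : ∑ k, p k = 1)
    {A : Matrix (Fin K × Fin d) (Fin K × Fin d) ℝ} (hA : Dominates lam A)
    (x : EuclideanSpace ℝ (Fin d)) :
    A.det * (1 + c * spread (sampleCov A x) p) ≤
      (A + c • (feature (K := K) x * softHess p * (feature (K := K) x)ᵀ)).det := by
  have h := det_add_mul_transpose_ge hl hA (feature (K := K) x * devRoot c p)
  have h1 : feature (K := K) x * devRoot c p * (feature (K := K) x * devRoot c p)ᵀ =
      c • (feature (K := K) x * softHess p * (feature (K := K) x)ᵀ) := by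
    rw [Matrix.transpose_mul, Matrix.mul_assoc, ← Matrix.mul_assoc (devRoot c p),
      devRoot_mul_transpose hc hp0 hp1]
    simp [Matrix.mul_assoc]
  have h2 : (feature (K := K) x * devRoot c p)ᵀ * A⁻¹ * (feature (K := K) x * devRoot c p) =
      (devRoot c p)ᵀ * sampleCov A x * devRoot c p := by
    simp only [Matrix.transpose_mul, sampleCov, Matrix.mul_assoc]
  rwa [h1, h2, trace_devRoot hc hp0] at h

theorem trace_hessian_le {p : Fin K → ℝ} (hp0 : ∀ k, 0 ≤ p k) (hp1 : ∑ k, p k = 1)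
    (x : EuclideanSpace ℝ (Fin d)) :
    (feature (K := K) x * softHess p * (feature (K := K) x)ᵀ).trace ≤ ‖x‖ ^ 2 := by
  have h : ∀ k i, (feature (K := K) x * softHess p * (feature (K := K) x)ᵀ) (k, i) (k, i)
      ≤ p k * x i ^ 2 := by
    intro k i
    have : (feature (K := K) x * softHess p * (feature (K := K) x)ᵀ) (k, i) (k, i)
        = x i * softHess p k k * x i := by
      simp [Matrix.mul_apply, feature]
    rw [this, softHess, Matrix.of_apply, if_pos rfl]
    nlinarith [mul_nonneg (mul_nonneg (hp0 k) (hp0 k)) (sq_nonneg (x i))]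
  simp only [Matrix.trace, Matrix.diag_apply, Fintype.sum_prod_type]
  refine (Finset.sum_le_sum fun k _ => Finset.sum_le_sum fun i _ => h k i).trans (le_of_eq ?_)
  simp only [← Finset.mul_sum, ← Finset.sum_mul, hp1, one_mul, EuclideanSpace.real_norm_sq_eq]

theorem spread_nonneg {lam : ℝ} (hl : 0 < lam)
    {A : Matrix (Fin K × Fin d) (Fin K × Fin d) ℝ} (hA : Dominates lam A)
    (x : EuclideanSpace ℝ (Fin d)) {p : Fin K → ℝ} (hp0 : ∀ k, 0 ≤ p k) :
    0 ≤ spread (sampleCov A x) p :=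
  Finset.sum_nonneg fun k _ => mul_nonneg (hp0 k)
    (by rw [dot_sampleCov]; exact hA.dot_inv_nonneg hl _)

theorem dot_dev_le {lam : ℝ} (hl : 0 < lam)
    {A : Matrix (Fin K × Fin d) (Fin K × Fin d) ℝ} (hA : Dominates lam A)
    {x : EuclideanSpace ℝ (Fin d)} (hx : 32 * ‖x‖ ^ 2 ≤ lam) {p : Fin K → ℝ}
    (hp0 : ∀ k, 0 ≤ p k) (hp1 : ∑ k, p k = 1) (k : Fin K) :
    dev p k ⬝ᵥ sampleCov A x *ᵥ dev p k ≤ 1 / 8 := by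
  have h1 := (le_abs_self _).trans (abs_dot_sampleCov_le hl hA hx (dev p k) (dev p k))
  have h2 := sum_abs_dev_le hp0 hp1 k
  have h3 : 0 ≤ ∑ l, |dev p k l| := Finset.sum_nonneg fun _ _ => abs_nonneg _
  nlinarith

theorem spread_le {lam : ℝ} (hl : 0 < lam)
    {A : Matrix (Fin K × Fin d) (Fin K × Fin d) ℝ} (hA : Dominates lam A)
    {x : EuclideanSpace ℝ (Fin d)} (hx : 32 * ‖x‖ ^ 2 ≤ lam) {p : Fin K → ℝ}
    (hp0 : ∀ k, 0 ≤ p k) (hp1 : ∑ k, p k = 1) :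
    spread (sampleCov A x) p ≤ 1 / 8 := by
  calc spread (sampleCov A x) p ≤ ∑ k, p k * (1 / 8) := Finset.sum_le_sum fun k _ =>
        mul_le_mul_of_nonneg_left (dot_dev_le hl hA hx hp0 hp1 k) (hp0 k)
    _ = 1 / 8 := by rw [← Finset.sum_mul, hp1, one_mul]

/-- One round of the logarithmic determinant potential. -/
theorem spread_le_log_det {lam β : ℝ} (hl : 0 < lam) (hβ : 0 < β) (hβ1 : β ≤ 1)
    {A : Matrix (Fin K × Fin d) (Fin K × Fin d) ℝ} (hA : Dominates lam A)
    {x : EuclideanSpace ℝ (Fin d)} (hx : 32 * ‖x‖ ^ 2 ≤ lam) {p : Fin K → ℝ}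
    (hp0 : ∀ k, 0 ≤ p k) (hp1 : ∑ k, p k = 1) :
    spread (sampleCov A x) p ≤ 4 / β *
      (Real.log (A + (β / 2) • (feature (K := K) x * softHess p * (feature (K := K) x)ᵀ)).det
        - Real.log A.det) := by
  have h0 := spread_nonneg hl hA x hp0
  have h1 := spread_le hl hA hx hp0 hp1
  have hd := (hA.posDef hl).det_pos
  set s := β / 2 * spread (sampleCov A x) p
  have hs0 : 0 ≤ s := by positivity
  have hs1 : s ≤ 1 := by simp only [s]; nlinarith
  have h2 := Real.log_le_log (by positivity)
    (det_add_hessian_ge hl (half_pos hβ).le hp0 hp1 hA x)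
  rw [Real.log_mul hd.ne' (by positivity)] at h2
  -- Here `s ≤ 1` is essential; it comes from `spread ≤ 1 / 8`. As `s` is `β / 2` times the spread,
  -- the halved logarithm bound gives the constant `4 / β`.
  have h3 : s / 2 ≤ Real.log (1 + s) := by
    have h4 := Real.one_sub_inv_le_log_of_pos (x := 1 + s) (by positivity)
    have h5 : s / 2 ≤ 1 - (1 + s)⁻¹ := by
      rw [le_sub_iff_add_le, ← le_sub_iff_add_le', inv_le_iff_one_le_mul₀ (by positivity)]
      nlinarith
    linarith
  rw [div_mul_eq_mul_div, le_div_iff₀ hβ]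
  simp only [s] at h3 h2
  linarith

end Spread

/-! ### The deterministic part of the regret analysis -/

section Round

variable {K d : ℕ}

/-- The minimizer of `bᵀ θ + θᵀ A θ`. -/
noncomputable def center (A : Matrix (Fin K × Fin d) (Fin K × Fin d) ℝ) (b : Param K d) :
    Param K d :=
  WithLp.toLp 2 (-(1 / 2 : ℝ) • (A⁻¹ *ᵥ b.ofLp))

theorem quadratic_eq_center {lam : ℝ} (hl : 0 < lam)
    {A : Matrix (Fin K × Fin d) (Fin K × Fin d) ℝ} (hA : Dominates lam A) (b θ : Param K d) :
    b.ofLp ⬝ᵥ θ.ofLp + θ.ofLp ⬝ᵥ A *ᵥ θ.ofLp =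
      b.ofLp ⬝ᵥ (center A b).ofLp + (center A b).ofLp ⬝ᵥ A *ᵥ (center A b).ofLp +
        (θ - center A b).ofLp ⬝ᵥ A *ᵥ (θ - center A b).ofLp := by
  set c := center A b
  have hb : b.ofLp = -(2 : ℝ) • (A *ᵥ c.ofLp) := by
    simp only [c, center, Matrix.mulVec_smul, hA.mulVec_inv_mulVec hl, smul_smul]
    norm_num
  have h4 := dotProduct_mulVec_of_symm hA.symm c.ofLp θ.ofLp
  rw [hb]
  simp only [WithLp.ofLp_sub, Matrix.mulVec_sub, dotProduct_sub, sub_dotProduct, smul_dotProduct,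
    smul_eq_mul, dotProduct_comm (A *ᵥ c.ofLp)]
  linarith

/-- The lower bound of the cumulative surrogate loss increases by at least this in a round with
center prediction `zc`, covariance `S` and linearization at `z`. -/
noncomputable def gain (S : Matrix (Fin K) (Fin K) ℝ) (zc z : Fin K → ℝ) (y : Fin K) : ℝ :=
  logisticLoss z y + lossGrad z y ⬝ᵥ (zc - z) - 1 / 4 * (lossGrad z y ⬝ᵥ S *ᵥ lossGrad z y)

/-- The quadratic surrogate of the loss at the prediction `z`. -/
noncomputable def surrogate (β : ℝ) (z : Fin K → ℝ) (y : Fin K) (w : Fin K → ℝ) : ℝ :=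
  logisticLoss z y + lossGrad z y ⬝ᵥ (w - z) + β / 2 * wvar (softmax z) (w - z)

/-- `β / 2` is at most the reciprocal of `log K + 2 M + 2`, the constant of the quadratic lower
bound. Nothing is asked of the expansion point. -/
theorem surrogate_le [NeZero K] {β M : ℝ} (hβ : β ≤ (Real.log K / 2 + M + 1)⁻¹)
    {w : Fin K → ℝ} (hw : ∀ k, |w k| ≤ M) (z : Fin K → ℝ) (y : Fin K) :
    surrogate β z y w ≤ logisticLoss w y := by
  have h := logisticLoss_ge_quadratic (z := z) hw y
  have hM : 0 ≤ M := (abs_nonneg _).trans (hw y)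
  have hK : 0 ≤ Real.log K := Real.log_nonneg (by exact_mod_cast NeZero.one_le)
  have h2 : β / 2 ≤ (Real.log K + 2 * M + 2)⁻¹ := by
    calc β / 2 ≤ (Real.log K / 2 + M + 1)⁻¹ / 2 := by linarith
      _ = (Real.log K + 2 * M + 2)⁻¹ := by
        rw [div_eq_mul_inv, ← mul_inv]; congr 1; ring
  have h3 := mul_le_mul_of_nonneg_right h2
    (wvar_nonneg (fun k => (softmax_pos z k).le) (w - z))
  rw [surrogate, lossGrad_dotProduct]
  have h4 : (w - z) = fun k => w k - z k := rfl
  simp only [h4] at *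
  linarith

theorem wvar_sub [NeZero K] (z w : Fin K → ℝ) :
    wvar (softmax z) (w - z) = w ⬝ᵥ softHess (softmax z) *ᵥ w
      - 2 * ((softHess (softmax z) *ᵥ z) ⬝ᵥ w) + z ⬝ᵥ softHess (softmax z) *ᵥ z := by
  rw [← dot_softHess (sum_softmax z)]
  have := dotProduct_mulVec_of_symm (softHess_symm (softmax z)) z w
  simp only [Matrix.mulVec_sub, dotProduct_sub, sub_dotProduct,
    dotProduct_comm (softHess (softmax z) *ᵥ z)]
  linarith

/-- Inductive step for two facts about the cumulative surrogate: it stays a quadratic with data `A,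
b`, and its minimum is at least the sum of the gains. In the growth step the variance term is
dropped, and `gᵀv + vᵀAv` is minimized over the displacement `v` from the old center; the minimum is
`-gᵀS g / 4`. -/
theorem surrogate_round [NeZero K] {lam β : ℝ} (hl : 0 < lam) (hβ : 0 ≤ β)
    {A A' : Matrix (Fin K × Fin d) (Fin K × Fin d) ℝ} {b b' : Param K d}
    {x : EuclideanSpace ℝ (Fin d)} {y : Fin K} {z : Fin K → ℝ} (hA : Dominates lam A)
    (hA' : Dominates lam A')
    (eA : A' = A + (β / 2) • (feature (K := K) x * softHess (softmax z) * (feature (K := K) x)ᵀ))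
    (eb : b'.ofLp = b.ofLp + feature x *ᵥ lossGrad z y
      - β • (feature x *ᵥ (softHess (softmax z) *ᵥ z)))
    {Q : Param K d → ℝ} {c ρ : ℝ} (hQ : ∀ θ, Q θ = c + (b.ofLp ⬝ᵥ θ.ofLp + θ.ofLp ⬝ᵥ A *ᵥ θ.ofLp))
    (hρ : ∀ θ, ρ + (θ - center A b).ofLp ⬝ᵥ A *ᵥ (θ - center A b).ofLp ≤ Q θ) :
    (∃ c', ∀ θ, Q θ + surrogate β z y (linPred θ x) =
      c' + (b'.ofLp ⬝ᵥ θ.ofLp + θ.ofLp ⬝ᵥ A' *ᵥ θ.ofLp)) ∧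
    ∀ θ, ρ + gain (sampleCov A x) (linPred (center A b) x) z y +
      (θ - center A' b').ofLp ⬝ᵥ A' *ᵥ (θ - center A' b').ofLp ≤
        Q θ + surrogate β z y (linPred θ x) := by
  set g := lossGrad z y
  set H := softHess (softmax z)
  have h1 : ∃ c', ∀ θ, Q θ + surrogate β z y (linPred θ x) =
      c' + (b'.ofLp ⬝ᵥ θ.ofLp + θ.ofLp ⬝ᵥ A' *ᵥ θ.ofLp) := by
    refine ⟨c + (logisticLoss z y - g ⬝ᵥ z + β / 2 * (z ⬝ᵥ H *ᵥ z)), fun θ => ?_⟩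
    have e1 : θ.ofLp ⬝ᵥ (feature (K := K) x * H * (feature (K := K) x)ᵀ) *ᵥ θ.ofLp
        = linPred θ x ⬝ᵥ H *ᵥ linPred θ x := by
      rw [← Matrix.mulVec_mulVec, ← Matrix.mulVec_mulVec, Matrix.dotProduct_mulVec θ.ofLp,
        ← Matrix.mulVec_transpose, linPred_eq]
    rw [hQ, surrogate, wvar_sub, eA, eb, Matrix.add_mulVec, dotProduct_add, Matrix.smul_mulVec,
      dotProduct_smul, e1, sub_dotProduct, add_dotProduct, smul_dotProduct, feature_dotProduct,
      feature_dotProduct, dotProduct_sub, smul_eq_mul, smul_eq_mul]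
    ring
  refine ⟨h1, fun θ => ?_⟩
  obtain ⟨c', hc'⟩ := h1
  set m := center A' b'
  have h2 : Q θ + surrogate β z y (linPred θ x) = Q m + surrogate β z y (linPred m x) +
      (θ - m).ofLp ⬝ᵥ A' *ᵥ (θ - m).ofLp := by
    rw [hc', hc', quadratic_eq_center hl hA' b' θ]; ring
  rw [h2]
  have h3 := hρ m
  have h4 : logisticLoss z y + g ⬝ᵥ (linPred m x - z) ≤ surrogate β z y (linPred m x) := by
    have := wvar_nonneg (fun k => (softmax_pos z k).le) (linPred m x - z)
    rw [surrogate]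
    have : 0 ≤ β / 2 * wvar (softmax z) (linPred m x - z) := by positivity
    linarith
  set v := (m - center A b).ofLp
  have h5 : g ⬝ᵥ (linPred m x - z) = g ⬝ᵥ (linPred (center A b) x - z) + (feature x *ᵥ g) ⬝ᵥ v := by
    rw [feature_dotProduct x g (m - center A b), linPred_sub, ← dotProduct_add]
    congr 1; abel
  set w := A⁻¹ *ᵥ (feature x *ᵥ g)
  -- Completing the square: `-w / 2` is the minimizer of `gᵀ Φᵀ v + vᵀ A v`.
  have h6 := hA.dot_nonneg hl (v + (1 / 2 : ℝ) • w)
  have h7 : A *ᵥ w = feature x *ᵥ g := hA.mulVec_inv_mulVec hl _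
  have h8 : w ⬝ᵥ A *ᵥ v = (feature x *ᵥ g) ⬝ᵥ v := by
    rw [dotProduct_mulVec_of_symm hA.symm, h7, dotProduct_comm]
  have h9 : g ⬝ᵥ sampleCov A x *ᵥ g = w ⬝ᵥ A *ᵥ w := by
    rw [dot_sampleCov, hA.dot_inv_eq hl]
  rw [Matrix.mulVec_add, Matrix.mulVec_smul, add_dotProduct, dotProduct_add, dotProduct_add,
    smul_dotProduct, smul_dotProduct, dotProduct_smul, dotProduct_smul, h8, h7,
    dotProduct_comm v (feature x *ᵥ g), dotProduct_comm w (feature x *ᵥ g)] at h6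
  rw [h7, dotProduct_comm w] at h9
  simp only [smul_eq_mul] at h6
  simp only [gain]
  linarith

/-- The logarithm of the moment bound for the inverse expected softmax. -/
noncomputable def mixBound (S : Matrix (Fin K) (Fin K) ℝ) (z : Fin K → ℝ) (y : Fin K)
    (a : Fin K → ℝ) : ℝ :=
  Real.log (∑ k, Real.exp (z k - z y + 1 / 2 *
    ((Pi.single k 1 - Pi.single y 1 + (2 : ℝ) • a) ⬝ᵥ
      S *ᵥ (Pi.single k 1 - Pi.single y 1 + (2 : ℝ) • a)))) - a ⬝ᵥ S *ᵥ a

/-- With tilt `-(3/4) g` the exponent for class `k` contains the quadratic form of `e_k - p - g /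
2`. Its cross term is cancelled by the shift `S g / 2` of the sampling mean `zt`. What remains is
the softmax sum of `exp` of half the variances of `e_k - p`, and the coefficient `1/8 - 9/16 =
-7/16` of `gᵀ S g`. The number `r` measures the failure of the relation `zt = z + S g / 2`. -/
theorem mixBound_le [NeZero K] {S : Matrix (Fin K) (Fin K) ℝ} (hS : Sᵀ = S)
    (hS0 : ∀ u, 0 ≤ u ⬝ᵥ S *ᵥ u) (z zt : Fin K → ℝ) (y : Fin K)
    (hv : ∀ k, dev (softmax z) k ⬝ᵥ S *ᵥ dev (softmax z) k ≤ 1 / 8) {r : ℝ}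
    (hr : ‖zt - z - (1 / 2 : ℝ) • (S *ᵥ lossGrad z y)‖ ≤ r) :
    mixBound S zt y (-(3 / 4 : ℝ) • lossGrad z y) ≤
      logisticLoss z y + spread S (softmax z) + 2 * r + lossGrad z y ⬝ᵥ (zt - z)
        - 7 / 16 * (lossGrad z y ⬝ᵥ S *ᵥ lossGrad z y) := by
  set g := lossGrad z y with hg
  set p := softmax z with hp
  set ρ := zt - z - (1 / 2 : ℝ) • (S *ᵥ g) with hρ
  have hp0 : ∀ k, 0 ≤ p k := fun k => (softmax_pos z k).le
  have hp1 : ∑ k, p k = 1 := sum_softmax z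
  have hgdev : ∀ k, Pi.single k 1 - Pi.single y 1 = dev p k + g := by
    intro k
    funext l
    simp only [dev, g, lossGrad, Pi.add_apply, Pi.sub_apply, ← hp, Pi.single_apply]
    ring
  set G := g ⬝ᵥ S *ᵥ g
  have hexpo : ∀ k, zt k - zt y + 1 / 2 * ((Pi.single k 1 - Pi.single y 1 + (2 : ℝ) •
      (-(3 / 4 : ℝ) • g)) ⬝ᵥ S *ᵥ (Pi.single k 1 - Pi.single y 1 + (2 : ℝ) • (-(3 / 4 : ℝ) • g)))
      ≤ (z k - z y + dev p k ⬝ᵥ S *ᵥ dev p k / 2) + (2 * r + g ⬝ᵥ (zt - z) + 1 / 8 * G) := by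
    intro k
    have e1 : Pi.single k 1 - Pi.single y 1 + (2 : ℝ) • (-(3 / 4 : ℝ) • g)
        = dev p k - (1 / 2 : ℝ) • g := by
      rw [hgdev, smul_smul]; module
    have e2 : zt k - zt y = z k - z y + (dev p k + g) ⬝ᵥ (zt - z) := by
      rw [← hgdev, sub_dotProduct, single_one_dotProduct, single_one_dotProduct]
      simp only [Pi.sub_apply]; ring
    -- The second term is the one that cancels against the cross term in `e7`.
    have e3 : dev p k ⬝ᵥ (zt - z) = dev p k ⬝ᵥ ρ + 1 / 2 * (dev p k ⬝ᵥ S *ᵥ g) := by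
      rw [hρ, dotProduct_sub _ (zt - z), dotProduct_smul, smul_eq_mul]; ring
    have e4 := dotProduct_mulVec_of_symm hS g (dev p k)
    have e5 : dev p k ⬝ᵥ ρ ≤ 2 * r := by
      refine (le_abs_self _).trans ((abs_dotProduct_le _ _).trans ?_)
      exact mul_le_mul (sum_abs_dev_le hp0 hp1 k) hr (norm_nonneg _) zero_le_two
    have e7 : (dev p k - (1 / 2 : ℝ) • g) ⬝ᵥ S *ᵥ (dev p k - (1 / 2 : ℝ) • g) =
        dev p k ⬝ᵥ S *ᵥ dev p k - dev p k ⬝ᵥ S *ᵥ g + 1 / 4 * G := by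
      simp only [Matrix.mulVec_sub, Matrix.mulVec_smul, sub_dotProduct, dotProduct_sub,
        smul_dotProduct, dotProduct_smul, e4, smul_eq_mul, G]
      ring
    rw [e1, e2, add_dotProduct, e3, e7]
    linarith
  have hsum : ∑ k, Real.exp (z k - z y + dev p k ⬝ᵥ S *ᵥ dev p k / 2) ≤
      Real.exp (logisticLoss z y + spread S p) := by
    have h1 : ∀ k, Real.exp (z k - z y) = Real.exp (logisticLoss z y) * p k := by
      intro k
      rw [hp, ← Real.exp_log (softmax_pos z k), ← Real.exp_add, log_softmax, logisticLoss_eq]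
      congr 1; ring
    -- For `x` in `[0, 1]` one has `e^x ≤ 1 + 2 x`; the bound `hv` keeps the argument in this range.
    have h2 : ∀ k, Real.exp (dev p k ⬝ᵥ S *ᵥ dev p k / 2) ≤ 1 + dev p k ⬝ᵥ S *ᵥ dev p k := by
      intro k
      have h0 := hS0 (dev p k)
      have h3 := Real.abs_exp_sub_one_le (x := dev p k ⬝ᵥ S *ᵥ dev p k / 2)
        (by rw [abs_of_nonneg (by positivity)]; linarith [hv k])
      rw [abs_of_nonneg (by positivity : 0 ≤ dev p k ⬝ᵥ S *ᵥ dev p k / 2)] at h3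
      linarith [(le_abs_self _).trans h3]
    calc ∑ k, Real.exp (z k - z y + dev p k ⬝ᵥ S *ᵥ dev p k / 2)
        ≤ ∑ k, Real.exp (logisticLoss z y) * (p k + p k * (dev p k ⬝ᵥ S *ᵥ dev p k)) := by
          refine Finset.sum_le_sum fun k _ => ?_
          rw [Real.exp_add, h1]
          have := mul_le_mul_of_nonneg_left (h2 k)
            (mul_nonneg (Real.exp_pos (logisticLoss z y)).le (hp0 k))
          linarith
      _ = Real.exp (logisticLoss z y) * (1 + spread S p) := by
          rw [← Finset.mul_sum, Finset.sum_add_distrib, hp1, spread]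
      _ ≤ _ := by
          rw [Real.exp_add]
          exact mul_le_mul_of_nonneg_left (by linarith [Real.add_one_le_exp (spread S p)])
            (Real.exp_pos _).le
  have hlog : Real.log (∑ k, Real.exp (zt k - zt y + 1 / 2 * ((Pi.single k 1 - Pi.single y 1 +
      (2 : ℝ) • (-(3 / 4 : ℝ) • g)) ⬝ᵥ S *ᵥ (Pi.single k 1 - Pi.single y 1 + (2 : ℝ) •
      (-(3 / 4 : ℝ) • g))))) ≤ logisticLoss z y + spread S p +
        (2 * r + g ⬝ᵥ (zt - z) + 1 / 8 * G) := by
    rw [Real.log_le_iff_le_exp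
      (Finset.sum_pos (fun _ _ => Real.exp_pos _) Finset.univ_nonempty)]
    calc _ ≤ ∑ k, Real.exp (z k - z y + dev p k ⬝ᵥ S *ᵥ dev p k / 2) *
          Real.exp (2 * r + g ⬝ᵥ (zt - z) + 1 / 8 * G) := Finset.sum_le_sum fun k _ => by
            rw [← Real.exp_add]; exact Real.exp_le_exp.2 (hexpo k)
      _ ≤ _ := by
          rw [← Finset.sum_mul, Real.exp_add (logisticLoss z y + spread S p)]
          exact mul_le_mul_of_nonneg_right hsum (Real.exp_pos _).le
  rw [mixBound]
  have e6 : (-(3 / 4 : ℝ) • g) ⬝ᵥ S *ᵥ (-(3 / 4 : ℝ) • g) = 9 / 16 * G := by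
    rw [Matrix.mulVec_smul, smul_dotProduct, dotProduct_smul]
    simp only [smul_eq_mul]; ring
  rw [e6]
  linarith

end Round

/-! ### Effect of computing the minimizers inexactly -/

section Inexact

variable {K d : ℕ}

theorem linPred_add (θ θ' : Param K d) (x : EuclideanSpace ℝ (Fin d)) :
    linPred (θ + θ') x = linPred θ x + linPred θ' x := by
  simp [linPred_eq, Matrix.mulVec_add]

theorem linPred_smul (c : ℝ) (θ : Param K d) (x : EuclideanSpace ℝ (Fin d)) :
    linPred (c • θ) x = c • linPred θ x := by
  simp [linPred_eq, Matrix.mulVec_smul]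

theorem argminStep_eq_center (A : Matrix (Fin K × Fin d) (Fin K × Fin d) ℝ) (b : Param K d)
    (x : EuclideanSpace ℝ (Fin d)) (y : Fin K) (z : Fin K → ℝ) :
    argminStep A b x y z = center A b + (-(1 / 2 : ℝ)) •
      WithLp.toLp 2 (A⁻¹ *ᵥ (feature x *ᵥ lossGrad z y)) := by
  rw [argminStep, center, Matrix.mulVec_add, smul_add, WithLp.toLp_add, WithLp.toLp_smul,
    WithLp.toLp_smul]

/-- If `θ` were the exact minimizer, the new quadratic, which uses the loss expansion at `θ`, would
have the same gradient there as the objective, so `θ` would be its center. In general the gradient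
at `θs` is `Φ(x) u`, where `u` collects the errors of expanding at `θ` in place of `θs`. Since `lam
≥ 32 R²`, this moves the center by at most `ε`, to which the distance from `θ` to `θs` is added. -/
theorem norm_sub_center_le [NeZero K] {lam β ε R : ℝ} (hl : 0 < lam) (hβ : 0 ≤ β) (hβ1 : β ≤ 1)
    (hR : 32 * R ^ 2 ≤ lam)
    {A A' : Matrix (Fin K × Fin d) (Fin K × Fin d) ℝ} {b b' : Param K d}
    {x : EuclideanSpace ℝ (Fin d)} (hx : ‖x‖ ≤ R) {y : Fin K} {θ θs : Param K d}
    (hA : Dominates lam A) (hA' : Dominates lam A')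
    (eA : A' = A + (β / 2) •
      (feature (K := K) x * softHess (softmax (linPred θ x)) * (feature (K := K) x)ᵀ))
    (eb : b'.ofLp = b.ofLp + feature x *ᵥ lossGrad (linPred θ x) y
      - β • (feature x *ᵥ (softHess (softmax (linPred θ x)) *ᵥ linPred θ x)))
    (hs : argminStep A b x y (linPred θs x) = θs) (hε : ‖θ - θs‖ ≤ ε) :
    ‖θ - center A' b'‖ ≤ 2 * ε := by
  set z := linPred θ x
  set zs := linPred θs x
  set p := softmax z
  have hp0 : ∀ k, 0 ≤ p k := fun k => (softmax_pos z k).le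
  have hp1 : ∑ k, p k = 1 := sum_softmax z
  -- The Hessian term is linear in `zs - z` and carries `β`, not `β / 2`, because the gradient of
  -- the quadratic form doubles it.
  set u : Fin K → ℝ := (lossGrad z y - lossGrad zs y) + β • (softHess p *ᵥ (zs - z))
  have hε0 : 0 ≤ ε := (norm_nonneg _).trans hε
  have hR0 : 0 ≤ R := (norm_nonneg _).trans hx
  have h1 : (2 : ℝ) • (A' *ᵥ θs.ofLp) + b'.ofLp = feature x *ᵥ u := by
    have h2 := stationary_of_fixed hl hA hs
    have h3 : (feature (K := K) x * softHess p * (feature (K := K) x)ᵀ) *ᵥ θs.ofLp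
        = feature x *ᵥ (softHess p *ᵥ zs) := by
      rw [← Matrix.mulVec_mulVec, ← Matrix.mulVec_mulVec, ← linPred_eq]
    have h4 : (2 : ℝ) • (A *ᵥ θs.ofLp) + b.ofLp = -(feature x *ᵥ lossGrad zs y) :=
      eq_neg_of_add_eq_zero_left h2
    rw [eA, eb, Matrix.add_mulVec, Matrix.smul_mulVec, h3, Matrix.mulVec_add, Matrix.mulVec_sub,
      Matrix.mulVec_smul, Matrix.mulVec_sub, Matrix.mulVec_sub, smul_add, smul_sub β, smul_smul,
      mul_div_cancel₀ _ (two_ne_zero' ℝ)]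
    linear_combination (exp := 1) h4
  have h5 : θs - center A' b' =
      (1 / 2 : ℝ) • (WithLp.toLp 2 (A'⁻¹ *ᵥ (feature x *ᵥ u)) : Param K d) := by
    rw [← h1, Matrix.mulVec_add, Matrix.mulVec_smul, hA'.inv_mulVec_mulVec hl, center,
      WithLp.toLp_add, WithLp.toLp_smul, WithLp.toLp_smul, WithLp.toLp_ofLp]
    module
  have hz : ‖zs - z‖ ≤ R * ε := by
    rw [norm_sub_rev, ← linPred_sub]
    exact (norm_linPred_le _ _).trans (mul_le_mul hx hε (norm_nonneg _) hR0)
  have hu : ∑ k, |u k| ≤ 4 * (R * ε) := by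
    have e1 : ∀ k, |u k| ≤ |softmax z k - softmax zs k| + |(softHess p *ᵥ (zs - z)) k| := by
      intro k
      have : u k = (softmax z k - softmax zs k) + β * (softHess p *ᵥ (zs - z)) k := by
        simp [u, lossGrad]
      rw [this]
      refine (abs_add_le _ _).trans (add_le_add le_rfl ?_)
      rw [abs_mul, abs_of_nonneg hβ]
      exact mul_le_of_le_one_left (abs_nonneg _) hβ1
    refine (Finset.sum_le_sum fun k _ => e1 k).trans ?_
    rw [Finset.sum_add_distrib]
    have e2 := sum_abs_softmax_sub_le zs z
    have e3 := sum_abs_softHess_mulVec_le hp0 hp1 (zs - z)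
    rw [norm_sub_rev] at e2
    linarith
  have h6 : ‖θs - center A' b'‖ ≤ ε := by
    rw [h5, norm_smul, Real.norm_of_nonneg (by norm_num)]
    have e1 := norm_inv_feature_le hl hA' x u
    have e2 : ‖x‖ / lam * ∑ k, |u k| ≤ R / lam * (4 * (R * ε)) :=
      mul_le_mul (div_le_div_of_nonneg_right hx hl.le) hu
        (Finset.sum_nonneg fun _ _ => abs_nonneg _) (by positivity)
    have e3 : R / lam * (4 * (R * ε)) ≤ ε := by
      rw [div_mul_eq_mul_div, div_le_iff₀ hl]
      nlinarith [mul_le_mul_of_nonneg_left hR hε0, mul_nonneg hε0 (sq_nonneg R)]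
    linarith
  calc ‖θ - center A' b'‖ = ‖(θ - θs) + (θs - center A' b')‖ := by congr 1; abel
    _ ≤ 2 * ε := (norm_add_le _ _).trans (by linarith)

/-- The optimality condition gives `zs = Φᵀ center - S g(zs) / 2` exactly. Three errors remain: `θt`
is not the center, `g` is taken at `z`, and `z` differs from `zs`. They amount to `2 + 1/2 + 1 ≤ 4`
times `R ε`. -/
theorem norm_residual_le [NeZero K] {lam ε R : ℝ} (hl : 0 < lam)
    (hR : 32 * R ^ 2 ≤ lam)
    {A : Matrix (Fin K × Fin d) (Fin K × Fin d) ℝ} {b : Param K d}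
    {x : EuclideanSpace ℝ (Fin d)} (hx : ‖x‖ ≤ R) {y : Fin K} {θ θs θt : Param K d}
    (hA : Dominates lam A) (hs : argminStep A b x y (linPred θs x) = θs) (hε : ‖θ - θs‖ ≤ ε)
    (ht : ‖θt - center A b‖ ≤ 2 * ε) :
    ‖linPred θt x - linPred θ x - (1 / 2 : ℝ) • (sampleCov A x *ᵥ lossGrad (linPred θ x) y)‖
      ≤ 4 * (R * ε) := by
  set z := linPred θ x
  set zs := linPred θs x
  have hε0 : 0 ≤ ε := (norm_nonneg _).trans hε
  have hR0 : 0 ≤ R := (norm_nonneg _).trans hx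
  have h1 : zs = linPred (center A b) x - (1 / 2 : ℝ) • (sampleCov A x *ᵥ lossGrad zs y) := by
    have := congrArg (fun θ => linPred θ x) hs
    simp only [argminStep_eq_center, linPred_add, linPred_smul, ← sampleCov_mulVec] at this
    rw [neg_smul] at this
    exact this.symm.trans (sub_eq_add_neg _ _).symm
  have hz : ‖z - zs‖ ≤ R * ε := by
    rw [← linPred_sub]
    exact (norm_linPred_le _ _).trans (mul_le_mul hx hε (norm_nonneg _) hR0)
  have h2 : ‖linPred (θt - center A b) x‖ ≤ R * (2 * ε) :=
    (norm_linPred_le _ _).trans (mul_le_mul hx ht (norm_nonneg _) hR0)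
  have h3 : ‖sampleCov A x *ᵥ (lossGrad zs y - lossGrad z y)‖ ≤ R * ε := by
    rw [sampleCov_mulVec]
    have e0 : lossGrad zs y - lossGrad z y = fun k => softmax zs k - softmax z k := by
      funext k; simp [lossGrad]
    have e1 := sum_abs_softmax_sub_le z zs
    rw [← norm_sub_rev] at e1
    have e2 := norm_inv_feature_le hl hA x (fun k => softmax zs k - softmax z k)
    have e3 : ‖x‖ / lam * ∑ k, |softmax zs k - softmax z k| ≤ R / lam * (2 * (R * ε)) :=
      mul_le_mul (div_le_div_of_nonneg_right hx hl.le) (by linarith)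
        (Finset.sum_nonneg fun _ _ => abs_nonneg _) (by positivity)
    have e4 : R / lam * (2 * (R * ε)) ≤ ε := by
      rw [div_mul_eq_mul_div, div_le_iff₀ hl]
      nlinarith [mul_le_mul_of_nonneg_left hR hε0, mul_nonneg hε0 (sq_nonneg R)]
    rw [e0]
    exact (norm_linPred_le _ _).trans (mul_le_mul hx (by linarith) (norm_nonneg _) hR0)
  have h4 : linPred θt x - z - (1 / 2 : ℝ) • (sampleCov A x *ᵥ lossGrad z y) =
      linPred (θt - center A b) x +
        (1 / 2 : ℝ) • (sampleCov A x *ᵥ (lossGrad zs y - lossGrad z y)) - (z - zs) := by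
    rw [linPred_sub, Matrix.mulVec_sub, smul_sub]
    linear_combination (exp := 1) -h1
  rw [h4]
  refine (norm_sub_le _ _).trans ?_
  have h5 := norm_add_le (linPred (θt - center A b) x)
    ((1 / 2 : ℝ) • (sampleCov A x *ᵥ (lossGrad zs y - lossGrad z y)))
  rw [norm_smul, Real.norm_of_nonneg (by norm_num)] at h5
  linarith [norm_nonneg (sampleCov A x *ᵥ (lossGrad zs y - lossGrad z y))]

end Inexact

/-! ### Summing the deterministic bounds over a run -/

section Run

variable {n K d : ℕ} {lam β ε R : ℝ} {x : Fin n → EuclideanSpace ℝ (Fin d)} {y : Fin n → Fin K}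
  {A : ℕ → Matrix (Fin K × Fin d) (Fin K × Fin d) ℝ} {b θ : ℕ → Param K d}

theorem IsRun.A_succ' [NeZero K] (h : IsRun lam β ε x y A b θ) (t : Fin n) :
    A (t + 1) = A t + (β / 2) • (feature (K := K) (x t) *
      softHess (softmax (linPred (θ (t + 1)) (x t))) * (feature (K := K) (x t))ᵀ) := by
  rw [h.A_succ, hessian_paramLoss]

theorem IsRun.b_succ' [NeZero K] (h : IsRun lam β ε x y A b θ) (t : Fin n) :
    (b (t + 1)).ofLp = (b t).ofLp +
      feature (x t) *ᵥ lossGrad (linPred (θ (t + 1)) (x t)) (y t) -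
      β • (feature (x t) *ᵥ (softHess (softmax (linPred (θ (t + 1)) (x t))) *ᵥ
        linPred (θ (t + 1)) (x t))) := by
  rw [h.b_succ, hessian_paramLoss, gradient_paramLoss, ← Matrix.mulVec_mulVec,
    ← Matrix.mulVec_mulVec, ← linPred_eq]
  rfl

theorem IsRun.dominates [NeZero K] (h : IsRun lam β ε x y A b θ) (hβ : 0 ≤ β) :
    ∀ t ≤ n, Dominates lam (A t) := by
  intro t
  induction t with
  | zero => intro _; rw [h.A_zero]; exact dominates_smul_one lam
  | succ t ih =>
    intro ht
    rw [h.A_succ' ⟨t, ht⟩]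
    exact (ih (by omega)).add_hessian (by positivity) (fun k => (softmax_pos _ k).le)
      (sum_softmax _) _

theorem IsRun.exists_fixed [NeZero K] (h : IsRun lam β ε x y A b θ) (hl : 0 < lam) (hβ : 0 ≤ β)
    (hR : 32 * R ^ 2 ≤ lam) (hx : ∀ t, ‖x t‖ ≤ R) (t : Fin n) :
    ∃ θs, argminStep (A t) (b t) (x t) (y t) (linPred θs (x t)) = θs ∧ ‖θ (t + 1) - θs‖ ≤ ε := by
  obtain ⟨θs, h1, h2⟩ := h.θ_succ t
  have hx2 : 32 * ‖x t‖ ^ 2 ≤ lam := by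
    have := pow_le_pow_left₀ (norm_nonneg _) (hx t) 2
    linarith
  exact ⟨θs, fixed_of_isMin hl (h.dominates hβ t t.2.le) hx2 h1, h2⟩

theorem IsRun.norm_sub_center_le [NeZero K] (h : IsRun lam β ε x y A b θ) (hl : 0 < lam)
    (hβ : 0 ≤ β) (hβ1 : β ≤ 1) (hε : 0 ≤ ε) (hR : 32 * R ^ 2 ≤ lam) (hx : ∀ t, ‖x t‖ ≤ R) :
    ∀ t ≤ n, ‖θ t - center (A t) (b t)‖ ≤ 2 * ε := by
  intro t ht
  cases t with
  | zero => simp [h.θ_zero, h.b_zero, center, hε]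
  | succ t =>
    obtain ⟨θs, hs, hd⟩ := h.exists_fixed hl hβ hR hx ⟨t, ht⟩
    exact EfficientGAF.norm_sub_center_le hl hβ hβ1 hR (hx ⟨t, ht⟩) (h.dominates hβ t (by omega))
      (h.dominates hβ (t + 1) ht) (h.A_succ' ⟨t, ht⟩) (h.b_succ' ⟨t, ht⟩) hs hd

/-- The bound for the loss of the mixture forecast in round `t`. -/
noncomputable def roundBound (x : Fin n → EuclideanSpace ℝ (Fin d)) (y : Fin n → Fin K)
    (A : ℕ → Matrix (Fin K × Fin d) (Fin K × Fin d) ℝ) (θ : ℕ → Param K d) (t : Fin n) : ℝ :=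
  mixBound (sampleCov (A t) (x t)) (linPred (θ t) (x t)) (y t)
    (-(3 / 4 : ℝ) • lossGrad (linPred (θ (t + 1)) (x t)) (y t))

/-- The gain is stated at the center and the mixture bound at `θ t`; exchanging them costs `4 R ε`,
and the residual costs `2 · 4 R ε`. The coefficient `-7/16` of `gᵀ S g` leaves room for the `-1/4`
in the gain. -/
theorem IsRun.roundBound_le [NeZero K] (h : IsRun lam β ε x y A b θ) (hl : 0 < lam)
    (hβ : 0 ≤ β) (hβ1 : β ≤ 1) (hε : 0 ≤ ε) (hR : 32 * R ^ 2 ≤ lam) (hx : ∀ t, ‖x t‖ ≤ R)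
    (t : Fin n) :
    roundBound x y A θ t ≤
      gain (sampleCov (A t) (x t)) (linPred (center (A t) (b t)) (x t))
        (linPred (θ (t + 1)) (x t)) (y t) +
      spread (sampleCov (A t) (x t)) (softmax (linPred (θ (t + 1)) (x t))) + 12 * (R * ε) := by
  obtain ⟨θs, hs, hd⟩ := h.exists_fixed hl hβ hR hx t
  have hA := h.dominates hβ t t.2.le
  have hc := h.norm_sub_center_le hl hβ hβ1 hε hR hx t t.2.le
  have hR0 : 0 ≤ R := (norm_nonneg _).trans (hx t)
  have hx2 : 32 * ‖x t‖ ^ 2 ≤ lam := by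
    have := pow_le_pow_left₀ (norm_nonneg _) (hx t) 2
    linarith
  have hS0 : ∀ u, 0 ≤ u ⬝ᵥ sampleCov (A t) (x t) *ᵥ u := fun u => by
    rw [dot_sampleCov]; exact hA.dot_inv_nonneg hl _
  have h1 := mixBound_le (sampleCov_symm hA (x t)) hS0 (linPred (θ (t + 1)) (x t))
    (linPred (θ t) (x t)) (y t)
    (dot_dev_le hl hA hx2 (fun k => (softmax_pos _ k).le) (sum_softmax _))
    (norm_residual_le hl hR (hx t) hA hs hd hc)
  have h2 : lossGrad (linPred (θ (t + 1)) (x t)) (y t) ⬝ᵥ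
      (linPred (θ t) (x t) - linPred (center (A t) (b t)) (x t)) ≤ 4 * (R * ε) := by
    refine (le_abs_self _).trans ((abs_dotProduct_le _ _).trans ?_)
    rw [← linPred_sub]
    have e1 := (norm_linPred_le (θ t - center (A t) (b t)) (x t)).trans
      (mul_le_mul (hx t) hc (norm_nonneg _) hR0)
    calc _ ≤ 2 * (R * (2 * ε)) :=
          mul_le_mul (sum_abs_lossGrad_le _ _) e1 (norm_nonneg _) zero_le_two
      _ = _ := by ring
  have h3 := hS0 (lossGrad (linPred (θ (t + 1)) (x t)) (y t))
  rw [roundBound]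
  simp only [gain, dotProduct_sub] at *
  linarith

theorem IsRun.sum_gain_le [NeZero K] {B : ℝ} (h : IsRun lam β ε x y A b θ) (hl : 0 < lam)
    (hβ : 0 < β) (hβB : β ≤ (Real.log K / 2 + B * R + 1)⁻¹)
    (hx : ∀ t, ‖x t‖ ≤ R) {u : Param K d} (hu : ‖u‖ ≤ B) :
    ∑ t : Fin n, gain (sampleCov (A t) (x t)) (linPred (center (A t) (b t)) (x t))
        (linPred (θ (t + 1)) (x t)) (y t) ≤ lam * B ^ 2 + ∑ t, paramLoss (x t) (y t) u := by
  -- The summands are extended by zero beyond `n` so that the induction runs over natural numbers.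
  let G : ℕ → ℝ := fun s => if hs : s < n then
    gain (sampleCov (A s) (x ⟨s, hs⟩)) (linPred (center (A s) (b s)) (x ⟨s, hs⟩))
      (linPred (θ (s + 1)) (x ⟨s, hs⟩)) (y ⟨s, hs⟩) else 0
  let F : Param K d → ℕ → ℝ := fun v s => if hs : s < n then
    surrogate β (linPred (θ (s + 1)) (x ⟨s, hs⟩)) (y ⟨s, hs⟩) (linPred v (x ⟨s, hs⟩)) else 0
  have key : ∀ t ≤ n,
      (∃ c, ∀ v : Param K d, lam * (v.ofLp ⬝ᵥ v.ofLp) + ∑ s ∈ Finset.range t, F v s =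
        c + ((b t).ofLp ⬝ᵥ v.ofLp + v.ofLp ⬝ᵥ A t *ᵥ v.ofLp)) ∧
      ∀ v : Param K d, ∑ s ∈ Finset.range t, G s +
        (v - center (A t) (b t)).ofLp ⬝ᵥ A t *ᵥ (v - center (A t) (b t)).ofLp ≤
          lam * (v.ofLp ⬝ᵥ v.ofLp) + ∑ s ∈ Finset.range t, F v s := by
    intro t
    induction t with
    | zero =>
      intro _
      have : center (A 0) (b 0) = 0 := by simp [center, h.b_zero]
      rw [this, h.A_zero, h.b_zero]
      refine ⟨⟨0, fun v => ?_⟩, fun v => ?_⟩ <;> simp [Matrix.smul_mulVec]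
    | succ t ih =>
      intro ht
      obtain ⟨⟨c, hc⟩, h2⟩ := ih (by omega)
      have hF : ∀ v, F v t = surrogate β (linPred (θ (t + 1)) (x ⟨t, ht⟩)) (y ⟨t, ht⟩)
          (linPred v (x ⟨t, ht⟩)) := fun v => dif_pos ht
      have hG : G t = gain (sampleCov (A t) (x ⟨t, ht⟩))
          (linPred (center (A t) (b t)) (x ⟨t, ht⟩)) (linPred (θ (t + 1)) (x ⟨t, ht⟩))
          (y ⟨t, ht⟩) := dif_pos ht
      have := surrogate_round hl hβ.le (h.dominates hβ.le t (by omega))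
        (h.dominates hβ.le (t + 1) ht) (h.A_succ' ⟨t, ht⟩) (h.b_succ' ⟨t, ht⟩) hc h2
      simpa only [Finset.sum_range_succ, ← add_assoc, hF, hG] using this
  have h1 := (key n le_rfl).2 u
  have h2 := (h.dominates hβ.le n le_rfl).dot_nonneg hl (u - center (A n) (b n)).ofLp
  have h3 : ∑ s ∈ Finset.range n, G s = ∑ t : Fin n, gain (sampleCov (A t) (x t))
      (linPred (center (A t) (b t)) (x t)) (linPred (θ (t + 1)) (x t)) (y t) := by
    rw [Finset.sum_range]; simp [G]
  have h4 : ∑ s ∈ Finset.range n, F u s ≤ ∑ t, paramLoss (x t) (y t) u := by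
    rw [Finset.sum_range]
    refine Finset.sum_le_sum fun t _ => ?_
    simp only [F, Fin.is_lt, dif_pos, Fin.eta]
    refine surrogate_le hβB (fun k => (abs_linPred_le u (x t) k).trans ?_) _ _
    rw [mul_comm B R]
    exact mul_le_mul (hx t) hu (norm_nonneg _) ((norm_nonneg _).trans (hx t))
  have h5 : lam * (u.ofLp ⬝ᵥ u.ofLp) ≤ lam * B ^ 2 := by
    rw [← norm_sq_eq_dotProduct]
    exact mul_le_mul_of_nonneg_left (pow_le_pow_left₀ (norm_nonneg _) hu 2) hl.le
  linarith

/-- The spreads telescope into `log det A_n - log det A_0`. The determinant is controlled by the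
trace, which each round increases by at most `β R² / 2`, since the softmax Hessian lifted by `Φ(x)`
has trace at most `‖x‖²`. -/
theorem IsRun.sum_spread_le [NeZero K] [NeZero d] (h : IsRun lam β ε x y A b θ) (hl : 0 < lam)
    (hβ : 0 < β) (hβ1 : β ≤ 1) (hR : 32 * R ^ 2 ≤ lam) (hx : ∀ t, ‖x t‖ ≤ R) :
    ∑ t : Fin n, spread (sampleCov (A t) (x t)) (softmax (linPred (θ (t + 1)) (x t))) ≤
      4 / β * (K * d * Real.log (1 + β * n * R ^ 2 / (2 * lam * (K * d)))) := by
  have hx2 : ∀ t, ‖x t‖ ^ 2 ≤ R ^ 2 := fun t => pow_le_pow_left₀ (norm_nonneg _) (hx t) 2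
  let G : ℕ → ℝ := fun s => if hs : s < n then
    spread (sampleCov (A s) (x ⟨s, hs⟩)) (softmax (linPred (θ (s + 1)) (x ⟨s, hs⟩))) else 0
  have key : ∀ t ≤ n, ∑ s ∈ Finset.range t, G s ≤
      4 / β * (Real.log (A t).det - Real.log (A 0).det) ∧
      (A t).trace ≤ lam * (K * d) + β / 2 * (t * R ^ 2) := by
    intro t
    induction t with
    | zero => intro _; simp [h.A_zero, Matrix.trace_smul]
    | succ t ih =>
      intro ht
      obtain ⟨h1, h2⟩ := ih (by omega)
      have hG : G t = spread (sampleCov (A t) (x ⟨t, ht⟩))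
          (softmax (linPred (θ (t + 1)) (x ⟨t, ht⟩))) := dif_pos ht
      have h3 := spread_le_log_det hl hβ hβ1 (h.dominates hβ.le t (by omega))
        (x := x ⟨t, ht⟩) (by linarith [hx2 ⟨t, ht⟩])
        (fun k => (softmax_pos (linPred (θ (t + 1)) (x ⟨t, ht⟩)) k).le) (sum_softmax _)
      have h4 := h.A_succ' ⟨t, ht⟩
      simp only at h4
      rw [← h4, ← hG] at h3
      refine ⟨?_, ?_⟩
      · rw [Finset.sum_range_succ]; linarith
      · rw [h4, Matrix.trace_add, Matrix.trace_smul, smul_eq_mul]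
        have h5 := (trace_hessian_le (fun k => (softmax_pos (linPred (θ (t + 1)) (x ⟨t, ht⟩)) k).le)
          (sum_softmax _) (x ⟨t, ht⟩)).trans (hx2 ⟨t, ht⟩)
        have h6 := mul_le_mul_of_nonneg_left h5 (half_pos hβ).le
        push_cast
        linarith
  obtain ⟨h1, h2⟩ := key n le_rfl
  have h3 : ∑ s ∈ Finset.range n, G s = ∑ t : Fin n,
      spread (sampleCov (A t) (x t)) (softmax (linPred (θ (t + 1)) (x t))) := by
    rw [Finset.sum_range]; simp [G]
  rw [← h3]
  refine h1.trans (mul_le_mul_of_nonneg_left ?_ (by positivity))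
  have hKd : (0 : ℝ) < K * d := by
    have := NeZero.pos K; have := NeZero.pos d; positivity
  have hpos := (h.dominates hβ.le n le_rfl).posDef hl
  have hdet0 : Real.log (A 0).det = K * d * Real.log lam := by
    rw [h.A_zero, Matrix.det_smul, Matrix.det_one, mul_one, Real.log_pow]
    simp
  have h4 := log_det_le hpos
  have hcard : (Fintype.card (Fin K × Fin d) : ℝ) = K * d := by simp
  rw [hcard] at h4
  have htr : 0 < (A n).trace := hpos.trace_pos
  have h5 : Real.log ((A n).trace / (K * d)) ≤
      Real.log lam + Real.log (1 + β * n * R ^ 2 / (2 * lam * (K * d))) := by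
    rw [← Real.log_mul hl.ne' (by positivity)]
    refine Real.log_le_log (by positivity) ?_
    rw [div_le_iff₀ hKd]
    refine h2.trans (le_of_eq ?_)
    generalize (K : ℝ) * d = q at hKd
    field_simp
  have h6 := mul_le_mul_of_nonneg_left h5 hKd.le
  rw [hdet0]
  linarith

theorem IsRun.sum_roundBound_le [NeZero K] [NeZero d] {B : ℝ} (h : IsRun lam β ε x y A b θ)
    (hl : 0 < lam) (hβ : 0 < β) (hβ1 : β ≤ 1) (hβB : β ≤ (Real.log K / 2 + B * R + 1)⁻¹)
    (hε : 0 ≤ ε) (hR : 32 * R ^ 2 ≤ lam) (hx : ∀ t, ‖x t‖ ≤ R) {u : Param K d} (hu : ‖u‖ ≤ B) :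
    ∑ t, roundBound x y A θ t ≤ lam * B ^ 2 + ∑ t, paramLoss (x t) (y t) u +
      4 / β * (K * d * Real.log (1 + β * n * R ^ 2 / (2 * lam * (K * d)))) +
        12 * n * (R * ε) := by
  have h1 := Finset.sum_le_sum fun t (_ : t ∈ Finset.univ) =>
    h.roundBound_le hl hβ.le hβ1 hε hR hx t
  rw [Finset.sum_add_distrib, Finset.sum_add_distrib, Finset.sum_const, Finset.card_univ,
    Fintype.card_fin, nsmul_eq_mul] at h1
  linarith [h.sum_gain_le hl hβ hβB hx hu, h.sum_spread_le hl hβ hβ1 hR hx]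

end Run

/-! ### Exponential moments of the samples -/

section Moments

variable {K : ℕ} {E : Type*} [MeasurableSpace E]

/-- Under `ν`, the exponential moments of `f` are those of the normal law with mean `z` and
covariance `S`. -/
structure HasNormalMgf (ν : Measure E) (f : E → Fin K → ℝ) (z : Fin K → ℝ)
    (S : Matrix (Fin K) (Fin K) ℝ) : Prop where
  measurable : Measurable f
  integral_exp : ∀ a : Fin K → ℝ,
    ∫ ω, Real.exp (a ⬝ᵥ (f ω - z)) ∂ν = Real.exp (1 / 2 * (a ⬝ᵥ S *ᵥ a))

/-- The program samples with an arbitrary factor `T`, whereas the law in the algorithm is defined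
through a particular square root. Exponential moments depend only on `T Tᵀ`, so one argument covers
both. -/
theorem hasNormalMgf_pi (z : Fin K → ℝ) (T : Matrix (Fin K) (Fin K) ℝ) :
    HasNormalMgf (Measure.pi fun _ : Fin K => gaussianReal 0 1) (fun g => z + T *ᵥ g) z
      (T * Tᵀ) := by
  refine ⟨?_, fun a => ?_⟩
  · exact measurable_const.add
      (Continuous.measurable (Continuous.matrix_mulVec continuous_const continuous_id))
  · have h1 : ∀ g : Fin K → ℝ, Real.exp (a ⬝ᵥ (z + T *ᵥ g - z)) =
        ∏ k, Real.exp ((Tᵀ *ᵥ a) k * g k) := by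
      intro g
      rw [add_sub_cancel_left, Matrix.dotProduct_mulVec, ← Matrix.mulVec_transpose, dotProduct,
        Real.exp_sum]
    simp_rw [h1]
    rw [integral_fintype_prod_eq_prod (fun (k : Fin K) (r : ℝ) => Real.exp ((Tᵀ *ᵥ a) k * r))]
    have h2 : ∀ s : ℝ, ∫ r, Real.exp (s * r) ∂(gaussianReal 0 1) = Real.exp (s ^ 2 / 2) := by
      intro s
      have := congrFun (mgf_fun_id_gaussianReal (μ := 0) (v := 1)) s
      simpa [mgf] using this
    simp_rw [h2]
    rw [← Real.exp_sum, ← Matrix.mulVec_mulVec, Matrix.dotProduct_mulVec a,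
      ← Matrix.mulVec_transpose, dotProduct, Finset.mul_sum]
    congr 1
    exact Finset.sum_congr rfl fun k _ => by ring

open scoped MatrixOrder in
theorem hasNormalMgf_multivariateGaussian (z : Fin K → ℝ) {S : Matrix (Fin K) (Fin K) ℝ}
    (hS : S.PosSemidef) :
    HasNormalMgf (multivariateGaussian (WithLp.toLp 2 z) S) (fun ω => ω.ofLp) z S := by
  refine ⟨by fun_prop, fun a => ?_⟩
  have hsym : (CFC.sqrt S)ᵀ = CFC.sqrt S := by
    have h1 : IsSelfAdjoint (CFC.sqrt S) := (CFC.sqrt_nonneg S).isSelfAdjoint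
    rw [← Matrix.conjTranspose_eq_transpose_of_trivial]
    exact h1
  have hsq : CFC.sqrt S * (CFC.sqrt S)ᵀ = S := by
    rw [hsym]; exact CFC.sqrt_mul_sqrt_self _ hS.nonneg
  have h := (hasNormalMgf_pi z (CFC.sqrt S)).integral_exp a
  rw [hsq] at h
  rw [← h, multivariateGaussian, integral_map (by fun_prop) (by fun_prop),
    ← map_pi_eq_stdGaussian, integral_map (by fun_prop) (by fun_prop)]
  rfl

namespace HasNormalMgf

variable {ν : Measure E} [IsProbabilityMeasure ν] {f : E → Fin K → ℝ} {z : Fin K → ℝ}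
  {S : Matrix (Fin K) (Fin K) ℝ}

/-- The Bochner integral of a nonintegrable function is zero by convention, while the prescribed
moment is positive. -/
theorem integrable_exp (h : HasNormalMgf ν f z S) (a : Fin K → ℝ) :
    Integrable (fun ω => Real.exp (a ⬝ᵥ (f ω - z))) ν := by
  by_contra h0
  have := h.integral_exp a
  rw [integral_undef h0] at this
  exact (Real.exp_pos _).ne this

theorem measurable_softmax (h : HasNormalMgf ν f z S) (y : Fin K) :
    Measurable fun ω => softmax (f ω) y := by
  have hk : ∀ k, Measurable fun ω => f ω k := fun k => (measurable_pi_apply k).comp h.measurable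
  exact (hk y).exp.div (Finset.measurable_sum _ fun k _ => (hk k).exp)

theorem integrable_softmax_pow [NeZero K] (h : HasNormalMgf ν f z S) (y : Fin K) (j : ℕ) :
    Integrable (fun ω => softmax (f ω) y ^ j) ν := by
  refine Integrable.of_bound ((h.measurable_softmax y).pow_const j).aestronglyMeasurable 1
    (Filter.Eventually.of_forall fun ω => ?_)
  have h0 := (softmax_pos (f ω) y).le
  rw [Real.norm_of_nonneg (by positivity)]
  exact pow_le_one₀ h0 (softmax_le_one _ _)

theorem integrable_softmax [NeZero K] (h : HasNormalMgf ν f z S) (y : Fin K) :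
    Integrable (fun ω => softmax (f ω) y) ν := by
  simpa using h.integrable_softmax_pow y 1

/-- For `X = softmax(ω)_y` and a tilt `W = exp(a · (ω - z))`, Cauchy-Schwarz gives `(E W)² ≤ E X ·
E(W² / X)`. Because `1 / X = ∑_k exp(ω_k - ω_y)`, the last factor is a finite sum of normal
exponential moments. -/
theorem exp_neg_mixBound_le [NeZero K] (h : HasNormalMgf ν f z S) (y : Fin K) (a : Fin K → ℝ) :
    Real.exp (-mixBound S z y a) ≤ ∫ ω, softmax (f ω) y ∂ν := by
  set q : Fin K → Fin K → ℝ := fun k => Pi.single k 1 - Pi.single y 1 + (2 : ℝ) • a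
  set M := ∑ k, Real.exp (z k - z y + 1 / 2 * (q k ⬝ᵥ S *ᵥ q k))
  have hM : 0 < M := Finset.sum_pos (fun _ _ => Real.exp_pos _) Finset.univ_nonempty
  set w := Real.exp (1 / 2 * (a ⬝ᵥ S *ᵥ a))
  have hint2 : ∀ k, Integrable
      (fun ω => Real.exp (z k - z y) * Real.exp (q k ⬝ᵥ (f ω - z))) ν :=
    fun k => (h.integrable_exp (q k)).const_mul _
  have hM' : ∫ ω, ∑ k, Real.exp (z k - z y) * Real.exp (q k ⬝ᵥ (f ω - z)) ∂ν = M := by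
    rw [integral_finsetSum _ fun k _ => hint2 k]
    refine Finset.sum_congr rfl fun k _ => ?_
    rw [integral_const_mul, h.integral_exp, ← Real.exp_add]
  -- Cauchy-Schwarz in pointwise form: `2 c W - c² W² / X ≤ X`. This value of `c` maximizes the
  -- integrated left side `2 c w - c² M`.
  set c := w / M
  have hpt : ∀ ω, 2 * c * Real.exp (a ⬝ᵥ (f ω - z)) -
      c ^ 2 * ∑ k, Real.exp (z k - z y) * Real.exp (q k ⬝ᵥ (f ω - z)) ≤ softmax (f ω) y := by
    intro ω
    set W := Real.exp (a ⬝ᵥ (f ω - z))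
    set X := softmax (f ω) y
    have hX : 0 < X := softmax_pos _ _
    have h1 : ∑ k, Real.exp (z k - z y) * Real.exp (q k ⬝ᵥ (f ω - z)) = W ^ 2 / X := by
      rw [eq_div_iff hX.ne', Finset.sum_mul]
      have h2 : ∀ k, Real.exp (z k - z y) * Real.exp (q k ⬝ᵥ (f ω - z)) * X =
          W ^ 2 * softmax (f ω) k := by
        intro k
        simp only [X, W, softmax, ← mul_div_assoc, ← Real.exp_add, ← Real.exp_nat_mul]
        congr 2
        simp only [q, add_dotProduct, sub_dotProduct, smul_dotProduct, single_one_dotProduct,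
          Pi.sub_apply, smul_eq_mul]
        push_cast
        ring
      rw [Finset.sum_congr rfl fun k _ => h2 k, ← Finset.mul_sum, sum_softmax, mul_one]
    rw [h1]
    have h3 : 0 ≤ (X - c * W) ^ 2 / X := by positivity
    have h4 : (X - c * W) ^ 2 / X = X - (2 * c * W - c ^ 2 * (W ^ 2 / X)) := by
      field_simp; ring
    linarith
  have hle := integral_mono (((h.integrable_exp a).const_mul (2 * c)).sub
    ((integrable_finsetSum _ fun k _ => hint2 k).const_mul (c ^ 2))) (h.integrable_softmax y)
    (fun ω => by simpa using hpt ω)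
  simp only [Pi.sub_apply] at hle
  rw [integral_sub ((h.integrable_exp a).const_mul (2 * c))
    ((integrable_finsetSum _ fun k _ => hint2 k).const_mul (c ^ 2)), integral_const_mul,
    integral_const_mul, hM', h.integral_exp a] at hle
  refine le_trans (le_of_eq ?_) hle
  have h5 : mixBound S z y a = Real.log M - a ⬝ᵥ S *ᵥ a := rfl
  have h6 : Real.exp (a ⬝ᵥ S *ᵥ a) = w ^ 2 := by
    rw [← Real.exp_nat_mul]; congr 1; push_cast; ring
  rw [h5, neg_sub, Real.exp_sub, Real.exp_log hM, h6]
  change _ = 2 * c * w - c ^ 2 * M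
  simp only [c]
  field_simp
  ring

theorem integral_softmax_pos [NeZero K] (h : HasNormalMgf ν f z S) (y : Fin K) :
    0 < ∫ ω, softmax (f ω) y ∂ν :=
  (Real.exp_pos _).trans_le (h.exp_neg_mixBound_le y 0)

theorem integral_softmax_le_one [NeZero K] (h : HasNormalMgf ν f z S) (y : Fin K) :
    ∫ ω, softmax (f ω) y ∂ν ≤ 1 := by
  have := integral_mono (h.integrable_softmax y) (integrable_const (1 : ℝ))
    fun ω => softmax_le_one (f ω) y
  simpa using this

/-- The relative second moment of the sampled probabilities is bounded. -/
theorem integral_softmax_sq_le [NeZero K] (h : HasNormalMgf ν f z S) (y : Fin K)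
    (hS : ∀ u w, |u ⬝ᵥ S *ᵥ w| ≤ (∑ k, |u k|) * (∑ k, |w k|) / 32) :
    ∫ ω, softmax (f ω) y ^ 2 ∂ν ≤ 2 * (∫ ω, softmax (f ω) y ∂ν) ^ 2 := by
  set q := softmax z
  have hq0 : ∀ k, 0 < q k := softmax_pos z
  have hq1 : ∑ k, q k = 1 := sum_softmax z
  have hquad : ∀ u : Fin K → ℝ, ∑ k, |u k| ≤ 2 → u ⬝ᵥ S *ᵥ u ≤ 1 / 8 := by
    intro u hu
    have h0 : 0 ≤ ∑ k, |u k| := Finset.sum_nonneg fun _ _ => abs_nonneg _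
    have := (le_abs_self _).trans (hS u u)
    nlinarith
  -- Jensen's inequality for the normalizing sum `∑ q_k e^{ξ_k}` gives an upper bound that is
  -- exponential in a linear form.
  have hup : ∀ ω, softmax (f ω) y ≤ q y * Real.exp (dev q y ⬝ᵥ (f ω - z)) := by
    intro ω
    set ξ := f ω - z
    set m := ∑ k, q k * ξ k
    have h1 : Real.exp m ≤ ∑ k, q k * Real.exp (ξ k) := by
      have h2 : ∀ k, q k * (Real.exp m * (1 + (ξ k - m))) ≤ q k * Real.exp (ξ k) := by
        intro k
        refine mul_le_mul_of_nonneg_left ?_ (hq0 k).le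
        have e : ξ k = m + (ξ k - m) := by ring
        conv_rhs => rw [e, Real.exp_add]
        exact mul_le_mul_of_nonneg_left (by linarith [Real.add_one_le_exp (ξ k - m)])
          (Real.exp_pos _).le
      have h3 : ∑ k, q k * (Real.exp m * (1 + (ξ k - m))) = Real.exp m := by
        have : ∀ k, q k * (Real.exp m * (1 + (ξ k - m))) =
            Real.exp m * (q k * (1 - m) + q k * ξ k) := fun k => by ring
        simp_rw [this]
        rw [← Finset.mul_sum, Finset.sum_add_distrib, ← Finset.sum_mul, hq1]
        change Real.exp m * (1 * (1 - m) + m) = _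
        ring
      rw [← h3]
      exact Finset.sum_le_sum fun k _ => h2 k
    have h4 : softmax (f ω) y = q y * Real.exp (ξ y) / ∑ k, q k * Real.exp (ξ k) := by
      have hz := sum_exp_pos z
      have h5 : ∀ k, q k * Real.exp (ξ k) = Real.exp (f ω k) / ∑ j, Real.exp (z j) := by
        intro k
        simp only [q, softmax, ξ, Pi.sub_apply, Real.exp_sub]
        field_simp
      simp_rw [h5]
      rw [← Finset.sum_div, div_div_div_cancel_right₀ hz.ne', softmax]
    have h6 : dev q y ⬝ᵥ ξ = ξ y - m := by
      rw [dev, sub_dotProduct, single_one_dotProduct]; rfl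
    rw [h4, h6, Real.exp_sub, mul_div_assoc]
    exact mul_le_mul_of_nonneg_left
      (div_le_div_of_nonneg_left (Real.exp_pos _).le (Real.exp_pos _) h1) (hq0 y).le
  have h7 : ∫ ω, softmax (f ω) y ^ 2 ∂ν ≤ q y ^ 2 * Real.exp (1 / 4) := by
    calc ∫ ω, softmax (f ω) y ^ 2 ∂ν
        ≤ ∫ ω, q y ^ 2 * Real.exp (((2 : ℝ) • dev q y) ⬝ᵥ (f ω - z)) ∂ν := by
          refine integral_mono (h.integrable_softmax_pow y 2)
            ((h.integrable_exp _).const_mul _) fun ω => ?_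
          refine (pow_le_pow_left₀ (softmax_pos _ _).le (hup ω) 2).trans (le_of_eq ?_)
          rw [mul_pow, ← Real.exp_nat_mul, smul_dotProduct]
          rfl
      _ ≤ _ := by
          rw [integral_const_mul, h.integral_exp]
          refine mul_le_mul_of_nonneg_left (Real.exp_le_exp.2 ?_) (sq_nonneg _)
          rw [Matrix.mulVec_smul, smul_dotProduct, dotProduct_smul]
          have := hquad _ (sum_abs_dev_le (fun k => (hq0 k).le) hq1 y)
          simp only [smul_eq_mul]
          linarith
  -- The lower bound without tilt suffices here: `e_k - e_y` has variance at most `1/8`.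
  have h8 : q y * Real.exp (-(1 / 16)) ≤ ∫ ω, softmax (f ω) y ∂ν := by
    refine le_trans ?_ (h.exp_neg_mixBound_le y 0)
    rw [← Real.exp_log (hq0 y), ← Real.exp_add, Real.exp_le_exp, le_neg, neg_add, neg_neg]
    have h9 : Real.log (q y) = -logisticLoss z y := by rw [logisticLoss, neg_neg]
    rw [h9, neg_neg, logisticLoss_eq, mixBound]
    simp only [smul_zero, add_zero, zero_dotProduct, sub_zero]
    rw [Real.log_le_iff_le_exp (Finset.sum_pos (fun _ _ => Real.exp_pos _) Finset.univ_nonempty),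
      Real.exp_add, Real.exp_sub, Real.exp_log (sum_exp_pos z), Finset.sum_div, Finset.sum_mul]
    refine Finset.sum_le_sum fun k _ => ?_
    rw [Real.exp_add, Real.exp_sub]
    refine mul_le_mul_of_nonneg_left (Real.exp_le_exp.2 ?_) (by positivity)
    have := hquad (Pi.single k 1 - Pi.single y 1) (by
      calc ∑ l, |(Pi.single k 1 - Pi.single y 1 : Fin K → ℝ) l|
          ≤ ∑ l, ((Pi.single k 1 : Fin K → ℝ) l + (Pi.single y 1 : Fin K → ℝ) l) := by
            refine Finset.sum_le_sum fun l _ => (abs_sub _ _).trans (le_of_eq ?_)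
            rw [abs_of_nonneg, abs_of_nonneg] <;>
              simp only [Pi.single_apply] <;> split_ifs <;> simp
        _ = 2 := by rw [Finset.sum_add_distrib]; norm_num)
    linarith
  have h10 : (q y * Real.exp (-(1 / 16))) ^ 2 ≤ (∫ ω, softmax (f ω) y ∂ν) ^ 2 :=
    pow_le_pow_left₀ (mul_nonneg (hq0 y).le (Real.exp_pos _).le) h8 2
  -- The total exponent is `1/4 + 2/16 = 3/8 ≤ 1/2`, and the square root of `e` is below 2.
  have h11 : Real.exp (1 / 4) ≤ 2 * Real.exp (-(1 / 16)) ^ 2 := by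
    have e1 : Real.exp (1 / 4) = Real.exp (3 / 8) * Real.exp (-(1 / 16)) ^ 2 := by
      rw [← Real.exp_nat_mul, ← Real.exp_add]; norm_num
    rw [e1]
    refine mul_le_mul_of_nonneg_right ?_ (by positivity)
    have e2 : Real.exp (3 / 8) ≤ Real.exp (1 / 2) := Real.exp_le_exp.2 (by norm_num)
    have e3 : Real.exp (1 / 2) ^ 2 = Real.exp 1 := by rw [← Real.exp_nat_mul]; norm_num
    have e4 := Real.exp_one_lt_d9
    nlinarith [Real.exp_pos (1 / 2)]
  calc _ ≤ q y ^ 2 * Real.exp (1 / 4) := h7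
    _ ≤ q y ^ 2 * (2 * Real.exp (-(1 / 16)) ^ 2) := mul_le_mul_of_nonneg_left h11 (sq_nonneg _)
    _ = 2 * (q y * Real.exp (-(1 / 16))) ^ 2 := by ring
    _ ≤ _ := by linarith

end HasNormalMgf

end Moments

/-! ### Concentration -/

section Concentration

variable {E : Type*} [MeasurableSpace E]

/-- Multiply by `e^x ≥ 1 + x + x²/2` and note that `(1 - x + x²/2)(1 + x + x²/2) = 1 + x⁴/4`. -/
theorem exp_neg_le_quadratic {x : ℝ} (hx : 0 ≤ x) : Real.exp (-x) ≤ 1 - x + x ^ 2 / 2 := by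
  have h1 := Real.quadratic_le_exp_of_nonneg hx
  have h2 : Real.exp (-x) * Real.exp x = 1 := by rw [← Real.exp_add]; simp
  have h3 : 0 ≤ 1 - x + x ^ 2 / 2 := by nlinarith [sq_nonneg (x - 1)]
  have h4 : 1 ≤ (1 - x + x ^ 2 / 2) * Real.exp x := by
    nlinarith [mul_le_mul_of_nonneg_left h1 h3, sq_nonneg (x ^ 2)]
  exact le_of_mul_le_mul_right (h2.trans_le h4) (Real.exp_pos x)

/-- A lower tail bound for means of independent nonnegative variables. -/
theorem measureReal_mean_le {ν : Measure E} [IsProbabilityMeasure ν] {X : E → ℝ}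
    (hX : Measurable X) (hX0 : ∀ ω, 0 ≤ X ω) (hX1 : ∀ ω, X ω ≤ 1) (hp : 0 < ∫ ω, X ω ∂ν)
    (hX2 : ∫ ω, X ω ^ 2 ∂ν ≤ 2 * (∫ ω, X ω ∂ν) ^ 2) {m : ℕ} (hm : 0 < m) {s : ℝ} (hs : 0 ≤ s) :
    (Measure.pi fun _ : Fin m => ν).real
      {ω | (1 / (m : ℝ)) * ∑ i, X (ω i) ≤ (1 - s) * ∫ ω, X ω ∂ν} ≤
        Real.exp (-(m * (s ^ 2 / 4))) := by
  set p := ∫ ω, X ω ∂ν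
  -- The Chernoff exponent per sample is `-τ s p + τ² p²`. This `τ` minimizes it, with value
  -- `-s²/4`, free of `p` because the second moment is relative to `p²`.
  set τ := s / (2 * p)
  have hτ : 0 ≤ τ := by positivity
  have hm' : (0 : ℝ) < m := by exact_mod_cast hm
  have hset : {ω : Fin m → E | (1 / (m : ℝ)) * ∑ i, X (ω i) ≤ (1 - s) * p} =
      {ω | ∑ i, X (ω i) ≤ m * ((1 - s) * p)} := by
    ext ω
    simp only [Set.mem_ofPred_eq]
    rw [one_div, inv_mul_le_iff₀ hm']
  have hmeas : Measurable fun ω : Fin m → E => ∑ i, X (ω i) := by fun_prop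
  have hintE : Integrable (fun ω : Fin m → E => Real.exp (-τ * ∑ i, X (ω i)))
      (Measure.pi fun _ : Fin m => ν) := by
    refine Integrable.of_bound (hmeas.const_mul (-τ)).exp.aestronglyMeasurable 1
      (Filter.Eventually.of_forall fun ω => ?_)
    rw [Real.norm_of_nonneg (Real.exp_pos _).le, Real.exp_le_one_iff]
    have : 0 ≤ ∑ i, X (ω i) := Finset.sum_nonneg fun i _ => hX0 _
    nlinarith
  have h1 := measure_le_le_exp_mul_mgf (μ := Measure.pi fun _ : Fin m => ν)
    (X := fun ω => ∑ i, X (ω i)) (m * ((1 - s) * p)) (neg_nonpos.2 hτ) hintE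
  have h2 : mgf (fun ω : Fin m → E => ∑ i, X (ω i)) (Measure.pi fun _ : Fin m => ν) (-τ) =
      (∫ ω, Real.exp (-τ * X ω) ∂ν) ^ m := by
    rw [mgf]
    simp_rw [Finset.mul_sum, Real.exp_sum]
    rw [integral_fintype_prod_eq_pow (fun ω => Real.exp (-τ * X ω)), Fintype.card_fin]
  have hb1 : Integrable X ν := Integrable.of_bound hX.aestronglyMeasurable 1
    (Filter.Eventually.of_forall fun ω => by rw [Real.norm_of_nonneg (hX0 ω)]; exact hX1 ω)
  have hb2 : Integrable (fun ω => X ω ^ 2) ν :=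
    Integrable.of_bound (hX.pow_const 2).aestronglyMeasurable 1
      (Filter.Eventually.of_forall fun ω => by
        rw [Real.norm_of_nonneg (sq_nonneg _)]; exact pow_le_one₀ (hX0 ω) (hX1 ω))
  have hb3 : Integrable (fun ω => 1 - τ * X ω) ν := (integrable_const 1).sub (hb1.const_mul τ)
  have h3 : ∫ ω, Real.exp (-τ * X ω) ∂ν ≤ Real.exp (-τ * p + τ ^ 2 * p ^ 2) := by
    calc ∫ ω, Real.exp (-τ * X ω) ∂ν ≤ ∫ ω, (1 - τ * X ω + τ ^ 2 / 2 * X ω ^ 2) ∂ν := by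
          refine integral_mono (Integrable.of_bound (by fun_prop) 1
            (Filter.Eventually.of_forall fun ω => ?_))
            (hb3.add (hb2.const_mul _)) fun ω => ?_
          · rw [Real.norm_of_nonneg (Real.exp_pos _).le, Real.exp_le_one_iff]
            nlinarith [hX0 ω]
          · have := exp_neg_le_quadratic (mul_nonneg hτ (hX0 ω))
            rw [← neg_mul] at this
            refine this.trans (le_of_eq ?_)
            ring
      _ = 1 - τ * p + τ ^ 2 / 2 * ∫ ω, X ω ^ 2 ∂ν := by
          rw [integral_add hb3 (hb2.const_mul _),
            integral_sub (integrable_const 1) (hb1.const_mul τ), integral_const_mul,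
            integral_const_mul]
          simp [p]
      _ ≤ 1 + (-τ * p + τ ^ 2 * p ^ 2) := by nlinarith [sq_nonneg τ]
      _ ≤ _ := by linarith [Real.add_one_le_exp (-τ * p + τ ^ 2 * p ^ 2)]
  rw [hset]
  refine h1.trans ?_
  rw [h2]
  calc Real.exp (-(-τ) * (m * ((1 - s) * p))) * (∫ ω, Real.exp (-τ * X ω) ∂ν) ^ m
      ≤ Real.exp (-(-τ) * (m * ((1 - s) * p))) * Real.exp (-τ * p + τ ^ 2 * p ^ 2) ^ m :=
        mul_le_mul_of_nonneg_left (pow_le_pow_left₀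
          (integral_nonneg fun ω => (Real.exp_pos _).le) h3 m) (Real.exp_pos _).le
    _ = Real.exp (-(m * (s ^ 2 / 4))) := by
        rw [← Real.exp_nat_mul, ← Real.exp_add]
        congr 1
        simp only [τ]
        field_simp
        ring

/-- A union bound. `G` need not be measurable: it is only compared with the measurable complement of
the bad events. In the application it is an intersection over uncountably many comparators. -/
theorem measureReal_forall_ge {n : ℕ} {F : Type*} [MeasurableSpace F] (ρ : Fin n → Measure F)
    [∀ t, IsProbabilityMeasure (ρ t)] (bad : Fin n → Set F) (hbad : ∀ t, MeasurableSet (bad t))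
    {η : ℝ} (h : ∀ t, (ρ t).real (bad t) ≤ η) {G : Set (Fin n → F)}
    (hG : ∀ ω, (∀ t, ω t ∉ bad t) → ω ∈ G) : 1 - n * η ≤ (Measure.pi ρ).real G := by
  set U : Set (Fin n → F) := ⋃ t, Function.eval t ⁻¹' bad t
  have hU : MeasurableSet U := MeasurableSet.iUnion fun t => measurable_pi_apply t (hbad t)
  have h1 : (Measure.pi ρ).real U ≤ n * η := by
    calc (Measure.pi ρ).real U ≤ ∑ t, (Measure.pi ρ).real (Function.eval t ⁻¹' bad t) :=
          measureReal_iUnion_fintype_le _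
      _ = ∑ t, (ρ t).real (bad t) := Finset.sum_congr rfl fun t _ =>
          (measurePreserving_eval ρ t).measureReal_preimage (hbad t).nullMeasurableSet
      _ ≤ ∑ _t : Fin n, η := Finset.sum_le_sum fun t _ => h t
      _ = n * η := by simp
  have h2 : (Measure.pi ρ).real Uᶜ ≤ (Measure.pi ρ).real G := by
    refine measureReal_mono fun ω hω => hG ω fun t ht => hω ?_
    exact Set.mem_iUnion.2 ⟨t, ht⟩
  rw [probReal_compl_eq_one_sub hU] at h2
  linarith

end Concentration

/-! ### The regret of the sampled forecasts -/

section Forecast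

variable {K m : ℕ}

/-- The average of the sampled probabilities of the class `y`. -/
noncomputable def sampleMean (ω : Fin m → Fin K → ℝ) (y : Fin K) : ℝ :=
  (1 / (m : ℝ)) * ∑ i, softmax (ω i) y

theorem sampleMean_nonneg [NeZero K] (ω : Fin m → Fin K → ℝ) (y : Fin K) :
    0 ≤ sampleMean ω y :=
  mul_nonneg (by positivity) (Finset.sum_nonneg fun i _ => (softmax_pos _ _).le)

theorem smooth_sampleMean_pos [NeZero K] {μ : ℝ} (hμ : 0 < μ) (hμ1 : μ ≤ 1)
    (ω : Fin m → Fin K → ℝ) (k : Fin K) : 0 < smooth μ (sampleMean ω) k := by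
  have h1 := mul_nonneg (sub_nonneg.2 hμ1) (sampleMean_nonneg ω k)
  have h2 : 0 < μ / K := div_pos hμ (by exact_mod_cast NeZero.pos K)
  rw [smooth]; linarith

/-- The smoothed mean sums to one, so the softmax of its logarithm returns it unchanged. -/
theorem logisticLoss_prediction [NeZero K] (hm : 1 ≤ m) {μ : ℝ} (hμ : 0 < μ) (hμ1 : μ ≤ 1)
    (ω : Fin m → Fin K → ℝ) (y : Fin K) :
    logisticLoss (prediction μ ω) y = -Real.log (smooth μ (sampleMean ω) y) := by
  have hpos := smooth_sampleMean_pos hμ hμ1 ω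
  have hexp : ∀ k, Real.exp (prediction μ ω k) = smooth μ (sampleMean ω) k :=
    fun k => Real.exp_log (hpos k)
  have hm' : (m : ℝ) ≠ 0 := by positivity
  have hK : (K : ℝ) ≠ 0 := by exact_mod_cast NeZero.ne K
  have hsum : ∑ k, smooth μ (sampleMean ω) k = 1 := by
    simp only [smooth, sampleMean, Finset.sum_add_distrib, ← Finset.mul_sum, Finset.sum_const,
      Finset.card_univ, Fintype.card_fin, nsmul_eq_mul]
    rw [Finset.sum_comm]
    simp only [sum_softmax, Finset.sum_const, Finset.card_univ, Fintype.card_fin, nsmul_eq_mul]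
    field_simp
    ring
  rw [logisticLoss, softmax]
  simp_rw [hexp]
  rw [hsum, div_one]

theorem neg_log_smooth_le_log [NeZero K] {μ : ℝ} (hμ : 1 / 2 ≤ μ) (hμ1 : μ ≤ 1)
    (ω : Fin m → Fin K → ℝ) (y : Fin K) :
    -Real.log (smooth μ (sampleMean ω) y) ≤ Real.log K + Real.log 2 := by
  have hK : (0 : ℝ) < K := by exact_mod_cast NeZero.pos K
  rw [← Real.log_mul hK.ne' two_ne_zero, ← Real.log_inv]
  refine Real.log_le_log (inv_pos.2 (smooth_sampleMean_pos (by linarith) hμ1 ω y)) ?_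
  have h1 := mul_nonneg (sub_nonneg.2 hμ1) (sampleMean_nonneg ω y)
  have h2 : (1 / 2) / (K : ℝ) ≤ μ / K := div_le_div_of_nonneg_right hμ hK.le
  have h3 : ((K : ℝ) * 2)⁻¹ ≤ smooth μ (sampleMean ω) y := by
    rw [smooth]
    have : ((K : ℝ) * 2)⁻¹ = (1 / 2) / K := by field_simp
    linarith
  exact inv_le_of_inv_le₀ (by positivity) h3

theorem neg_log_smooth_le [NeZero K] {μ p : ℝ} (hμ : 0 < μ) (hμ1 : μ ≤ 1 / 2) (hp : 0 < p)
    {ω : Fin m → Fin K → ℝ} {y : Fin K} (h : (1 - 2 * (μ * Real.sqrt μ)) * p ≤ sampleMean ω y) :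
    -Real.log (smooth μ (sampleMean ω) y) ≤ -Real.log p + 7 * μ := by
  have hK : (0 : ℝ) < K := by exact_mod_cast NeZero.pos K
  have hsq : Real.sqrt μ ≤ 71 / 100 := by
    rw [Real.sqrt_le_left (by norm_num)]; linarith
  -- From `μ ≤ 1/2` the square root of `μ` is at most `0.71`, so the relative deviation is at most
  -- linear in `μ`. The two logarithms below then cost `2 μ` and `5 μ`.
  set x := 142 / 100 * μ
  have hx : 2 * (μ * Real.sqrt μ) ≤ x := by simp only [x]; nlinarith
  have hx1 : x ≤ 71 / 100 := by simp only [x]; linarith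
  have h1 : (1 - μ) * ((1 - x) * p) ≤ smooth μ (sampleMean ω) y := by
    have e1 : (1 - x) * p ≤ sampleMean ω y := le_trans (by nlinarith) h
    have e2 := mul_le_mul_of_nonneg_left e1 (by linarith : 0 ≤ 1 - μ)
    have e3 : 0 < μ / K := div_pos hμ hK
    rw [smooth]; linarith
  have h2 : 0 < (1 - μ) * ((1 - x) * p) := mul_pos (by linarith) (mul_pos (by linarith) hp)
  have h3 := Real.log_le_log h2 h1
  rw [Real.log_mul (by linarith) (mul_pos (by linarith) hp).ne',
    Real.log_mul (by linarith) hp.ne'] at h3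
  have h4 : -(2 * μ) ≤ Real.log (1 - μ) := by
    have := Real.one_sub_inv_le_log_of_pos (x := 1 - μ) (by linarith)
    have e : (1 - μ)⁻¹ ≤ 1 + 2 * μ := by
      rw [inv_le_iff_one_le_mul₀ (by linarith)]; nlinarith
    linarith
  have h5 : -(5 * μ) ≤ Real.log (1 - x) := by
    have := Real.one_sub_inv_le_log_of_pos (x := 1 - x) (by linarith)
    have e : (1 - x)⁻¹ ≤ 1 + 5 * μ := by
      rw [inv_le_iff_one_le_mul₀ (by linarith)]
      simp only [x]
      nlinarith
    linarith
  linarith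

end Forecast

/-! ### From the curvature bound to the stated regret bound -/

section Bounds

/-- Bernoulli's inequality for the exponent `s / s' ≤ 1`: `(1 + c/s)^(s/s') ≤ 1 + c/s'`. -/
theorem mul_log_one_add_div_mono {c s s' : ℝ} (hc : 0 ≤ c) (hs : 0 < s) (hss : s ≤ s') :
    s * Real.log (1 + c / s) ≤ s' * Real.log (1 + c / s') := by
  have hs' := hs.trans_le hss
  have h1 := rpow_one_add_le_one_add_mul_self (s := c / s) (p := s / s')
    (by have : 0 ≤ c / s := by positivity
        linarith) (by positivity) ((div_le_one hs').2 hss)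
  have h2 : s / s' * (c / s) = c / s' := by field_simp
  rw [h2] at h1
  have h3 := Real.log_le_log (by positivity) h1
  rw [Real.log_rpow (by positivity), div_mul_eq_mul_div, div_le_iff₀ hs'] at h3
  linarith

theorem logisticBound_nonneg {n K d : ℕ} {B R : ℝ} (hB : 0 < B) (hR : 0 < R) :
    0 ≤ logisticBound n K d B R := by
  have hK : 0 ≤ Real.log K := Real.log_natCast_nonneg K
  have : 0 ≤ Real.log (1 + n / (d * K * (Real.log K + B * R))) :=
    Real.log_nonneg (by have : (0 : ℝ) ≤ n / (d * K * (Real.log K + B * R)) := by positivity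
                        linarith)
  rw [logisticBound]
  positivity

/-- The bounds of the deterministic analysis in terms of `logisticBound`. -/
theorem curvature_bound_le {n K d : ℕ} {B R lam β : ℝ} (hK : 2 ≤ K) (hd : 1 ≤ d)
    (hB : 0 < B) (hR : 0 < R) (hlam : lam = 32 * d * K * R ^ 2)
    (hβ : β = (Real.log K / 2 + B * R + 1)⁻¹) :
    lam * B ^ 2 + 4 / β * (K * d * Real.log (1 + β * n * R ^ 2 / (2 * lam * (K * d)))) ≤
      32 * logisticBound n K d B R := by
  have hK' : (2 : ℝ) ≤ K := by exact_mod_cast hK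
  have hd' : (1 : ℝ) ≤ d := by exact_mod_cast hd
  have hlog : 1 / 2 ≤ Real.log K := by
    have h1 := Real.log_le_log two_pos hK'
    linarith [Real.log_two_gt_d9]
  have hBR : 0 < B * R := mul_pos hB hR
  set a := Real.log K + B * R
  have ha : 0 < a := by positivity
  have hlog2 : 0.69 ≤ Real.log K := by
    have h1 := Real.log_le_log two_pos hK'
    have := Real.log_two_gt_d9
    norm_num at this ⊢
    linarith
  have hβpos : 0 < β := by rw [hβ]; positivity
  -- The summand 1 in `1 / β` is absorbed by `(3/2) log K`, which is where at least two classes are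
  -- needed.
  have hβinv : 1 / β ≤ 2 * a := by
    rw [hβ, one_div, inv_inv]; simp only [a]; norm_num at hlog2; linarith
  have e1 : β * n * R ^ 2 / (2 * lam * (K * d)) = n / (64 * (d * K) ^ 2) / (1 / β) := by
    rw [hlam]; field_simp; ring
  have h1 := mul_log_one_add_div_mono (c := n / (64 * (d * K) ^ 2)) (by positivity)
    (one_div_pos.2 hβpos) hβinv
  have h2 : (n : ℝ) / (64 * (d * K) ^ 2) / (2 * a) ≤ n / (d * K * a) := by
    rw [div_div]
    refine div_le_div_of_nonneg_left (by positivity) (by positivity) ?_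
    have : 1 ≤ (d : ℝ) * K := by nlinarith
    nlinarith [mul_pos (by linarith : (0 : ℝ) < d * K) ha]
  have h3 : Real.log (1 + n / (64 * (d * K) ^ 2) / (2 * a)) ≤ Real.log (1 + n / (d * K * a)) :=
    Real.log_le_log (by positivity) (by linarith)
  have h4 : 0 ≤ Real.log (1 + n / (d * K * a)) := by
    have : (0 : ℝ) ≤ n / (d * K * a) := by positivity
    exact Real.log_nonneg (by linarith)
  have e2 : 4 / β * (K * d * Real.log (1 + β * n * R ^ 2 / (2 * lam * (K * d)))) =
      4 * (K * d) * (1 / β * Real.log (1 + n / (64 * (d * K) ^ 2) / (1 / β))) := by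
    rw [e1]; ring
  have h5 : 1 / β * Real.log (1 + n / (64 * (d * K) ^ 2) / (1 / β)) ≤
      2 * a * Real.log (1 + n / (d * K * a)) :=
    h1.trans (mul_le_mul_of_nonneg_left h3 (by positivity))
  have h6 := mul_le_mul_of_nonneg_left h5 (by positivity : (0 : ℝ) ≤ 4 * (K * d))
  rw [e2, hlam, logisticBound]
  change _ ≤ 32 * (_ + d * K * a * Real.log (1 + n / (d * K * a)))
  have h7 : 0 ≤ d * K * a * Real.log (1 + n / (d * K * a)) := by positivity
  nlinarith

end Bounds

/-! ### High-probability regret guarantees -/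

section Guarantee

variable {n K d m : ℕ} {lam β ε R B δ μ : ℝ} {x : Fin n → EuclideanSpace ℝ (Fin d)}
  {y : Fin n → Fin K} {A : ℕ → Matrix (Fin K × Fin d) (Fin K × Fin d) ℝ} {b θ : ℕ → Param K d}

theorem logisticLoss_eq_zero (z : Fin 1 → ℝ) (y : Fin 1) : logisticLoss z y = 0 := by
  rw [logisticLoss_eq, Subsingleton.elim y 0]; simp

/-- A bounded comparator cannot do much better than uniform guessing. This handles very short
horizons, where the smoothing parameter may be large. -/
theorem paramLoss_ge [NeZero K] {x : EuclideanSpace ℝ (Fin d)} {y : Fin K} {u : Param K d}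
    (hx : ‖x‖ ≤ R) (hu : ‖u‖ ≤ B) : Real.log K - 2 * (B * R) ≤ paramLoss x y u := by
  have hb : ∀ k, |linPred u x k| ≤ B * R := fun k => (abs_linPred_le u x k).trans
    (by rw [mul_comm B R]; exact mul_le_mul hx hu (norm_nonneg _) ((norm_nonneg _).trans hx))
  have hK : (0 : ℝ) < K := by exact_mod_cast NeZero.pos K
  have h1 : Real.log K - B * R ≤ Real.log (∑ j, Real.exp (linPred u x j)) := by
    rw [Real.le_log_iff_exp_le (sum_exp_pos _), Real.exp_sub, Real.exp_log hK, div_eq_mul_inv,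
      ← Real.exp_neg]
    calc (K : ℝ) * Real.exp (-(B * R)) = ∑ _j : Fin K, Real.exp (-(B * R)) := by simp
      _ ≤ _ := Finset.sum_le_sum fun k _ => Real.exp_le_exp.2 (abs_le.1 (hb k)).1
  rw [paramLoss, logisticLoss_eq]
  linarith [(abs_le.1 (hb y)).2]

theorem regret_prediction_le [NeZero K] [NeZero d] (hrun : IsRun lam β ε x y A b θ) (hK : 2 ≤ K)
    (hB : 0 < B) (hR : 0 < R) (hx : ∀ t, ‖x t‖ ≤ R) (hlam : lam = 32 * d * K * R ^ 2)
    (hβ : β = (Real.log K / 2 + B * R + 1)⁻¹) (hm : 1 ≤ m) (hε : 0 ≤ ε)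
    (hnε : n * (R * ε) ≤ 1) (hμ : 0 < μ) (hμ1 : μ ≤ 1) {e : ℝ} {ω : Fin n → Fin m → Fin K → ℝ}
    (he : ∀ t, -Real.log (smooth μ (sampleMean (ω t)) (y t)) ≤ roundBound x y A θ t + e)
    {u : Param K d} (hu : ‖u‖ ≤ B) :
    regret x y (fun t => prediction μ (ω t)) u ≤
      32 * logisticBound n K d B R + 12 + n * e := by
  have hd1 : 1 ≤ d := NeZero.one_le
  have hK' : (2 : ℝ) ≤ K := by exact_mod_cast hK
  have hd' : (1 : ℝ) ≤ d := by exact_mod_cast hd1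
  have hl : 0 < lam := by rw [hlam]; positivity
  have hlogK : 0 ≤ Real.log K := Real.log_natCast_nonneg K
  have hβ0 : 0 < β := by rw [hβ]; positivity
  have hβ1 : β ≤ 1 := by
    rw [hβ]; exact inv_le_one_of_one_le₀ (by nlinarith [mul_pos hB hR])
  have hR32 : 32 * R ^ 2 ≤ lam := by
    rw [hlam]
    have : 1 ≤ (d : ℝ) * K := by nlinarith
    nlinarith [mul_le_mul_of_nonneg_right this (sq_nonneg R)]
  have h1 := hrun.sum_roundBound_le hl hβ0 hβ1 hβ.le hε hR32 hx hu
  have h2 := curvature_bound_le (n := n) hK hd1 hB hR hlam hβ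
  have h3 := Finset.sum_le_sum fun t (_ : t ∈ Finset.univ) => he t
  rw [Finset.sum_add_distrib, Finset.sum_const, Finset.card_univ, Fintype.card_fin,
    nsmul_eq_mul] at h3
  simp only [regret, logisticLoss_prediction hm hμ hμ1]
  linarith

theorem log_le_cube_root {K : ℝ} (hK : 1 ≤ K) : Real.log K ≤ 3 * K ^ (1 / 3 : ℝ) := by
  have h := Real.log_le_rpow_div (x := K) (by linarith) (ε := 1 / 3) (by norm_num)
  linarith

/-- For `μ ≤ 1/2` smoothing costs `7 μ`. For larger `μ` the uniform part alone bounds the loss by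
`log K + log 2 ≤ 4 K^{1/3} ≤ 8 K^{1/3} μ`, while the round bound is nonnegative because it dominates
`-log p`. -/
theorem regret_le_of_sampleMean_ge [NeZero K] [NeZero d] (hrun : IsRun lam β ε x y A b θ)
    (hK : 2 ≤ K) (hB : 0 < B) (hR : 0 < R) (hx : ∀ t, ‖x t‖ ≤ R)
    (hlam : lam = 32 * d * K * R ^ 2)
    (hβ : β = (Real.log K / 2 + B * R + 1)⁻¹) (hm : 1 ≤ m) (hε : 0 ≤ ε)
    (hnε : n * (R * ε) ≤ 1) (hμ : 0 < μ) (hμ1 : μ ≤ 1) {p : Fin n → ℝ} (hp0 : ∀ t, 0 < p t)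
    (hp1 : ∀ t, p t ≤ 1) (hp : ∀ t, -Real.log (p t) ≤ roundBound x y A θ t)
    {ω : Fin n → Fin m → Fin K → ℝ}
    (hω : ∀ t, (1 - 2 * (μ * Real.sqrt μ)) * p t ≤ sampleMean (ω t) (y t))
    {u : Param K d} (hu : ‖u‖ ≤ B) :
    regret x y (fun t => prediction μ (ω t)) u ≤
      32 * logisticBound n K d B R + 12 + n * (8 * ((K : ℝ) ^ (1 / 3 : ℝ) * μ)) := by
  have hK1 : (1 : ℝ) ≤ K := by exact_mod_cast (by omega : 1 ≤ K)
  have hKr : 1 ≤ (K : ℝ) ^ (1 / 3 : ℝ) := Real.one_le_rpow hK1 (by norm_num)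
  refine regret_prediction_le hrun hK hB hR hx hlam hβ hm hε hnε hμ hμ1 (fun t => ?_) hu
  rcases le_total μ (1 / 2) with h | h
  · have h1 := neg_log_smooth_le hμ h (hp0 t) (hω t)
    have h2 : μ ≤ (K : ℝ) ^ (1 / 3 : ℝ) * μ := le_mul_of_one_le_left hμ.le hKr
    linarith [hp t]
  · have h1 := neg_log_smooth_le_log h hμ1 (ω t) (y t)
    have h2 := log_le_cube_root hK1
    have h3 : Real.log 2 ≤ 1 := by linarith [Real.log_two_lt_d9]
    have h4 : Real.log (p t) ≤ 0 := Real.log_nonpos (hp0 t).le (hp1 t)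
    have h5 : (K : ℝ) ^ (1 / 3 : ℝ) * (1 / 2) ≤ (K : ℝ) ^ (1 / 3 : ℝ) * μ :=
      mul_le_mul_of_nonneg_left h (by positivity)
    linarith [hp t]

theorem regret_le_of_sampleMean_ge_of_small [NeZero K] [NeZero d]
    (hrun : IsRun lam β ε x y A b θ)
    (hK : 2 ≤ K) (hB : 0 < B) (hR : 0 < R) (hx : ∀ t, ‖x t‖ ≤ R)
    (hlam : lam = 32 * d * K * R ^ 2)
    (hβ : β = (Real.log K / 2 + B * R + 1)⁻¹) (hm : 1 ≤ m) (hε : 0 ≤ ε)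
    (hnε : n * (R * ε) ≤ 1) (hn : 1 ≤ n) (hμ : 0 < μ) (hμn : n * μ ≤ 1) {p : Fin n → ℝ}
    (hp0 : ∀ t, 0 < p t) (hp : ∀ t, -Real.log (p t) ≤ roundBound x y A θ t)
    {ω : Fin n → Fin m → Fin K → ℝ}
    (hω : ∀ t, (1 - 2 * (μ * Real.sqrt μ)) * p t ≤ sampleMean (ω t) (y t))
    {u : Param K d} (hu : ‖u‖ ≤ B) :
    regret x y (fun t => prediction μ (ω t)) u ≤ 32 * logisticBound n K d B R + 19 := by
  have hn1 : (1 : ℝ) ≤ n := by exact_mod_cast hn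
  have hμ1 : μ ≤ 1 := by nlinarith
  rcases le_total μ (1 / 2) with h | h
  · have := regret_prediction_le hrun hK hB hR hx hlam hβ hm hε hnε hμ hμ1 (e := 7 * μ)
      (fun t => (neg_log_smooth_le hμ h (hp0 t) (hω t)).trans (by linarith [hp t])) hu
    linarith
  -- Here `n μ ≤ 1` and `μ ≥ 1/2` force `n ≤ 2`. Two rounds of excess `1 + 2BR` are covered by `32
  -- B²R² + 19`, as `logisticBound` is at least `B²R²`.
  · have h1 : ∀ t, logisticLoss (prediction μ (ω t)) (y t) ≤ paramLoss (x t) (y t) u +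
        (1 + 2 * (B * R)) := by
      intro t
      rw [logisticLoss_prediction hm hμ hμ1]
      have e1 := neg_log_smooth_le_log h hμ1 (ω t) (y t)
      have e2 := paramLoss_ge (y := y t) (hx t) hu
      linarith [Real.log_two_lt_d9]
    have h2 := Finset.sum_le_sum fun t (_ : t ∈ Finset.univ) => h1 t
    rw [Finset.sum_add_distrib, Finset.sum_const, Finset.card_univ, Fintype.card_fin,
      nsmul_eq_mul] at h2
    have h3 : (n : ℝ) ≤ 2 := by nlinarith
    have hK1 : (1 : ℝ) ≤ K := by exact_mod_cast (by omega : 1 ≤ K)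
    have hd1 : (1 : ℝ) ≤ d := by exact_mod_cast NeZero.one_le
    have h4 : B ^ 2 * R ^ 2 ≤ logisticBound n K d B R := by
      have hlogK : 0 ≤ Real.log K := Real.log_natCast_nonneg K
      have e1 : 0 ≤ d * K * (Real.log K + B * R) *
          Real.log (1 + n / (d * K * (Real.log K + B * R))) := by
        have : (0 : ℝ) ≤ n / (d * K * (Real.log K + B * R)) := by positivity
        have : 0 ≤ Real.log (1 + n / (d * K * (Real.log K + B * R))) :=
          Real.log_nonneg (by linarith)
        positivity
      have e2 : 1 ≤ (d : ℝ) * K := by nlinarith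
      have e3 : 0 ≤ B ^ 2 * R ^ 2 := by positivity
      rw [logisticBound]
      nlinarith [mul_le_mul_of_nonneg_right e2 e3]
    have h5 : 0 < B * R := mul_pos hB hR
    have h6 : (n : ℝ) * (1 + 2 * (B * R)) ≤ 2 * (1 + 2 * (B * R)) :=
      mul_le_mul_of_nonneg_right h3 (by linarith)
    rw [regret]
    nlinarith [sq_nonneg (B * R - 1), sq_nonneg (B * R)]

/-- With high probability no sample mean is much smaller than its expectation. -/
theorem measureReal_sampleMean_ge [NeZero K] {E : Type*} [MeasurableSpace E]
    {ν : Fin n → Measure E} [∀ t, IsProbabilityMeasure (ν t)] {f : Fin n → E → Fin K → ℝ}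
    {z : Fin n → Fin K → ℝ} {S : Fin n → Matrix (Fin K) (Fin K) ℝ}
    (hf : ∀ t, HasNormalMgf (ν t) (f t) (z t) (S t))
    (hS : ∀ t u w, |u ⬝ᵥ S t *ᵥ w| ≤ (∑ k, |u k|) * (∑ k, |w k|) / 32)
    (hn : 1 ≤ n) (hm : 1 ≤ m) (hδ : 0 < δ) (hμ : 0 < μ) (hμm : m * μ ^ 3 = Real.log (n / δ))
    {G : Set (Fin n → Fin m → E)}
    (hG : ∀ ω, (∀ t, (1 - 2 * (μ * Real.sqrt μ)) * ∫ g, softmax (f t g) (y t) ∂(ν t) ≤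
      sampleMean (fun i => f t (ω t i)) (y t)) → ω ∈ G) :
    1 - δ ≤ (Measure.pi fun t => Measure.pi fun _ : Fin m => ν t).real G := by
  have hn' : (0 : ℝ) < n := by exact_mod_cast hn
  have hs : Real.sqrt μ ^ 2 = μ := Real.sq_sqrt hμ.le
  have h := measureReal_forall_ge (fun t => Measure.pi fun _ : Fin m => ν t)
    (fun t => {ω : Fin m → E | (1 / (m : ℝ)) * ∑ i, softmax (f t (ω i)) (y t) ≤
      (1 - 2 * (μ * Real.sqrt μ)) * ∫ g, softmax (f t g) (y t) ∂(ν t)})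
    (fun t => measurableSet_le ((Finset.measurable_sum _ fun i _ =>
      ((hf t).measurable_softmax (y t)).comp (measurable_pi_apply i)).const_mul _)
        measurable_const)
    (η := δ / n) (fun t => by
      refine (measureReal_mean_le ((hf t).measurable_softmax (y t))
        (fun ω => (softmax_pos _ _).le) (fun ω => softmax_le_one _ _)
        ((hf t).integral_softmax_pos (y t)) ((hf t).integral_softmax_sq_le (y t) (hS t)) hm
        (s := 2 * (μ * Real.sqrt μ)) (by positivity)).trans (le_of_eq ?_)
      -- The deviation `2 μ^{3/2}` is chosen so that the exponent is `m μ³ = log(n/δ)`, which gives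
      -- failure probability `δ / n` per round.
      have e1 : (m : ℝ) * ((2 * (μ * Real.sqrt μ)) ^ 2 / 4) = Real.log (n / δ) := by
        rw [← hμm, mul_pow, mul_pow, hs]; ring
      rw [e1, ← Real.log_inv, inv_div, Real.exp_log (by positivity)])
    (G := G) (fun ω hω => hG ω fun t => (not_le.1 (hω t)).le)
  rwa [mul_div_cancel₀ _ hn'.ne'] at h

/-- The probabilistic part is proved for an arbitrary sample space with normal exponential moments,
then used twice: for the prescribed Gaussian law and for the standard Gaussian noise fed to the
program. All deterministic reasoning is isolated in `hdet`. -/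
theorem regretGuarantee_of_sampleMean [NeZero K] {P : Learner} {r : ℝ}
    (hl : 0 < lam) (hβ : 0 ≤ β) (hR : 32 * R ^ 2 ≤ lam) (hx : ∀ t, ‖x t‖ ≤ R)
    (hn : 1 ≤ n) (hm : 1 ≤ m) (hδ : 0 < δ) (hμ : 0 < μ) (hμm : m * μ ^ 3 = Real.log (n / δ))
    (hP : P.Implements m lam β μ ε x y)
    (hdet : ∀ (A : ℕ → Matrix (Fin K × Fin d) (Fin K × Fin d) ℝ) (b θ : ℕ → Param K d),
      IsRun lam β ε x y A b θ → ∀ p : Fin n → ℝ, (∀ t, 0 < p t) → (∀ t, p t ≤ 1) →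
      (∀ t, -Real.log (p t) ≤ roundBound x y A θ t) → ∀ ω : Fin n → Fin m → Fin K → ℝ,
      (∀ t, (1 - 2 * (μ * Real.sqrt μ)) * p t ≤ sampleMean (ω t) (y t)) →
      ∀ u : Param K d, ‖u‖ ≤ B → regret x y (fun t => prediction μ (ω t)) u ≤ r) :
    RegretGuarantee P m lam β μ ε δ B r x y := by
  have hx2 : ∀ t, 32 * ‖x t‖ ^ 2 ≤ lam := fun t => by
    have := pow_le_pow_left₀ (norm_nonneg _) (hx t) 2
    linarith
  have main : ∀ {E : Type} [MeasurableSpace E] (ν : Fin n → Measure E)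
      [∀ t, IsProbabilityMeasure (ν t)] (f : Fin n → E → Fin K → ℝ)
      (A : ℕ → Matrix (Fin K × Fin d) (Fin K × Fin d) ℝ) (b θ : ℕ → Param K d),
      IsRun lam β ε x y A b θ →
      (∀ t : Fin n, HasNormalMgf (ν t) (f t) (linPred (θ t) (x t)) (sampleCov (A t) (x t))) →
      1 - δ ≤ (Measure.pi fun t => Measure.pi fun _ : Fin m => ν t).real
        {ω | ∀ u : Param K d, ‖u‖ ≤ B →
          regret x y (fun t => prediction μ fun i => f t (ω t i)) u ≤ r} := by
    intro E _ ν _ f A b θ hrun hf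
    refine measureReal_sampleMean_ge (y := y) hf
      (fun t u w => abs_dot_sampleCov_le hl (hrun.dominates hβ t t.2.le) (hx2 t) u w)
      hn hm hδ hμ hμm fun ω hω => ?_
    exact hdet A b θ hrun _ (fun t => (hf t).integral_softmax_pos (y t))
      (fun t => (hf t).integral_softmax_le_one (y t))
      (fun t => by
        rw [neg_le, roundBound, Real.le_log_iff_exp_le ((hf t).integral_softmax_pos (y t))]
        exact (hf t).exp_neg_mixBound_le (y t) _) _ hω
  refine ⟨fun A b θ hrun => ?_, ?_⟩
  · have h := main (fun t : Fin n => multivariateGaussian (WithLp.toLp 2 (linPred (θ t) (x t)))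
      (sampleCov (A t) (x t))) (fun _ g => g.ofLp) A b θ hrun
      fun t => hasNormalMgf_multivariateGaussian _
        (sampleCov_posSemidef hl (hrun.dominates hβ t t.2.le) (x t))
    exact h
  · obtain ⟨A, b, θ, S, hrun, hS, hout⟩ := hP
    have h := main (fun _ => Measure.pi fun _ : Fin K => gaussianReal 0 1)
      (fun t g => linPred (θ t) (x t) + S t *ᵥ g) A b θ hrun fun t => by
        rw [← hS]; exact hasNormalMgf_pi _ _
    have e : ∀ g : Fin n → Fin m → Fin K → ℝ, P.output lam β μ x y g = fun t : Fin n =>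
        prediction μ fun i => linPred (θ t) (x t) + S t *ᵥ g t i := fun g => funext (hout g)
    simp_rw [e]
    exact h

/-- For one class all losses vanish. -/
theorem regret_eq_zero_of_one_class {x : Fin n → EuclideanSpace ℝ (Fin d)} {y : Fin n → Fin 1}
    (pred : Fin n → Fin 1 → ℝ) (u : Param 1 d) : regret x y pred u = 0 := by
  simp [regret, paramLoss, logisticLoss_eq_zero]

/-- With accuracy `e^{-m} / R` the accumulated effect of the inexact minimizers is at most a
constant. -/
theorem natCast_mul_exp_neg_le (hn : 1 ≤ n) (hδ : 0 < δ) (hδ1 : δ < 1)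
    (hm : Real.log (n / δ) ≤ m) : n * Real.exp (-m) ≤ 1 := by
  have hn' : (0 : ℝ) < n := by exact_mod_cast hn
  have h1 : Real.exp (-m) ≤ δ / n := by
    rw [← Real.log_le_log_iff (Real.exp_pos _) (by positivity), Real.log_exp, ← inv_div,
      Real.log_inv]
    linarith
  calc (n : ℝ) * Real.exp (-m) ≤ n * (δ / n) := mul_le_mul_of_nonneg_left h1 hn'.le
    _ ≤ 1 := by rw [mul_div_cancel₀ _ hn'.ne']; exact hδ1.le

theorem regretGuarantee [NeZero K] [NeZero d] {P : Learner} {C : ℝ} (hC : 32 ≤ C) (hn : 1 ≤ n)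
    (hB : 0 < B) (hR : 0 < R) (hδ : 0 < δ) (hδ1 : δ < 1) (hx : ∀ t, ‖x t‖ ≤ R)
    (hlam : lam = 32 * d * K * R ^ 2) (hβ : β = (Real.log K / 2 + B * R + 1)⁻¹)
    (hμ : μ = (Real.log (n / δ) / m) ^ (1 / 3 : ℝ)) (hm : 1 ≤ m)
    (hP : P.Implements m lam β μ (Real.exp (-m) / R) x y) :
    (μ ≤ 1 → RegretGuarantee P m lam β μ (Real.exp (-m) / R) δ B
      (C * (logisticBound n K d B R + n * (K / m * Real.log (n / δ)) ^ (1 / 3 : ℝ)) + C) x y) ∧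
    (n ^ 3 * Real.log (n / δ) ≤ m → RegretGuarantee P m lam β μ (Real.exp (-m) / R) δ B
      (C * logisticBound n K d B R + C) x y) := by
  have hn' : (1 : ℝ) ≤ n := by exact_mod_cast hn
  have hm' : (0 : ℝ) < m := by exact_mod_cast hm
  have hK1 : (1 : ℝ) ≤ K := by exact_mod_cast NeZero.one_le
  have hd1 : (1 : ℝ) ≤ d := by exact_mod_cast NeZero.one_le
  have hL : 0 < Real.log (n / δ) :=
    Real.log_pos ((one_lt_div hδ).2 (hδ1.trans_le hn'))
  set L := Real.log (n / δ)
  have hμ0 : 0 < μ := by rw [hμ]; positivity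
  have hμ3 : μ ^ 3 = L / m := by
    rw [hμ, ← Real.rpow_natCast, ← Real.rpow_mul (by positivity)]; norm_num
  have hμm : m * μ ^ 3 = L := by rw [hμ3]; field_simp
  have hl : 0 < lam := by rw [hlam]; positivity
  have hlogK : 0 ≤ Real.log K := Real.log_natCast_nonneg K
  have hβ0 : 0 ≤ β := by rw [hβ]; positivity
  have hR32 : 32 * R ^ 2 ≤ lam := by
    rw [hlam]
    have : 1 ≤ (d : ℝ) * K := by nlinarith
    nlinarith [mul_le_mul_of_nonneg_right this (sq_nonneg R)]
  have hε : 0 ≤ Real.exp (-m) / R := by positivity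
  have hRε : R * (Real.exp (-m) / R) = Real.exp (-m) := mul_div_cancel₀ _ hR.ne'
  have hLB := logisticBound_nonneg (n := n) (K := K) (d := d) hB hR
  have hroot : (K / m * L) ^ (1 / 3 : ℝ) = (K : ℝ) ^ (1 / 3 : ℝ) * μ := by
    rw [hμ, ← Real.mul_rpow (by positivity) (by positivity)]
    congr 1; ring
  have hroot0 : 0 ≤ n * ((K : ℝ) ^ (1 / 3 : ℝ) * μ) := by positivity
  -- One class is separate: all losses vanish there, but the bound `1 / β ≤ 2 (log K + B R)` may
  -- fail.
  rcases eq_or_lt_of_le (NeZero.one_le : 1 ≤ K) with hK | hK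
  · subst hK
    refine ⟨fun _ => ?_, fun _ => ?_⟩ <;>
    refine regretGuarantee_of_sampleMean hl hβ0 hR32 hx hn hm hδ hμ0 hμm hP
      fun A b θ _ p _ _ _ ω _ u _ => ?_ <;> rw [regret_eq_zero_of_one_class]
    · rw [hroot]; nlinarith
    · nlinarith
  · refine ⟨fun hμ1 => ?_, fun hmn => ?_⟩
    · have hLm : L ≤ m := by
        have : μ ^ 3 ≤ 1 := pow_le_one₀ hμ0.le hμ1
        rw [← hμm]; nlinarith
      refine regretGuarantee_of_sampleMean hl hβ0 hR32 hx hn hm hδ hμ0 hμm hP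
        fun A b θ hrun p hp0 hp1 hp ω hω u hu => ?_
      have h := regret_le_of_sampleMean_ge hrun hK hB hR hx hlam hβ hm hε
        (by rw [hRε]; exact natCast_mul_exp_neg_le hn hδ hδ1 hLm) hμ0 hμ1 hp0 hp1 hp hω hu
      rw [hroot]
      nlinarith
    · have hn3 : (1 : ℝ) ≤ (n : ℝ) ^ 3 := one_le_pow₀ hn'
      have hLm : L ≤ m := le_trans (by nlinarith) hmn
      -- Compare cubes: `μ³ = L / m` and `m ≥ n³ L`.
      have hμn : n * μ ≤ 1 := by
        refine le_of_pow_le_pow_left₀ three_ne_zero zero_le_one ?_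
        rw [mul_pow, hμ3, ← mul_div_assoc, one_pow]
        exact (div_le_one hm').2 hmn
      refine regretGuarantee_of_sampleMean hl hβ0 hR32 hx hn hm hδ hμ0 hμm hP
        fun A b θ hrun p hp0 hp1 hp ω hω u hu => ?_
      have h := regret_le_of_sampleMean_ge_of_small hrun hK hB hR hx hlam hβ hm hε
        (by rw [hRε]; exact natCast_mul_exp_neg_le hn hδ hδ1 hLm) hn hμ0 hμn hp0 hp hω hu
      nlinarith

end Guarantee

/-! ### Compiling expressions and array assignments -/

/-- Real expressions over the memory; `sum v n e` is the sum of `e` for the values of the variable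
`v` below the value of the variable `n`. -/
inductive Expr : Type
  | cell (a : ℕ) (idx : List Index)
  | const (q : ℚ)
  | index (e : Index)
  | un (f : UnOp) (e : Expr)
  | bin (f : BinOp) (e₁ e₂ : Expr)
  | sum (v n : ℕ) (e : Expr)

namespace Expr

noncomputable def eval : Expr → (ℕ → ℕ) → Memory → ℝ
  | cell a idx, env, M => M a (idx.map (Index.eval env))
  | const q, _, _ => q
  | index e, env, _ => e.eval env
  | un f e, env, M => f.eval (e.eval env M)
  | bin f e₁ e₂, env, M => f.eval (e₁.eval env M) (e₂.eval env M)
  | sum v n e, env, M => ∑ i ∈ Finset.range (env n), e.eval (Function.update env v i) M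

/-- All arrays read by the expression satisfy `p`. -/
def reads (p : ℕ → Bool) : Expr → Bool
  | cell a _ => p a
  | const _ => true
  | index _ => true
  | un _ e => e.reads p
  | bin _ e₁ e₂ => e₁.reads p && e₂.reads p
  | sum _ _ e => e.reads p

theorem eval_congr {p : ℕ → Bool} {M M' : Memory} (h : ∀ a, p a → M a = M' a) :
    ∀ (e : Expr) (env : ℕ → ℕ), e.reads p → e.eval env M = e.eval env M' := by
  intro e
  induction e with
  | cell a idx => intro env he; simp only [eval, h a he]
  | const q => intro _ _; rfl
  | index e => intro _ _; rfl
  | un f e ih => intro env he; simp only [eval, ih env he]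
  | bin f e₁ e₂ ih₁ ih₂ =>
    intro env he
    simp only [reads, Bool.and_eq_true] at he
    simp only [eval, ih₁ env he.1, ih₂ env he.2]
  | sum v n e ih =>
    intro env he
    simp only [eval]
    exact Finset.sum_congr rfl fun i _ => ih _ he

instance : Add Expr := ⟨bin .add⟩
instance : Sub Expr := ⟨bin .sub⟩
instance : Mul Expr := ⟨bin .mul⟩
instance : Div Expr := ⟨bin .div⟩

theorem eval_add (e₁ e₂ : Expr) (env : ℕ → ℕ) (M : Memory) :
    (e₁ + e₂).eval env M = e₁.eval env M + e₂.eval env M := rfl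
theorem eval_sub (e₁ e₂ : Expr) (env : ℕ → ℕ) (M : Memory) :
    (e₁ - e₂).eval env M = e₁.eval env M - e₂.eval env M := rfl
theorem eval_mul (e₁ e₂ : Expr) (env : ℕ → ℕ) (M : Memory) :
    (e₁ * e₂).eval env M = e₁.eval env M * e₂.eval env M := rfl
theorem eval_div (e₁ e₂ : Expr) (env : ℕ → ℕ) (M : Memory) :
    (e₁ / e₂).eval env M = e₁.eval env M / e₂.eval env M := rfl

/-- A program that stores the value of the expression in the cell `[]` of the array `T` and changes
no array below `T`. -/
def compile : ℕ → Expr → Cmd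
  -- The machine has no copy instruction; a cell is copied by adding zero.
  | T, cell a idx => .seq (.rat ⟨T, []⟩ 0) (.binary .add ⟨T, []⟩ ⟨a, idx⟩ ⟨T, []⟩)
  | T, const q => .rat ⟨T, []⟩ q
  | T, index e => .ofIndex ⟨T, []⟩ e
  | T, un f e => .seq (e.compile T) (.unary f ⟨T, []⟩ ⟨T, []⟩)
  | T, bin f e₁ e₂ => .seq (e₁.compile T)
      (.seq (e₂.compile (T + 1)) (.binary f ⟨T, []⟩ ⟨T, []⟩ ⟨T + 1, []⟩))
  | T, sum v n e => .seq (.rat ⟨T, []⟩ 0) (.forLoop v (.var n)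
      (.seq (e.compile (T + 1)) (.binary .add ⟨T, []⟩ ⟨T, []⟩ ⟨T + 1, []⟩)))

end Expr

theorem write_of_ne {env : ℕ → ℕ} {M : Memory} {c : Cell} {r : ℝ} {a : ℕ} (h : a ≠ c.array) :
    c.write env M r a = M a := by
  simp [Cell.write, h]

theorem write_scalar (env : ℕ → ℕ) (M : Memory) (T : ℕ) (r : ℝ) :
    (⟨T, []⟩ : Cell).write env M r T [] = r := by
  simp [Cell.write]

theorem read_scalar (env : ℕ → ℕ) (M : Memory) (T : ℕ) :
    (⟨T, []⟩ : Cell).read env M = M T [] := rfl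

theorem foldl_range_succ {α : Type*} (f : α → ℕ → α) (s : α) (k : ℕ) :
    (List.range (k + 1)).foldl f s = f ((List.range k).foldl f s) k := by
  simp [List.range_succ]

/-- Inputs lie below `N ≤ T`, and a subexpression evaluated while `T` is occupied is compiled at `T
+ 1`. Hence neither inputs nor pending partial results are overwritten. -/
theorem Expr.compile_spec {N : ℕ} :
    ∀ (e : Expr) (T : ℕ) (env : ℕ → ℕ) (M : Memory), N ≤ T → e.reads (fun a => decide (a < N)) →
      (∀ a < T, (e.compile T).exec env M a = M a) ∧
        (e.compile T).exec env M T [] = e.eval env M := by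
  intro e
  induction e with
  | cell a idx =>
    intro T env M hT he
    have ha : a < N := by simpa [reads] using he
    have hne : a ≠ T := by omega
    refine ⟨fun b hb => ?_, ?_⟩
    · simp only [compile, Cmd.exec]
      rw [write_of_ne (by simp; omega), write_of_ne (by simp; omega)]
    · simp only [compile, Cmd.exec, write_scalar, BinOp.eval, Cell.read]
      rw [write_of_ne (by simpa using hne)]
      simp [eval, write_scalar]
  | const q =>
    intro T env M hT he
    refine ⟨fun b hb => ?_, ?_⟩
    · simp only [compile, Cmd.exec]; rw [write_of_ne (by simp; omega)]
    · simp only [compile, Cmd.exec, write_scalar, eval]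
  | index e =>
    intro T env M hT he
    refine ⟨fun b hb => ?_, ?_⟩
    · simp only [compile, Cmd.exec]; rw [write_of_ne (by simp; omega)]
    · simp only [compile, Cmd.exec, write_scalar, eval]
  | un f e ih =>
    intro T env M hT he
    obtain ⟨h1, h2⟩ := ih T env M hT he
    refine ⟨fun b hb => ?_, ?_⟩
    · simp only [compile, Cmd.exec]; rw [write_of_ne (by simp; omega), h1 b hb]
    · simp only [compile, Cmd.exec, write_scalar, read_scalar, h2, eval]
  | bin f e₁ e₂ ih₁ ih₂ =>
    intro T env M hT he
    simp only [reads, Bool.and_eq_true] at he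
    obtain ⟨h1, h2⟩ := ih₁ T env M hT he.1
    obtain ⟨h3, h4⟩ := ih₂ (T + 1) env ((e₁.compile T).exec env M) (by omega) he.2
    refine ⟨fun b hb => ?_, ?_⟩
    · simp only [compile, Cmd.exec]
      rw [write_of_ne (by simp; omega), h3 b (by omega), h1 b hb]
    · simp only [compile, Cmd.exec, write_scalar, read_scalar, h4, eval]
      rw [h3 T (by omega), h2, eval_congr (fun a ha => h1 a
        (lt_of_lt_of_le (by simpa using ha) hT)) e₂ env he.2]
  | sum v n e ih =>
    intro T env M hT he
    have key : ∀ k, let M' := (List.range k).foldl (fun M' i =>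
        (Cmd.seq (e.compile (T + 1)) (.binary .add ⟨T, []⟩ ⟨T, []⟩ ⟨T + 1, []⟩)).exec
          (Function.update env v i) M') ((⟨T, []⟩ : Cell).write env M ((0 : ℚ) : ℝ))
        (∀ a < T, M' a = M a) ∧
          M' T [] = ∑ i ∈ Finset.range k, e.eval (Function.update env v i) M := by
      intro k
      induction k with
      | zero =>
        refine ⟨fun b hb => ?_, ?_⟩
        · simp only [List.range_zero, List.foldl_nil]; rw [write_of_ne (by simp; omega)]
        · simp only [List.range_zero, List.foldl_nil, write_scalar]; simp
      | succ k ihk =>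
        simp only [foldl_range_succ] at ihk ⊢
        set M' := (List.range k).foldl (fun M' i =>
          (Cmd.seq (e.compile (T + 1)) (.binary .add ⟨T, []⟩ ⟨T, []⟩ ⟨T + 1, []⟩)).exec
            (Function.update env v i) M') ((⟨T, []⟩ : Cell).write env M ((0 : ℚ) : ℝ))
        obtain ⟨h1, h2⟩ := ihk
        obtain ⟨h3, h4⟩ := ih (T + 1) (Function.update env v k) M' (by omega) he
        refine ⟨fun b hb => ?_, ?_⟩
        · simp only [Cmd.exec]
          rw [write_of_ne (by simp; omega), h3 b (by omega), h1 b hb]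
        · simp only [Cmd.exec, write_scalar, read_scalar, h4]
          rw [h3 T (by omega), h2, Finset.sum_range_succ, BinOp.eval,
            eval_congr (fun a ha => h1 a (lt_of_lt_of_le (by simpa using ha) hT)) e _ he]
    obtain ⟨h1, h2⟩ := key (env n)
    exact ⟨h1, h2⟩

/-- `a[idx] := e`, with the arrays from `100` on as scratch space. -/
def assign (a : ℕ) (idx : List Index) (e : Expr) : Cmd :=
  .seq (e.compile 100) (.seq (.rat ⟨101, []⟩ 0) (.binary .add ⟨a, idx⟩ ⟨100, []⟩ ⟨101, []⟩))

/-- Nested loops; `(v, n)` stands for the loop of the variable `v` up to the variable `n`. -/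
def loops : List (ℕ × ℕ) → Cmd → Cmd
  | [], c => c
  | (v, n) :: vs, c => .forLoop v (.var n) (loops vs c)

/-- The array assignment `a[vs] := e`. -/
def fill (vs : List (ℕ × ℕ)) (a : ℕ) (e : Expr) : Cmd :=
  loops vs (assign a (vs.map fun v => .var v.1) e)

/-- The environment with the loop variables `vs` set to `l`. -/
def setVars : (ℕ → ℕ) → List (ℕ × ℕ) → List ℕ → ℕ → ℕ
  | env, (v, _) :: vs, i :: l => setVars (Function.update env v i) vs l
  | env, _, _ => env

/-- `l` is a multi-index in the range of the loops `vs`. -/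
def InRange : (ℕ → ℕ) → List (ℕ × ℕ) → List ℕ → Prop
  | _, [], [] => True
  | env, (v, n) :: vs, i :: l => i < env n ∧ InRange (Function.update env v i) vs l
  | _, _, _ => False

theorem setVars_of_notMem {v : ℕ} : ∀ (vs : List (ℕ × ℕ)) (env : ℕ → ℕ) (l : List ℕ),
    v ∉ vs.map Prod.fst → setVars env vs l v = env v := by
  intro vs
  induction vs with
  | nil => intro env l _; simp [setVars]
  | cons w vs ih =>
    intro env l h
    cases l with
    | nil => simp [setVars]
    | cons i l =>
      simp only [List.map_cons, List.mem_cons, not_or] at h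
      rw [setVars, ih _ _ h.2, Function.update_of_ne h.1]

theorem map_eval_setVars : ∀ (vs : List (ℕ × ℕ)) (env : ℕ → ℕ) (l : List ℕ),
    (vs.map Prod.fst).Nodup → InRange env vs l →
      (vs.map fun v => Index.var v.1).map (Index.eval (setVars env vs l)) = l := by
  intro vs
  induction vs with
  | nil => intro env l _ h; cases l with
    | nil => rfl
    | cons i l => exact h.elim
  | cons w vs ih =>
    intro env l hn h
    cases l with
    | nil => exact h.elim
    | cons i l =>
      rw [List.map_cons, List.nodup_cons] at hn
      have h1 := ih (Function.update env w.1 i) l hn.2 h.2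
      simp only [List.map_cons, setVars, h1, Index.eval]
      rw [setVars_of_notMem vs _ _ hn.1]
      simp

/-- Since `e` does not read `a`, every iteration sees the original contents `M₀` of the other arrays
below 100. The induction tracks each cell of `a` as either hit, holding `val`, or untouched. As
`val` depends on the cell alone, a cell hit by several iterations causes no conflict. -/
theorem loops_assign_spec {a : ℕ} {idx : List Index} {e : Expr} (ha : a < 100)
    (he : e.reads (fun b => decide (b < 100) && b != a)) {M₀ : Memory} {val : List ℕ → ℝ} :
    ∀ (vs : List (ℕ × ℕ)) (env : ℕ → ℕ) (M : Memory), (∀ b < 100, b ≠ a → M b = M₀ b) →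
      (∀ l, InRange env vs l → val (idx.map (Index.eval (setVars env vs l))) =
        e.eval (setVars env vs l) M₀) →
      (∀ b < 100, b ≠ a → (loops vs (assign a idx e)).exec env M b = M₀ b) ∧
      ∀ l', ((∃ l, InRange env vs l ∧ idx.map (Index.eval (setVars env vs l)) = l') ∧
          (loops vs (assign a idx e)).exec env M a l' = val l') ∨
        ((¬∃ l, InRange env vs l ∧ idx.map (Index.eval (setVars env vs l)) = l') ∧
          (loops vs (assign a idx e)).exec env M a l' = M a l') := by
  intro vs
  have he' : e.reads (fun b => decide (b < 100)) := by
    have aux : ∀ e : Expr, e.reads (fun b => decide (b < 100) && b != a) →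
        e.reads (fun b => decide (b < 100)) := by
      intro e
      induction e with
      | cell b idx => intro h; simp only [Expr.reads, Bool.and_eq_true] at *; exact h.1
      | const q => intro h; rfl
      | index e => intro h; rfl
      | un f e ih => intro h; exact ih h
      | bin f e₁ e₂ ih₁ ih₂ =>
        intro h; simp only [Expr.reads, Bool.and_eq_true] at *; exact ⟨ih₁ h.1, ih₂ h.2⟩
      | sum v n e ih => intro h; exact ih h
    exact aux e he
  induction vs with
  | nil =>
    intro env M hM hval
    obtain ⟨h1, h2⟩ := Expr.compile_spec e 100 env M le_rfl he'
    have hexec : ∀ b < 100, (loops [] (assign a idx e)).exec env M b =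
        if b = a then Function.update (M a) (idx.map (Index.eval env)) (e.eval env M₀)
          else M b := by
      intro b hb
      have hval' : e.eval env M = e.eval env M₀ := by
        refine Expr.eval_congr (fun c hc => ?_) e env he
        simp only [Bool.and_eq_true, decide_eq_true_eq, bne_iff_ne] at hc
        exact hM c hc.1 hc.2
      have h100 : ∀ r, (⟨101, []⟩ : Cell).write env ((e.compile 100).exec env M) r 100 [] =
          e.eval env M₀ := fun r => by rw [write_of_ne (by simp), h2, hval']
      simp only [loops, assign, Cmd.exec, read_scalar, write_scalar, BinOp.eval, h100]
      by_cases hba : b = a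
      · subst hba
        simp only [Cell.write, Function.update_self, if_true]
        rw [Function.update_of_ne (by omega), h1 b hb]
        simp
      · rw [write_of_ne (by simpa using hba), write_of_ne (by simp; omega), h1 b hb, if_neg hba]
    refine ⟨fun b hb hba => ?_, fun l' => ?_⟩
    · rw [hexec b hb, if_neg hba, hM b hb hba]
    · rw [hexec a ha, if_pos rfl]
      by_cases hl : idx.map (Index.eval env) = l'
      · refine Or.inl ⟨⟨[], trivial, hl⟩, ?_⟩
        rw [← hl, Function.update_self, show e.eval env M₀ = _ from (hval [] trivial).symm]
        rfl
      · refine Or.inr ⟨?_, Function.update_of_ne (Ne.symm hl) _ _⟩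
        rintro ⟨l, h3, h4⟩
        cases l with
        | nil => exact hl h4
        | cons i l => exact h3.elim
  | cons w vs ih =>
    obtain ⟨v, n⟩ := w
    intro env M hM hval
    have key : ∀ k ≤ env n, let M' := (List.range k).foldl (fun M' i =>
        (loops vs (assign a idx e)).exec (Function.update env v i) M') M
        (∀ b < 100, b ≠ a → M' b = M₀ b) ∧
        ∀ l', ((∃ i < k, ∃ l, InRange (Function.update env v i) vs l ∧
            idx.map (Index.eval (setVars (Function.update env v i) vs l)) = l') ∧
              M' a l' = val l') ∨
          ((¬∃ i < k, ∃ l, InRange (Function.update env v i) vs l ∧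
            idx.map (Index.eval (setVars (Function.update env v i) vs l)) = l') ∧
              M' a l' = M a l') := by
      intro k
      induction k with
      | zero => intro _; exact ⟨hM, fun l' => Or.inr ⟨by simp, rfl⟩⟩
      | succ k ihk =>
        intro hk
        obtain ⟨h1, h2⟩ := ihk (by omega)
        simp only [foldl_range_succ]
        set M' := (List.range k).foldl (fun M' i =>
          (loops vs (assign a idx e)).exec (Function.update env v i) M') M
        obtain ⟨h3, h4⟩ := ih (Function.update env v k) M' h1
          (fun l hl => hval (k :: l) ⟨by omega, hl⟩)
        refine ⟨h3, fun l' => ?_⟩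
        rcases h4 l' with ⟨⟨l, h5, h6⟩, h7⟩ | ⟨h5, h7⟩
        · exact Or.inl ⟨⟨k, by omega, l, h5, h6⟩, h7⟩
        · rw [h7]
          rcases h2 l' with ⟨⟨i, hi, h8⟩, h9⟩ | ⟨h8, h9⟩
          · exact Or.inl ⟨⟨i, by omega, h8⟩, h9⟩
          · refine Or.inr ⟨?_, h9⟩
            rintro ⟨i, hi, h10⟩
            rcases Nat.lt_succ_iff_lt_or_eq.1 hi with h | h
            · exact h8 ⟨i, h, h10⟩
            · exact h5 (h ▸ h10)
    obtain ⟨h1, h2⟩ := key (env n) le_rfl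
    refine ⟨h1, fun l' => ?_⟩
    have hiff : (∃ l, InRange env ((v, n) :: vs) l ∧
        idx.map (Index.eval (setVars env ((v, n) :: vs) l)) = l') ↔
        ∃ i < env n, ∃ l, InRange (Function.update env v i) vs l ∧
          idx.map (Index.eval (setVars (Function.update env v i) vs l)) = l' := by
      constructor
      · rintro ⟨l, h3, h4⟩
        cases l with
        | nil => exact h3.elim
        | cons i l => exact ⟨i, h3.1, l, h3.2, h4⟩
      · rintro ⟨i, hi, l, h3, h4⟩
        exact ⟨i :: l, ⟨hi, h3⟩, h4⟩
    rw [hiff]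
    exact h2 l'

theorem fill_spec {vs : List (ℕ × ℕ)} {a : ℕ} {e : Expr} (ha : a < 100)
    (he : e.reads (fun b => decide (b < 100) && b != a)) (hvs : (vs.map Prod.fst).Nodup)
    (env : ℕ → ℕ) (M : Memory) :
    (∀ b < 100, b ≠ a → (fill vs a e).exec env M b = M b) ∧
      ∀ l, InRange env vs l → (fill vs a e).exec env M a l = e.eval (setVars env vs l) M := by
  obtain ⟨h1, h2⟩ := loops_assign_spec ha he (M₀ := M)
    (val := fun l => e.eval (setVars env vs l) M) vs env M (fun _ _ _ => rfl)
    (fun l hl => by rw [map_eval_setVars vs env l hvs hl])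
  refine ⟨h1, fun l hl => ?_⟩
  rcases h2 l with ⟨_, h4⟩ | ⟨h3, _⟩
  · exact h4
  · exact absurd ⟨l, hl, map_eval_setVars vs env l hvs hl⟩ h3

/-! ### Rank-one updates of the inverse -/

theorem Dominates.add_vecMulVec {ι : Type*} [Fintype ι] [DecidableEq ι] {lam c : ℝ}
    {A : Matrix ι ι ℝ} (hA : Dominates lam A) (hc : 0 ≤ c) (u : ι → ℝ) :
    Dominates lam (A + c • Matrix.vecMulVec u u) := by
  refine hA.add (by rw [Matrix.transpose_smul, Matrix.transpose_vecMulVec]) fun v => ?_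
  rw [Matrix.smul_mulVec, dotProduct_smul, smul_eq_mul, Matrix.vecMulVec_mulVec, dotProduct_smul]
  simp only [MulOpposite.smul_eq_mul_unop, MulOpposite.unop_op]
  rw [dotProduct_comm v u]
  exact mul_nonneg hc (mul_self_nonneg _)

/-- The Sherman-Morrison formula; positivity of `A⁻¹` keeps the denominator nonzero. -/
theorem Dominates.inv_add_vecMulVec {ι : Type*} [Fintype ι] [DecidableEq ι] {lam c : ℝ}
    (hl : 0 < lam) {A : Matrix ι ι ℝ} (hA : Dominates lam A) (hc : 0 ≤ c) (u : ι → ℝ) :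
    (A + c • Matrix.vecMulVec u u)⁻¹ = A⁻¹ -
      (c / (1 + c * (u ⬝ᵥ A⁻¹ *ᵥ u))) • Matrix.vecMulVec (A⁻¹ *ᵥ u) (A⁻¹ *ᵥ u) := by
  set w := A⁻¹ *ᵥ u with hw
  have h1 : 0 < 1 + c * (u ⬝ᵥ w) := by
    have := mul_nonneg hc (hA.dot_inv_nonneg hl u); linarith
  have h2 : A * Matrix.vecMulVec w w = Matrix.vecMulVec u w := by
    rw [Matrix.mul_vecMulVec, hA.mulVec_inv_mulVec hl]
  have h3 : Matrix.vecMulVec u u * A⁻¹ = Matrix.vecMulVec u w := by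
    rw [Matrix.vecMulVec_mul, ← Matrix.mulVec_transpose, hA.inv_symm]
  have h4 : Matrix.vecMulVec u u * Matrix.vecMulVec w w = (u ⬝ᵥ w) • Matrix.vecMulVec u w := by
    rw [Matrix.mul_vecMulVec, Matrix.vecMulVec_mulVec]
    ext i j
    simp [Matrix.vecMulVec_apply]; ring
  refine Matrix.inv_eq_right_inv ?_
  rw [mul_sub, add_mul, add_mul, hA.mul_inv hl, Matrix.smul_mul, h3, Matrix.mul_smul, h2,
    Matrix.mul_smul, Matrix.smul_mul, h4, smul_smul, smul_smul, add_sub_assoc, ← add_smul,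
    ← sub_smul]
  rw [show c - _ = 0 from by field_simp; ring, zero_smul, add_zero]

/-! ### The Hessian as a sum of rank-one terms -/

section Update

variable {K d : ℕ}

/-- `A` with the first `j` rank-one terms of `c` times the Hessian of the loss added. -/
noncomputable def hessPartial (A : Matrix (Fin K × Fin d) (Fin K × Fin d) ℝ) (c : ℝ)
    (p : Fin K → ℝ) (x : EuclideanSpace ℝ (Fin d)) (j : ℕ) :
    Matrix (Fin K × Fin d) (Fin K × Fin d) ℝ :=
  A + ∑ v ∈ Finset.range j, if h : v < K then
    (c * p ⟨v, h⟩) • Matrix.vecMulVec (feature x *ᵥ dev p ⟨v, h⟩) (feature x *ᵥ dev p ⟨v, h⟩) else 0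

theorem hessPartial_zero (A : Matrix (Fin K × Fin d) (Fin K × Fin d) ℝ) (c : ℝ)
    (p : Fin K → ℝ) (x : EuclideanSpace ℝ (Fin d)) : hessPartial A c p x 0 = A := by
  simp [hessPartial]

theorem hessPartial_succ (A : Matrix (Fin K × Fin d) (Fin K × Fin d) ℝ) (c : ℝ)
    (p : Fin K → ℝ) (x : EuclideanSpace ℝ (Fin d)) (v : Fin K) :
    hessPartial A c p x (v + 1) = hessPartial A c p x v +
      (c * p v) • Matrix.vecMulVec (feature x *ᵥ dev p v) (feature x *ᵥ dev p v) := by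
  simp [hessPartial, Finset.sum_range_succ, add_assoc]

/-- The covariance matrix of a random basis vector, `diag(p) - p pᵀ`, is the average of the rank-one
matrices of its deviations `e_v - p`. So `K` rank-one updates produce the whole Hessian step. -/
theorem hessPartial_last (A : Matrix (Fin K × Fin d) (Fin K × Fin d) ℝ) (c : ℝ)
    {p : Fin K → ℝ} (hp0 : ∀ k, 0 ≤ p k) (hp1 : ∑ k, p k = 1) (x : EuclideanSpace ℝ (Fin d)) :
    hessPartial A c p x K =
      A + c • (feature (K := K) x * softHess p * (feature (K := K) x)ᵀ) := by
  have h1 : softHess p = ∑ v, p v • Matrix.vecMulVec (dev p v) (dev p v) := by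
    rw [← one_smul ℝ (softHess p), ← devRoot_mul_transpose zero_le_one hp0 hp1]
    ext k l
    rw [Matrix.mul_apply, Matrix.sum_apply]
    refine Finset.sum_congr rfl fun v _ => ?_
    simp only [devRoot, Matrix.transpose_apply, Matrix.of_apply, Matrix.smul_apply,
      Matrix.vecMulVec_apply, smul_eq_mul, one_mul]
    have := Real.mul_self_sqrt (hp0 v)
    linear_combination (dev p v k * dev p v l) * this
  rw [hessPartial, Finset.sum_range, h1, Matrix.mul_sum, Matrix.sum_mul, Finset.smul_sum]
  congr 1
  refine Finset.sum_congr rfl fun v _ => ?_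
  rw [dif_pos v.2, Matrix.mul_smul, Matrix.smul_mul, smul_smul, Matrix.mul_vecMulVec,
    Matrix.vecMulVec_mul, Matrix.vecMul_transpose]

theorem Dominates.hessPartial {lam c : ℝ} {A : Matrix (Fin K × Fin d) (Fin K × Fin d) ℝ}
    (hA : Dominates lam A) (hc : 0 ≤ c) {p : Fin K → ℝ} (hp0 : ∀ k, 0 ≤ p k)
    (x : EuclideanSpace ℝ (Fin d)) : ∀ j ≤ K, Dominates lam (hessPartial A c p x j) := by
  intro j
  induction j with
  | zero => intro _; rwa [hessPartial_zero]
  | succ j ih =>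
    intro hj
    rw [hessPartial_succ A c p x ⟨j, hj⟩]
    exact (ih (by omega)).add_vecMulVec (mul_nonneg hc (hp0 _)) _

end Update

/-! ### Factorization of a positive semidefinite matrix by Schur complements -/

section Cholesky

variable {K : ℕ}

/-- The column `W e_v / √W_vv`. -/
noncomputable def pivotCol (W : Matrix (Fin K) (Fin K) ℝ) (v k : Fin K) : ℝ :=
  W k v / Real.sqrt (W v v)

noncomputable def schur (W : Matrix (Fin K) (Fin K) ℝ) (v : Fin K) : Matrix (Fin K) (Fin K) ℝ :=
  Matrix.of fun k l => W k l - pivotCol W v k * pivotCol W v l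

/-- The Schur complement with respect to the first `j` indices. -/
noncomputable def schurIter (W : Matrix (Fin K) (Fin K) ℝ) : ℕ → Matrix (Fin K) (Fin K) ℝ
  | 0 => W
  | j + 1 => if h : j < K then schur (schurIter W j) ⟨j, h⟩ else schurIter W j

theorem schurIter_succ (W : Matrix (Fin K) (Fin K) ℝ) (v : Fin K) :
    schurIter W (v + 1) = schur (schurIter W v) v := by
  simp [schurIter]

/-- A vanishing pivot yields a zero column, because division by zero is zero; a singular covariance
thus needs no branching. -/
noncomputable def schurFactor (W : Matrix (Fin K) (Fin K) ℝ) : Matrix (Fin K) (Fin K) ℝ :=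
  Matrix.of fun k v => pivotCol (schurIter W v) v k

/-- Cauchy-Schwarz for a positive semidefinite matrix and a coordinate vector. -/
theorem sq_mulVec_le {W : Matrix (Fin K) (Fin K) ℝ} (hs : Wᵀ = W)
    (hW : ∀ u : Fin K → ℝ, 0 ≤ u ⬝ᵥ W *ᵥ u) (u : Fin K → ℝ) (v : Fin K) :
    (W *ᵥ u) v ^ 2 ≤ W v v * (u ⬝ᵥ W *ᵥ u) := by
  have key : ∀ s t : ℝ, 0 ≤ s ^ 2 * (u ⬝ᵥ W *ᵥ u) + 2 * (s * t) * (W *ᵥ u) v + t ^ 2 * W v v := by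
    intro s t
    have h1 := hW (s • u + t • Pi.single v 1)
    have h2 : u ⬝ᵥ W *ᵥ (Pi.single v 1) = (W *ᵥ u) v := by
      rw [dotProduct_mulVec_of_symm hs]; simp
    have h3 : (Pi.single v (1 : ℝ) : Fin K → ℝ) ⬝ᵥ W *ᵥ (Pi.single v 1) = W v v := by simp
    simp only [Matrix.mulVec_add, Matrix.mulVec_smul, dotProduct_add, add_dotProduct,
      smul_dotProduct, dotProduct_smul, smul_eq_mul, h2, h3, single_dotProduct, one_mul] at h1
    linarith
  have h0 : 0 ≤ W v v := by simpa using key 0 1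
  rcases h0.eq_or_lt with h | h
  -- With a zero diagonal entry these values turn `key` into `0 ≤ -2 (W u)_v²`.
  · have h1 := key ((W *ᵥ u) v) (-(1 / 2) * (u ⬝ᵥ W *ᵥ u) - 1)
    rw [← h] at h1 ⊢
    nlinarith [hW u, sq_nonneg ((W *ᵥ u) v)]
  · have h1 := key (W v v) (-(W *ᵥ u) v)
    nlinarith

/-- Positivity is the inequality `sq_mulVec_le`. If the pivot is zero the matrix is unchanged, and
the same inequality shows that its column `v` was already zero. -/
theorem schur_spec {W : Matrix (Fin K) (Fin K) ℝ} (hs : Wᵀ = W)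
    (hW : ∀ u : Fin K → ℝ, 0 ≤ u ⬝ᵥ W *ᵥ u) (v : Fin K) :
    (schur W v)ᵀ = schur W v ∧ (∀ u : Fin K → ℝ, 0 ≤ u ⬝ᵥ schur W v *ᵥ u) ∧
      (∀ k, schur W v k v = 0) := by
  have hsym : ∀ k l, W l k = W k l := fun k l => congrFun (congrFun hs k) l
  have h0 : 0 ≤ W v v := by simpa using hW (Pi.single v 1)
  refine ⟨?_, fun u => ?_, fun k => ?_⟩
  · ext k l
    simp only [schur, Matrix.transpose_apply, Matrix.of_apply, hsym k l]; ring
  · have h1 : schur W v *ᵥ u = W *ᵥ u - (pivotCol W v ⬝ᵥ u) • pivotCol W v := by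
      ext k
      simp only [schur, Matrix.mulVec, dotProduct, Matrix.of_apply, sub_mul,
        Finset.sum_sub_distrib, Pi.sub_apply, Pi.smul_apply, smul_eq_mul, Finset.sum_mul]
      congr 1
      exact Finset.sum_congr rfl fun _ _ => by ring
    have h2 : pivotCol W v ⬝ᵥ u = (W *ᵥ u) v / Real.sqrt (W v v) := by
      simp only [pivotCol, dotProduct, Matrix.mulVec, Finset.sum_div, hsym]
      exact Finset.sum_congr rfl fun _ _ => by rw [← hsym]; ring
    rw [h1, dotProduct_sub, dotProduct_smul, smul_eq_mul, dotProduct_comm u (pivotCol W v), h2,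
      ← sq, div_pow, Real.sq_sqrt h0]
    rcases h0.eq_or_lt with h | h
    · rw [← h]; simpa using hW u
    · rw [sub_nonneg, div_le_iff₀ h, mul_comm]; exact sq_mulVec_le hs hW u v
  · simp only [schur, Matrix.of_apply, pivotCol]
    rcases h0.eq_or_lt with h | h
    · have := sq_mulVec_le hs hW (Pi.single k 1) v
      rw [← h, zero_mul] at this
      have h3 : W k v = 0 := by
        rw [← hsym]; simpa using pow_eq_zero_iff (two_ne_zero) |>.1 (le_antisymm this (sq_nonneg _))
      simp [h3, ← h]
    · rw [div_mul_div_comm, Real.mul_self_sqrt h0]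
      field_simp; ring

/-- The invariant of the elimination: the remainder is positive semidefinite, its eliminated columns
vanish, and `W` is the remainder plus the rank-one terms extracted so far. Previously cleared
columns stay zero because, by symmetry, the pivot column has zeros at their indices. -/
theorem schurIter_spec {W : Matrix (Fin K) (Fin K) ℝ} (hs : Wᵀ = W)
    (hW : ∀ u : Fin K → ℝ, 0 ≤ u ⬝ᵥ W *ᵥ u) :
    ∀ j ≤ K, (schurIter W j)ᵀ = schurIter W j ∧ (∀ u : Fin K → ℝ, 0 ≤ u ⬝ᵥ schurIter W j *ᵥ u) ∧
      (∀ k l : Fin K, (l : ℕ) < j → schurIter W j k l = 0) ∧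
      ∀ k l, W k l = schurIter W j k l +
        ∑ v : Fin K, if (v : ℕ) < j then schurFactor W k v * schurFactor W l v else 0 := by
  intro j
  induction j with
  | zero => intro _; exact ⟨hs, hW, by simp, by simp [schurIter]⟩
  | succ j ih =>
    intro hj
    obtain ⟨h1, h2, h3, h4⟩ := ih (by omega)
    have hsucc := schurIter_succ W ⟨j, hj⟩
    simp only at hsucc
    rw [hsucc]
    obtain ⟨h5, h6, h7⟩ := schur_spec h1 h2 ⟨j, hj⟩
    refine ⟨h5, h6, fun k l hl => ?_, fun k l => ?_⟩
    · rcases Nat.lt_succ_iff_lt_or_eq.1 hl with h | h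
      · have h8 : schurIter W j ⟨j, hj⟩ l = 0 := h3 _ _ h
        have h9 : schurIter W j l ⟨j, hj⟩ = 0 := by
          rw [← h8]; exact congrFun (congrFun h1 ⟨j, hj⟩) l
        simp [schur, pivotCol, h3 k l h, h9]
      · have : l = ⟨j, hj⟩ := Fin.ext h
        rw [this]; exact h7 k
    · rw [h4 k l]
      have h8 : ∀ v : Fin K, (if (v : ℕ) < j + 1 then schurFactor W k v * schurFactor W l v else 0)
          = (if (v : ℕ) < j then schurFactor W k v * schurFactor W l v else 0) +
            (if v = ⟨j, hj⟩ then schurFactor W k v * schurFactor W l v else 0) := by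
        intro v
        simp only [Fin.ext_iff]
        rcases lt_trichotomy (v : ℕ) j with h | h | h
        · simp [h, h.ne, Nat.lt_succ_of_lt h]
        · simp [h]
        · have h9 : ¬ ((v : ℕ) < j + 1) := by omega
          simp [h9, h.not_gt, h.ne']
      simp only [h8, Finset.sum_add_distrib, Finset.sum_ite_eq', Finset.mem_univ, if_true]
      simp only [schur, schurFactor, Matrix.of_apply]
      ring

theorem schurFactor_mul_transpose {W : Matrix (Fin K) (Fin K) ℝ} (hs : Wᵀ = W)
    (hW : ∀ u : Fin K → ℝ, 0 ≤ u ⬝ᵥ W *ᵥ u) : schurFactor W * (schurFactor W)ᵀ = W := by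
  obtain ⟨_, _, h3, h4⟩ := schurIter_spec hs hW K le_rfl
  ext k l
  rw [h4 k l, h3 k l l.2, Matrix.mul_apply]
  simp

end Cholesky

/-! ### The approximate minimizer -/

section Iterate

variable {K d : ℕ}

/-- The iterates of the fixed-point map for the prediction of the minimizer. -/
noncomputable def predIter (A : Matrix (Fin K × Fin d) (Fin K × Fin d) ℝ) (b : Param K d)
    (x : EuclideanSpace ℝ (Fin d)) (y : Fin K) : ℕ → Fin K → ℝ
  | 0 => 0
  | i + 1 => linPred (argminStep A b x y (predIter A b x y i)) x

/-- The starting point `0` may be arbitrarily far from the limit, but two softmax vectors differ by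
at most 2 in `ℓ¹`. One step therefore brings the iterate within `1/32`, and contraction does the
rest. -/
theorem norm_predIter_sub_le [NeZero K] {lam : ℝ} (hl : 0 < lam)
    {A : Matrix (Fin K × Fin d) (Fin K × Fin d) ℝ} (hA : Dominates lam A) {b : Param K d}
    {x : EuclideanSpace ℝ (Fin d)} (hx : 32 * ‖x‖ ^ 2 ≤ lam) {y : Fin K} {θ : Param K d}
    (h : argminStep A b x y (linPred θ x) = θ) (i : ℕ) :
    ‖predIter A b x y (i + 1) - linPred θ x‖ ≤ (1 / 32) ^ (i + 1) := by
  induction i with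
  | zero =>
    have h1 := norm_linPred_argminStep_sub_le hl hA b hx y (linPred θ x) (predIter A b x y 0)
    have h2 := sum_abs_softmax_sub_le_two (linPred θ x) (predIter A b x y 0)
    rw [h] at h1
    simp only [predIter] at h1 h2 ⊢
    linarith
  | succ i ih =>
    have h1 := norm_linPred_argminStep_sub_le hl hA b hx y (linPred θ x) (predIter A b x y (i + 1))
    have h2 := sum_abs_softmax_sub_le (linPred θ x) (predIter A b x y (i + 1))
    rw [h] at h1
    rw [predIter, pow_succ]
    linarith

/-- The parameter is formed from the last prediction by one more step with Lipschitz constant at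
most `1 / R`, and `1/32 ≤ 1/e`. -/
theorem norm_argminStep_predIter_sub_le [NeZero K] {lam : ℝ} (hl : 0 < lam)
    {A : Matrix (Fin K × Fin d) (Fin K × Fin d) ℝ} (hA : Dominates lam A) {b : Param K d}
    {x : EuclideanSpace ℝ (Fin d)} {R : ℝ} (hR : 0 < R) (hx : ‖x‖ ≤ R) (hRl : 32 * R ^ 2 ≤ lam)
    {y : Fin K} {θ : Param K d} (h : argminStep A b x y (linPred θ x) = θ) {m : ℕ} (hm : 1 ≤ m) :
    ‖argminStep A b x y (predIter A b x y m) - θ‖ ≤ Real.exp (-m) / R := by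
  obtain ⟨i, rfl⟩ := Nat.exists_eq_add_of_le' hm
  have hx2 : 32 * ‖x‖ ^ 2 ≤ lam := by
    have := pow_le_pow_left₀ (norm_nonneg _) hx 2
    linarith
  have h1 := norm_argminStep_sub_le hl hA b x y (linPred θ x) (predIter A b x y (i + 1))
  have h2 := sum_abs_softmax_sub_le (linPred θ x) (predIter A b x y (i + 1))
  have h3 := norm_predIter_sub_le hl hA hx2 h i
  rw [h] at h1
  have h4 : ((1 : ℝ) / 32) ^ (i + 1) ≤ Real.exp (-((i + 1 : ℕ) : ℝ)) := by
    rw [show -((i + 1 : ℕ) : ℝ) = ((i + 1 : ℕ) : ℝ) * (-1) by ring, Real.exp_nat_mul]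
    refine pow_le_pow_left₀ (by norm_num) ?_ _
    rw [Real.exp_neg, one_div]
    exact inv_anti₀ (Real.exp_pos 1) (Real.exp_one_lt_d9.le.trans (by norm_num))
  have h5 : ‖x‖ / lam ≤ 1 / R := by
    rw [div_le_div_iff₀ hl hR]
    nlinarith [mul_le_mul_of_nonneg_right hx hR.le, sq_nonneg R]
  have h6 : (∑ k, |softmax (predIter A b x y (i + 1)) k - softmax (linPred θ x) k|) / 2 ≤
      Real.exp (-((i + 1 : ℕ) : ℝ)) := by linarith
  calc _ ≤ _ := h1
    _ ≤ 1 / R * Real.exp (-((i + 1 : ℕ) : ℝ)) :=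
      mul_le_mul h5 h6 (by positivity) (by positivity)
    _ = _ := by ring

end Iterate

/-! ### The program

Variable `5` counts the sequential loops, the variables `6, …, 9` run over the entries of arrays, and
`10, 11` are summation variables. Between the rounds the arrays `10, 11, 12` hold `A_t⁻¹, b_t` and the
current estimator. -/

namespace Expr

/-- The cell of the array `a` addressed by the variables `vs`. -/
def entry (a : ℕ) (vs : List ℕ) : Expr := .cell a (vs.map .var)

theorem eval_entry (a : ℕ) (vs : List ℕ) (env : ℕ → ℕ) (M : Memory) :
    (entry a vs).eval env M = M a (vs.map env) := by
  simp only [entry, eval, List.map_map]; rfl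

/-- The indicator of the equality of two variables. -/
def eqInd (u v : ℕ) : Expr :=
  -- Subtraction is truncated, so the inner sum is `|u - v|` and `1 - |u - v|` is the indicator.
  .index (.sub (.const 1) (.add (.sub (.var u) (.var v)) (.sub (.var v) (.var u))))

theorem eval_eqInd (u v : ℕ) (env : ℕ → ℕ) (M : Memory) :
    (eqInd u v).eval env M = if env u = env v then 1 else 0 := by
  simp only [eqInd, eval, Index.eval]
  split_ifs with h
  · simp [h]
  · have : 1 - (env u - env v + (env v - env u)) = 0 := by omega
    simp [this]

/-- The parameter in cell `c` of array `0`. -/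
def param (c : ℕ) : Expr := .cell 0 [.const c]

theorem eval_param (c : ℕ) (env : ℕ → ℕ) (M : Memory) : (param c).eval env M = M 0 [c] := rfl

end Expr

open EfficientGAF.Expr

def initInv : Cmd := fill [(6, 1), (7, 2), (8, 1), (9, 2)] 10 (eqInd 6 8 * eqInd 7 9 / param 0)

/-- Arrays of the prediction phase: `13` holds `A⁻¹ Φ(x)`, `14` the covariance, `15` the mean, `16`
the current Schur complement, `17` the pivot column, `19` the partial samples and `21` their softmax
normalizers. Arrays `18` and `20` are buffers, because a `fill` may not read the array it writes. -/
def invFeature : Cmd :=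
  fill [(6, 1), (7, 2), (8, 1)] 13 (.sum 10 2 (entry 10 [6, 7, 8, 10] * entry 1 [10]))
def covariance : Cmd := fill [(6, 1), (7, 1)] 14 (.sum 10 2 (entry 1 [10] * entry 13 [6, 10, 7]))
def mean : Cmd := fill [(6, 1)] 15 (.sum 10 2 (entry 1 [10] * entry 12 [6, 10]))
def copyCov : Cmd := fill [(6, 1), (7, 1)] 16 (entry 14 [6, 7])
def initSample : Cmd := fill [(6, 3), (7, 1)] 19 (entry 15 [7])
def pivot : Cmd := fill [(6, 1)] 17 (entry 16 [6, 5] / .un .sqrt (entry 16 [5, 5]))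
def schurNew : Cmd := fill [(6, 1), (7, 1)] 18 (entry 16 [6, 7] - entry 17 [6] * entry 17 [7])
def schurCopy : Cmd := fill [(6, 1), (7, 1)] 16 (entry 18 [6, 7])
def sampleNew : Cmd := fill [(6, 3), (7, 1)] 20 (entry 19 [6, 7] + entry 17 [7] * entry 2 [6, 5])
def sampleCopy : Cmd := fill [(6, 3), (7, 1)] 19 (entry 20 [6, 7])
def sampleBody : Cmd :=
  .seq pivot (.seq schurNew (.seq schurCopy (.seq sampleNew sampleCopy)))
def sampleLoop : Cmd := .forLoop 5 (.var 1) sampleBody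
def expSum : Cmd := fill [(6, 3)] 21 (.sum 10 1 (.un .exp (entry 19 [6, 10])))
def output : Cmd := fill [(6, 1)] 3 (.un .log ((.const 1 - param 2) *
  (.const 1 / .index (.var 3) * .sum 10 3 (.un .exp (entry 19 [10, 6]) / entry 21 [10])) +
    param 2 / .index (.var 1)))

/-- Arrays of the update: `22` holds `b - Φ(x) e_y`, `23` its image under `A⁻¹`, `24` the prediction
of that image, `25` the current prediction and `26` its softmax. Everything independent of the
iterate is computed before the loop, so an iteration only multiplies by the covariance in `14`. -/
def linGrad : Cmd := fill [(6, 1), (7, 2)] 22 (entry 11 [6, 7] - eqInd 6 4 * entry 1 [7])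
def invGrad : Cmd := fill [(6, 1), (7, 2)] 23
  (.sum 10 1 (.sum 11 2 (entry 10 [6, 7, 10, 11] * entry 22 [10, 11])))
def predGrad : Cmd := fill [(6, 1)] 24 (.sum 10 2 (entry 1 [10] * entry 23 [6, 10]))
def initIter : Cmd := fill [(6, 1)] 25 (.const 0)
def softIter : Cmd :=
  fill [(6, 1)] 26 (.un .exp (entry 25 [6]) / .sum 10 1 (.un .exp (entry 25 [10])))
def stepIter : Cmd := fill [(6, 1)] 25
  (.const (-1 / 2) * (entry 24 [6] + .sum 10 1 (entry 14 [6, 10] * entry 26 [10])))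
def iterLoop : Cmd := .forLoop 5 (.var 3) (.seq softIter stepIter)
def estimator : Cmd := fill [(6, 1), (7, 2)] 12
  (.const (-1 / 2) * (entry 23 [6, 7] + .sum 10 1 (entry 13 [6, 7, 10] * entry 26 [10])))
def predEst : Cmd := fill [(6, 1)] 25 (.sum 10 2 (entry 1 [10] * entry 12 [6, 10]))
def linNew : Cmd := fill [(6, 1), (7, 2)] 11 (entry 22 [6, 7] + entry 1 [7] * (entry 26 [6] -
  param 1 * (entry 26 [6] * (entry 25 [6] - .sum 10 1 (entry 26 [10] * entry 25 [10])))))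
-- Arrays of the rank-one updates: `27` holds `u = Φ(x)(e_v - p)`, `28` holds `A⁻¹ u`, `29` the
-- Sherman-Morrison coefficient, and `30` buffers the new inverse.
def devFeature : Cmd := fill [(6, 1), (7, 2)] 27 ((eqInd 6 5 - entry 26 [6]) * entry 1 [7])
def invDev : Cmd := fill [(6, 1), (7, 2)] 28
  (.sum 10 1 (.sum 11 2 (entry 10 [6, 7, 10, 11] * entry 27 [10, 11])))
def rankCoef : Cmd := fill [] 29 (param 1 / .const 2 * entry 26 [5] / (.const 1 +
  param 1 / .const 2 * entry 26 [5] * .sum 10 1 (.sum 11 2 (entry 27 [10, 11] * entry 28 [10, 11]))))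
def rankNew : Cmd := fill [(6, 1), (7, 2), (8, 1), (9, 2)] 30
  (entry 10 [6, 7, 8, 9] - entry 29 [] * (entry 28 [6, 7] * entry 28 [8, 9]))
def rankCopy : Cmd := fill [(6, 1), (7, 2), (8, 1), (9, 2)] 10 (entry 30 [6, 7, 8, 9])
def rankBody : Cmd := .seq devFeature (.seq invDev (.seq rankCoef (.seq rankNew rankCopy)))
def rankLoop : Cmd := .forLoop 5 (.var 1) rankBody

def gafPredict : Cmd := .seq invFeature (.seq covariance (.seq mean (.seq copyCov (.seq initSample
  (.seq sampleLoop (.seq expSum output))))))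

def gafUpdate : Cmd := .seq linGrad (.seq invGrad (.seq predGrad (.seq initIter (.seq iterLoop
  (.seq softIter (.seq estimator (.seq predEst (.seq softIter (.seq linNew rankLoop)))))))))

def gafLearner : Learner := ⟨initInv, gafPredict, gafUpdate⟩

/-! ### Reasoning about programs -/

/-- The program contains an instruction that writes to the array. -/
def Cmd.writes : Cmd → ℕ → Bool
  | .skip, _ => false
  | .rat dst _, a => dst.array == a
  | .ofIndex dst _, a => dst.array == a
  | .unary _ dst _, a => dst.array == a
  | .binary _ dst _ _, a => dst.array == a
  | .seq c₁ c₂, a => c₁.writes a || c₂.writes a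
  | .forLoop _ _ c, a => c.writes a

theorem Cmd.exec_seq (c₁ c₂ : Cmd) (env : ℕ → ℕ) (M : Memory) :
    (Cmd.seq c₁ c₂).exec env M = c₂.exec env (c₁.exec env M) := by rw [Cmd.exec]

theorem Cmd.exec_frame {a : ℕ} : ∀ (c : Cmd) (env : ℕ → ℕ) (M : Memory), c.writes a = false →
    c.exec env M a = M a := by
  have hw : ∀ (dst : Cell) (env : ℕ → ℕ) (M : Memory) (r : ℝ), (dst.array == a) = false →
      dst.write env M r a = M a := fun dst env M r h =>
    write_of_ne fun h' => by simp [h'] at h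
  intro c
  induction c with
  | skip => intros; rfl
  | rat dst q => intro env M h; exact hw dst env M _ h
  | ofIndex dst e => intro env M h; exact hw dst env M _ h
  | unary f dst src => intro env M h; exact hw dst env M _ h
  | binary f dst s₁ s₂ => intro env M h; exact hw dst env M _ h
  | seq c₁ c₂ ih₁ ih₂ =>
    intro env M h
    simp only [Cmd.writes, Bool.or_eq_false_iff] at h
    rw [Cmd.exec, ih₂ _ _ h.2, ih₁ _ _ h.1]
  | forLoop v e c ih =>
    intro env M h
    rw [Cmd.exec]
    generalize e.eval env = k
    induction k with
    | zero => rfl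
    | succ k ihk => rw [foldl_range_succ, ih _ _ h, ihk]

theorem Cmd.forLoop_induction {v n : ℕ} {c : Cmd} {env : ℕ → ℕ} {M : Memory}
    {Inv : ℕ → Memory → Prop} (h0 : Inv 0 M)
    (hs : ∀ i < env n, ∀ M', Inv i M' → Inv (i + 1) (c.exec (Function.update env v i) M')) :
    Inv (env n) ((Cmd.forLoop v (.var n) c).exec env M) := by
  have : ∀ k ≤ env n, Inv k ((List.range k).foldl
      (fun M' i => c.exec (Function.update env v i) M') M) := by
    intro k
    induction k with
    | zero => intro _; exact h0
    | succ k ih => intro hk; rw [foldl_range_succ]; exact hs k hk _ (ih (by omega))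
  exact this _ le_rfl

section Fill

variable {a n₁ n₂ n₃ n₄ p q r s : ℕ} {e : Expr} {env : ℕ → ℕ}

theorem fill₀ (M : Memory) (ha : a < 100) (he : e.reads (fun b => decide (b < 100) && b != a)) :
    (fill [] a e).exec env M a [] = e.eval env M :=
  (fill_spec ha he (by simp) env M).2 [] trivial

theorem fill₁ (M : Memory) (ha : a < 100) (he : e.reads (fun b => decide (b < 100) && b != a))
    (h₁ : env n₁ = p) (i : Fin p) :
    (fill [(6, n₁)] a e).exec env M a [(i : ℕ)] = e.eval (Function.update env 6 i) M :=
  (fill_spec ha he (by simp) env M).2 [(i : ℕ)] ⟨by rw [h₁]; exact i.2, trivial⟩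

theorem fill₂ (M : Memory) (ha : a < 100) (he : e.reads (fun b => decide (b < 100) && b != a))
    (h₁ : env n₁ = p) (h₂ : env n₂ = q) (hn₂ : n₂ < 6) (i : Fin p) (j : Fin q) :
    (fill [(6, n₁), (7, n₂)] a e).exec env M a [(i : ℕ), (j : ℕ)] =
      e.eval (Function.update (Function.update env 6 i) 7 j) M :=
  (fill_spec ha he (by simp) env M).2 [(i : ℕ), (j : ℕ)] ⟨by rw [h₁]; exact i.2,
    by rw [Function.update_of_ne (by omega), h₂]; exact j.2, trivial⟩

theorem fill₃ (M : Memory) (ha : a < 100) (he : e.reads (fun b => decide (b < 100) && b != a))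
    (h₁ : env n₁ = p) (h₂ : env n₂ = q) (h₃ : env n₃ = r) (hn₂ : n₂ < 6) (hn₃ : n₃ < 6)
    (i : Fin p) (j : Fin q) (k : Fin r) :
    (fill [(6, n₁), (7, n₂), (8, n₃)] a e).exec env M a [(i : ℕ), (j : ℕ), (k : ℕ)] =
      e.eval (Function.update (Function.update (Function.update env 6 i) 7 j) 8 k) M :=
  (fill_spec ha he (by simp) env M).2 [(i : ℕ), (j : ℕ), (k : ℕ)] ⟨by rw [h₁]; exact i.2,
    by rw [Function.update_of_ne (by omega), h₂]; exact j.2,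
    by rw [Function.update_of_ne (by omega), Function.update_of_ne (by omega), h₃]; exact k.2,
    trivial⟩

theorem fill₄ (M : Memory) (ha : a < 100) (he : e.reads (fun b => decide (b < 100) && b != a))
    (h₁ : env n₁ = p) (h₂ : env n₂ = q) (h₃ : env n₃ = r) (h₄ : env n₄ = s) (hn₂ : n₂ < 6)
    (hn₃ : n₃ < 6) (hn₄ : n₄ < 6) (i : Fin p) (j : Fin q) (k : Fin r) (l : Fin s) :
    (fill [(6, n₁), (7, n₂), (8, n₃), (9, n₄)] a e).exec env M a
        [(i : ℕ), (j : ℕ), (k : ℕ), (l : ℕ)] =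
      e.eval (Function.update (Function.update (Function.update (Function.update env 6 i) 7 j) 8 k)
        9 l) M :=
  (fill_spec ha he (by simp) env M).2 [(i : ℕ), (j : ℕ), (k : ℕ), (l : ℕ)]
    ⟨by rw [h₁]; exact i.2,
    by rw [Function.update_of_ne (by omega), h₂]; exact j.2,
    by rw [Function.update_of_ne (by omega), Function.update_of_ne (by omega), h₃]; exact k.2,
    by rw [Function.update_of_ne (by omega), Function.update_of_ne (by omega),
      Function.update_of_ne (by omega), h₄]; exact l.2,
    trivial⟩

end Fill

/-! ### Contents of arrays -/

variable {K d m : ℕ}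

def IsVec {p : ℕ} (f : List ℕ → ℝ) (v : Fin p → ℝ) : Prop := ∀ i : Fin p, f [(i : ℕ)] = v i

def IsTable {p q : ℕ} (f : List ℕ → ℝ) (v : Fin p → Fin q → ℝ) : Prop :=
  ∀ (i : Fin p) (j : Fin q), f [(i : ℕ), (j : ℕ)] = v i j

def IsParam (f : List ℕ → ℝ) (v : Fin K × Fin d → ℝ) : Prop :=
  ∀ (k : Fin K) (i : Fin d), f [(k : ℕ), (i : ℕ)] = v (k, i)

def IsMat (f : List ℕ → ℝ) (A : Matrix (Fin K × Fin d) (Fin K × Fin d) ℝ) : Prop :=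
  ∀ (k : Fin K) (i : Fin d) (l : Fin K) (j : Fin d),
    f [(k : ℕ), (i : ℕ), (l : ℕ), (j : ℕ)] = A (k, i) (l, j)

/-- The array holds `A⁻¹ Φ(x)`. -/
def IsInvFeature (f : List ℕ → ℝ) (A : Matrix (Fin K × Fin d) (Fin K × Fin d) ℝ)
    (x : EuclideanSpace ℝ (Fin d)) : Prop :=
  ∀ (k : Fin K) (i : Fin d) (l : Fin K),
    f [(k : ℕ), (i : ℕ), (l : ℕ)] = ∑ j, A⁻¹ (k, i) (l, j) * x j

/-! ### Correctness of the program, statement by statement -/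

section Specs

variable {env : ℕ → ℕ} {M : Memory} {A : Matrix (Fin K × Fin d) (Fin K × Fin d) ℝ}
  {x : EuclideanSpace ℝ (Fin d)}

theorem initInv_spec {lam : ℝ} (h1 : env 1 = K) (h2 : env 2 = d) (hM : M 0 [0] = lam) :
    IsMat (K := K) (d := d) (initInv.exec env M 10) (lam • 1)⁻¹ := by
  intro k i l j
  have hinv : (lam • (1 : Matrix (Fin K × Fin d) (Fin K × Fin d) ℝ))⁻¹ = lam⁻¹ • 1 := by
    rcases eq_or_ne lam 0 with h | h
    · simp [h]
    · exact Matrix.inv_eq_right_inv (by simp [smul_smul, h])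
  rw [initInv, fill₄ M (by norm_num) rfl h1 h2 h1 h2 (by norm_num) (by norm_num) (by norm_num),
    hinv]
  simp only [eval_div, eval_mul, eval_eqInd, eval_param, hM, Function.update_apply,
    Matrix.smul_apply, Matrix.one_apply, Prod.mk.injEq, Fin.ext_iff]
  by_cases h3 : (k : ℕ) = l <;> by_cases h4 : (i : ℕ) = j <;> simp [h3, h4]

theorem invFeature_spec (h1 : env 1 = K) (h2 : env 2 = d) (hA : IsMat (M 10) A⁻¹)
    (hx : IsVec (M 1) x.ofLp) : IsInvFeature (invFeature.exec env M 13) A x := by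
  intro k i l
  rw [invFeature, fill₃ M (by norm_num) rfl h1 h2 h1 (by norm_num) (by norm_num)]
  simp [Expr.eval, BinOp.eval, eval_entry, h2, Finset.sum_range,
    hA k i l, hx _]

theorem mulVec_prod_apply (N : Matrix (Fin K × Fin d) (Fin K × Fin d) ℝ) (w : Fin K × Fin d → ℝ)
    (q : Fin K × Fin d) : (N *ᵥ w) q = ∑ l, ∑ j, N q (l, j) * w (l, j) := by
  simp only [Matrix.mulVec, dotProduct, Fintype.sum_prod_type]

theorem sampleCov_apply (A : Matrix (Fin K × Fin d) (Fin K × Fin d) ℝ)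
    (x : EuclideanSpace ℝ (Fin d)) (k l : Fin K) :
    sampleCov A x k l = ∑ i, x i * ∑ j, A⁻¹ (k, i) (l, j) * x j := by
  have h := congrFun (sampleCov_mulVec A x (Pi.single l 1)) k
  rw [Matrix.mulVec_single_one, Matrix.col_apply, linPred_apply] at h
  rw [h]
  refine Finset.sum_congr rfl fun i _ => ?_
  congr 1
  change (A⁻¹ *ᵥ (feature x *ᵥ Pi.single l 1)) (k, i) = _
  rw [mulVec_prod_apply, Finset.sum_eq_single l]
  · simp [feature_mulVec]
  · intro k' _ hk; simp [feature_mulVec, hk]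
  · simp

theorem covariance_spec (h1 : env 1 = K) (h2 : env 2 = d) (hU : IsInvFeature (M 13) A x)
    (hx : IsVec (M 1) x.ofLp) : IsTable (covariance.exec env M 14) (sampleCov A x) := by
  intro k l
  rw [covariance, fill₂ M (by norm_num) rfl h1 h1 (by norm_num), sampleCov_apply]
  simp [Expr.eval, BinOp.eval, eval_entry, h2, Finset.sum_range,
    hU k _ l, hx _]

theorem mean_spec {θ : Param K d} (h1 : env 1 = K) (h2 : env 2 = d) (hθ : IsParam (M 12) θ.ofLp)
    (hx : IsVec (M 1) x.ofLp) : IsVec (mean.exec env M 15) (linPred θ x) := by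
  intro k
  rw [mean, fill₁ M (by norm_num) rfl h1, linPred_apply]
  simp [Expr.eval, BinOp.eval, eval_entry, h2, Finset.sum_range, hθ k, hx _]

theorem copyCov_spec {W : Matrix (Fin K) (Fin K) ℝ} (h1 : env 1 = K) (hW : IsTable (M 14) W) :
    IsTable (copyCov.exec env M 16) W := by
  intro k l
  rw [copyCov, fill₂ M (by norm_num) rfl h1 h1 (by norm_num)]
  simp [eval_entry, hW k l]

theorem initSample_spec {z : Fin K → ℝ} (h1 : env 1 = K) (h3 : env 3 = m) (hz : IsVec (M 15) z) :
    IsTable (p := m) (initSample.exec env M 19) fun _ => z := by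
  intro i k
  rw [initSample, fill₂ M (by norm_num) rfl h3 h1 (by norm_num)]
  simp [eval_entry, hz k]

/-- The samples when the first `j` columns of the factor `S` have been used. -/
noncomputable def partialSample (z : Fin K → ℝ) (S : Matrix (Fin K) (Fin K) ℝ)
    (g : Fin m → Fin K → ℝ) (j : ℕ) (i : Fin m) (k : Fin K) : ℝ :=
  z k + ∑ v ∈ Finset.range j, if h : v < K then S k ⟨v, h⟩ * g i ⟨v, h⟩ else 0

theorem partialSample_last (z : Fin K → ℝ) (S : Matrix (Fin K) (Fin K) ℝ)
    (g : Fin m → Fin K → ℝ) (i : Fin m) : partialSample z S g K i = z + S *ᵥ g i := by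
  funext k
  simp [partialSample, Finset.sum_range, Matrix.mulVec, dotProduct]

/-- Elimination and sampling are interleaved: column `v` of the factor is applied to the noise as
soon as it is known, so the factor is never stored. -/
theorem sampleBody_spec {W S : Matrix (Fin K) (Fin K) ℝ} {g : Fin m → Fin K → ℝ}
    {z : Fin K → ℝ} {v : Fin K} (h1 : env 1 = K) (h3 : env 3 = m) (h5 : env 5 = v)
    (hW : IsTable (M 16) W) (hg : IsTable (M 2) g) (hS : ∀ k, S k v = pivotCol W v k)
    (hω : IsTable (M 19) (partialSample z S g v)) :
    IsTable (sampleBody.exec env M 16) (schur W v) ∧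
      IsTable (sampleBody.exec env M 19) (partialSample z S g (v + 1)) := by
  simp only [sampleBody, Cmd.exec_seq]
  set M₁ := pivot.exec env M with hM₁
  have e17 : IsVec (M₁ 17) (pivotCol W v) := by
    intro k
    rw [hM₁, pivot, fill₁ M (by norm_num) rfl h1]
    simp [Expr.eval, eval_div, UnOp.eval, eval_entry, h5, hW _ _, pivotCol]
  have f2 : M₁ 2 = M 2 := Cmd.exec_frame _ _ _ rfl
  have f16 : M₁ 16 = M 16 := Cmd.exec_frame _ _ _ rfl
  have f19 : M₁ 19 = M 19 := Cmd.exec_frame _ _ _ rfl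
  rw [← f2] at hg
  rw [← f16] at hW
  rw [← f19] at hω
  clear_value M₁
  set M₂ := schurNew.exec env M₁ with hM₂
  have e18 : IsTable (M₂ 18) (schur W v) := by
    intro k l
    rw [hM₂, schurNew, fill₂ M₁ (by norm_num) rfl h1 h1 (by norm_num)]
    simp [eval_sub, eval_mul, eval_entry, hW _ _, e17 _, schur]
  have f2 : M₂ 2 = M₁ 2 := Cmd.exec_frame _ _ _ rfl
  have f17 : M₂ 17 = M₁ 17 := Cmd.exec_frame _ _ _ rfl
  have f19 : M₂ 19 = M₁ 19 := Cmd.exec_frame _ _ _ rfl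
  rw [← f2] at hg
  rw [← f17] at e17
  rw [← f19] at hω
  clear_value M₂
  set M₃ := schurCopy.exec env M₂ with hM₃
  have e16 : IsTable (M₃ 16) (schur W v) := by
    intro k l
    rw [hM₃, schurCopy, fill₂ M₂ (by norm_num) rfl h1 h1 (by norm_num)]
    simp [eval_entry, e18 _ _]
  have f2 : M₃ 2 = M₂ 2 := Cmd.exec_frame _ _ _ rfl
  have f17 : M₃ 17 = M₂ 17 := Cmd.exec_frame _ _ _ rfl
  have f19 : M₃ 19 = M₂ 19 := Cmd.exec_frame _ _ _ rfl
  rw [← f2] at hg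
  rw [← f17] at e17
  rw [← f19] at hω
  clear_value M₃
  set M₄ := sampleNew.exec env M₃ with hM₄
  have e20 : IsTable (M₄ 20) (partialSample z S g (v + 1)) := by
    intro i k
    rw [hM₄, sampleNew, fill₂ M₃ (by norm_num) rfl h3 h1 (by norm_num)]
    simp [eval_add, eval_mul, eval_entry, h5, hω i k, e17 k, hg i v,
      partialSample, Finset.sum_range_succ, hS, add_assoc]
  have f16 : M₄ 16 = M₃ 16 := Cmd.exec_frame _ _ _ rfl
  rw [← f16] at e16
  clear_value M₄
  refine ⟨?_, fun i k => ?_⟩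
  · rw [Cmd.exec_frame sampleCopy env M₄ rfl]; exact e16
  · rw [sampleCopy, fill₂ M₄ (by norm_num) rfl h3 h1 (by norm_num)]
    simp [eval_entry, e20 _ _]

theorem sampleLoop_spec {W : Matrix (Fin K) (Fin K) ℝ} {g : Fin m → Fin K → ℝ}
    {z : Fin K → ℝ} (h1 : env 1 = K) (h3 : env 3 = m) (hW : IsTable (M 16) W)
    (hg : IsTable (M 2) g) (hω : IsTable (p := m) (M 19) fun _ => z) :
    IsTable (sampleLoop.exec env M 19) fun i => z + schurFactor W *ᵥ g i := by
  have h := Cmd.forLoop_induction (v := 5) (n := 1) (c := sampleBody) (env := env) (M := M)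
    (Inv := fun j M' => M' 2 = M 2 ∧ IsTable (M' 16) (schurIter W j) ∧
      IsTable (M' 19) (partialSample z (schurFactor W) g j))
    ⟨rfl, hW, fun i k => by simpa [partialSample] using hω i k⟩
    (fun j hj M' ⟨i1, i2, i3⟩ => by
      obtain ⟨v, rfl⟩ : ∃ v : Fin K, j = v := ⟨⟨j, h1 ▸ hj⟩, rfl⟩
      rw [schurIter_succ]
      exact ⟨(Cmd.exec_frame _ _ _ rfl).trans i1,
        sampleBody_spec (by simpa using h1) (by simpa using h3) (by simp) i2 (i1 ▸ hg)
          (fun k => rfl) i3⟩)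
  intro i k
  rw [h1] at h
  have h4 := h.2.2 i k
  rwa [partialSample_last] at h4

/-- After each statement the frame rule carries the facts still needed to the new memory, whose
definition is then forgotten. Arrays `13` and `14` are part of the conclusion because the update
reuses them. -/
theorem gafPredict_spec {θ : Param K d} {g : Fin m → Fin K → ℝ} {μ : ℝ} (h1 : env 1 = K)
    (h2 : env 2 = d) (h3 : env 3 = m) (hA : IsMat (M 10) A⁻¹) (hθ : IsParam (M 12) θ.ofLp)
    (hx : IsVec (M 1) x.ofLp) (hg : IsTable (M 2) g) (hμ : M 0 [2] = μ) :
    IsVec (gafPredict.exec env M 3)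
      (prediction μ fun i => linPred θ x + schurFactor (sampleCov A x) *ᵥ g i) ∧
    IsInvFeature (gafPredict.exec env M 13) A x ∧
    IsTable (gafPredict.exec env M 14) (sampleCov A x) := by
  simp only [gafPredict, Cmd.exec_seq]
  set M₁ := invFeature.exec env M with hM₁
  have e13 : IsInvFeature (M₁ 13) A x := invFeature_spec h1 h2 hA hx
  have f0 : M₁ 0 = M 0 := Cmd.exec_frame _ _ _ rfl
  have f1 : M₁ 1 = M 1 := Cmd.exec_frame _ _ _ rfl
  have f2 : M₁ 2 = M 2 := Cmd.exec_frame _ _ _ rfl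
  have f12 : M₁ 12 = M 12 := Cmd.exec_frame _ _ _ rfl
  rw [← f0] at hμ
  rw [← f1] at hx
  rw [← f2] at hg
  rw [← f12] at hθ
  clear_value M₁
  set M₂ := covariance.exec env M₁ with hM₂
  have e14 : IsTable (M₂ 14) (sampleCov A x) := covariance_spec h1 h2 e13 hx
  have f0 : M₂ 0 = M₁ 0 := Cmd.exec_frame _ _ _ rfl
  have f1 : M₂ 1 = M₁ 1 := Cmd.exec_frame _ _ _ rfl
  have f2 : M₂ 2 = M₁ 2 := Cmd.exec_frame _ _ _ rfl
  have f12 : M₂ 12 = M₁ 12 := Cmd.exec_frame _ _ _ rfl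
  have f13 : M₂ 13 = M₁ 13 := Cmd.exec_frame _ _ _ rfl
  rw [← f0] at hμ
  rw [← f1] at hx
  rw [← f2] at hg
  rw [← f12] at hθ
  rw [← f13] at e13
  clear_value M₂
  set M₃ := mean.exec env M₂ with hM₃
  have e15 : IsVec (M₃ 15) (linPred θ x) := mean_spec h1 h2 hθ hx
  have f0 : M₃ 0 = M₂ 0 := Cmd.exec_frame _ _ _ rfl
  have f2 : M₃ 2 = M₂ 2 := Cmd.exec_frame _ _ _ rfl
  have f13 : M₃ 13 = M₂ 13 := Cmd.exec_frame _ _ _ rfl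
  have f14 : M₃ 14 = M₂ 14 := Cmd.exec_frame _ _ _ rfl
  rw [← f0] at hμ
  rw [← f2] at hg
  rw [← f13] at e13
  rw [← f14] at e14
  clear_value M₃
  set M₄ := copyCov.exec env M₃ with hM₄
  have e16 : IsTable (M₄ 16) (sampleCov A x) := copyCov_spec h1 e14
  have f0 : M₄ 0 = M₃ 0 := Cmd.exec_frame _ _ _ rfl
  have f2 : M₄ 2 = M₃ 2 := Cmd.exec_frame _ _ _ rfl
  have f13 : M₄ 13 = M₃ 13 := Cmd.exec_frame _ _ _ rfl
  have f14 : M₄ 14 = M₃ 14 := Cmd.exec_frame _ _ _ rfl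
  have f15 : M₄ 15 = M₃ 15 := Cmd.exec_frame _ _ _ rfl
  rw [← f0] at hμ
  rw [← f2] at hg
  rw [← f13] at e13
  rw [← f14] at e14
  rw [← f15] at e15
  clear_value M₄
  set M₅ := initSample.exec env M₄ with hM₅
  have e19 : IsTable (p := m) (M₅ 19) fun _ => linPred θ x := initSample_spec h1 h3 e15
  have f0 : M₅ 0 = M₄ 0 := Cmd.exec_frame _ _ _ rfl
  have f2 : M₅ 2 = M₄ 2 := Cmd.exec_frame _ _ _ rfl
  have f13 : M₅ 13 = M₄ 13 := Cmd.exec_frame _ _ _ rfl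
  have f14 : M₅ 14 = M₄ 14 := Cmd.exec_frame _ _ _ rfl
  have f16 : M₅ 16 = M₄ 16 := Cmd.exec_frame _ _ _ rfl
  rw [← f0] at hμ
  rw [← f2] at hg
  rw [← f13] at e13
  rw [← f14] at e14
  rw [← f16] at e16
  clear_value M₅
  set M₆ := sampleLoop.exec env M₅ with hM₆
  replace e19 : IsTable (M₆ 19) fun i => linPred θ x + schurFactor (sampleCov A x) *ᵥ g i :=
    sampleLoop_spec h1 h3 e16 hg e19
  have f0 : M₆ 0 = M₅ 0 := Cmd.exec_frame _ _ _ rfl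
  have f13 : M₆ 13 = M₅ 13 := Cmd.exec_frame _ _ _ rfl
  have f14 : M₆ 14 = M₅ 14 := Cmd.exec_frame _ _ _ rfl
  rw [← f0] at hμ
  rw [← f13] at e13
  rw [← f14] at e14
  clear_value M₆
  set ω := fun i => linPred θ x + schurFactor (sampleCov A x) *ᵥ g i
  set M₇ := expSum.exec env M₆ with hM₇
  have e21 : IsVec (p := m) (M₇ 21) fun i => ∑ k, Real.exp (ω i k) := by
    intro i
    rw [hM₇, expSum, fill₁ M₆ (by norm_num) rfl h3]
    simp [Expr.eval, UnOp.eval, eval_entry, h1, Finset.sum_range, e19 i _]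
  have f0 : M₇ 0 = M₆ 0 := Cmd.exec_frame _ _ _ rfl
  have f13 : M₇ 13 = M₆ 13 := Cmd.exec_frame _ _ _ rfl
  have f14 : M₇ 14 = M₆ 14 := Cmd.exec_frame _ _ _ rfl
  have f19 : M₇ 19 = M₆ 19 := Cmd.exec_frame _ _ _ rfl
  rw [← f0] at hμ
  rw [← f13] at e13
  rw [← f14] at e14
  rw [← f19] at e19
  clear_value M₇
  refine ⟨fun k => ?_, ?_, ?_⟩
  · rw [output, fill₁ M₇ (by norm_num) rfl h1]
    simp only [Expr.eval, BinOp.eval, UnOp.eval, eval_sub, eval_div, eval_entry,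
      eval_param, Index.eval, hμ, prediction, smooth, softmax]
    simp [h1, h3, Finset.sum_range, e19 _ k, e21 _]
  · rw [Cmd.exec_frame output env M₇ rfl]; exact e13
  · rw [Cmd.exec_frame output env M₇ rfl]; exact e14

/-! ### The update -/

/-- The vector `b - Φ(x) e_y`. -/
def linearPart (b : Param K d) (x : EuclideanSpace ℝ (Fin d)) (y : Fin K) : Fin K × Fin d → ℝ :=
  fun q => b q - (if q.1 = y then 1 else 0) * x q.2

theorem argminStep_apply (A : Matrix (Fin K × Fin d) (Fin K × Fin d) ℝ) (b : Param K d)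
    (x : EuclideanSpace ℝ (Fin d)) (y : Fin K) (z : Fin K → ℝ) (k : Fin K) (i : Fin d) :
    argminStep A b x y z (k, i) = -1 / 2 * ((A⁻¹ *ᵥ linearPart b x y) (k, i) +
      ∑ l, (∑ j, A⁻¹ (k, i) (l, j) * x j) * softmax z l) := by
  have h : b.ofLp + feature x *ᵥ lossGrad z y = linearPart b x y + feature x *ᵥ softmax z := by
    funext q
    simp only [Pi.add_apply, feature_mulVec, linearPart, lossGrad]; ring
  simp only [argminStep, h, Matrix.mulVec_add, Pi.smul_apply, Pi.add_apply, smul_eq_mul]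
  rw [mulVec_prod_apply A⁻¹ (feature x *ᵥ softmax z)]
  simp only [feature_mulVec, Finset.sum_mul]
  rw [show (-(1 / 2) : ℝ) = -1 / 2 by norm_num]
  congr 2
  exact Finset.sum_congr rfl fun l _ => Finset.sum_congr rfl fun j _ => by ring

/-- The fixed-point map in prediction space needs only the covariance and one fixed vector. This is
the reason for the cost `O(K²)` per iteration, independent of `d`. -/
theorem linPred_argminStep (A : Matrix (Fin K × Fin d) (Fin K × Fin d) ℝ) (b : Param K d)
    (x : EuclideanSpace ℝ (Fin d)) (y : Fin K) (z : Fin K → ℝ) (k : Fin K) :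
    linPred (argminStep A b x y z) x k = -1 / 2 *
      (∑ i, x i * (A⁻¹ *ᵥ linearPart b x y) (k, i) + ∑ l, sampleCov A x k l * softmax z l) := by
  simp only [linPred_apply, argminStep_apply, sampleCov_apply, Finset.sum_mul]
  rw [Finset.sum_comm, ← Finset.sum_add_distrib, Finset.mul_sum]
  refine Finset.sum_congr rfl fun i _ => ?_
  rw [mul_left_comm, mul_add, Finset.mul_sum]
  simp only [Finset.mul_sum, Finset.sum_mul, mul_assoc]

theorem softIter_spec {z : Fin K → ℝ} (h1 : env 1 = K) (hz : IsVec (M 25) z) :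
    IsVec (softIter.exec env M 26) (softmax z) := by
  intro k
  rw [softIter, fill₁ M (by norm_num) rfl h1]
  simp [Expr.eval, UnOp.eval, eval_div, eval_entry, h1, Finset.sum_range,
    hz _, softmax]

theorem iterLoop_spec {b : Param K d} {y : Fin K} (h1 : env 1 = K) (h3 : env 3 = m)
    (hW : IsTable (M 14) (sampleCov A x))
    (hc : IsVec (M 24) fun k => ∑ i, x i * (A⁻¹ *ᵥ linearPart b x y) (k, i))
    (hz : IsVec (p := K) (M 25) 0) :
    IsVec (iterLoop.exec env M 25) (predIter A b x y m) := by
  have h := Cmd.forLoop_induction (v := 5) (n := 3) (c := .seq softIter stepIter) (env := env)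
    (M := M) (Inv := fun j M' => M' 14 = M 14 ∧ M' 24 = M 24 ∧
      IsVec (M' 25) (predIter A b x y j))
    ⟨rfl, rfl, hz⟩
    (fun j hj M' ⟨i1, i2, i3⟩ => by
      refine ⟨(Cmd.exec_frame _ _ _ rfl).trans i1, (Cmd.exec_frame _ _ _ rfl).trans i2, ?_⟩
      have h1' : Function.update env 5 j 1 = K := by simpa using h1
      have e26 := softIter_spec h1' i3
      rw [← i1] at hW
      rw [← i2] at hc
      rw [Cmd.exec]
      set M₁ := softIter.exec (Function.update env 5 j) M' with hM₁
      have f14 : M₁ 14 = M' 14 := Cmd.exec_frame _ _ _ rfl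
      have f24 : M₁ 24 = M' 24 := Cmd.exec_frame _ _ _ rfl
      rw [← f14] at hW
      rw [← f24] at hc
      clear_value M₁
      intro k
      rw [stepIter, fill₁ M₁ (by norm_num) rfl h1', predIter, linPred_argminStep]
      simp only [Expr.eval, BinOp.eval, eval_entry]
      simp [h1, Finset.sum_range, hc k, hW k _, e26 _])
  rw [h3] at h
  exact h.2.2

/-- The vector `b_t` after the update. -/
theorem linNew_eq [NeZero K] (b θ : Param K d) (x : EuclideanSpace ℝ (Fin d)) (y : Fin K) (β : ℝ)
    (k : Fin K) (i : Fin d) :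
    (b + gradient (paramLoss x y) θ -
      β • WithLp.toLp 2 (Matrix.mulVec (hessian (paramLoss x y) θ) θ.ofLp)) (k, i) =
    linearPart b x y (k, i) + x i * (softmax (linPred θ x) k - β * (softmax (linPred θ x) k *
      (linPred θ x k - ∑ l, softmax (linPred θ x) l * linPred θ x l))) := by
  have h : ∀ w : Fin K × Fin d → ℝ, (b + gradient (paramLoss x y) θ - β • WithLp.toLp 2 w) (k, i) =
      b (k, i) + gradient (paramLoss x y) θ (k, i) - β * w (k, i) := fun w => rfl
  rw [h, hessian_paramLoss, gradient_paramLoss, ← Matrix.mulVec_mulVec, ← Matrix.mulVec_mulVec,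
    ← linPred_eq, feature_mulVec, softHess_mulVec]
  simp only [linearPart, lossGrad, feature_mulVec]
  ring

theorem rankBody_spec {lam β : ℝ} (hl : 0 < lam) (hA : Dominates lam A) (hβ : 0 ≤ β)
    {p : Fin K → ℝ} (hp0 : ∀ k, 0 ≤ p k) {v : Fin K} (h1 : env 1 = K) (h2 : env 2 = d)
    (h5 : env 5 = v) (hx : IsVec (M 1) x.ofLp) (hM : M 0 [1] = β) (hp : IsVec (M 26) p)
    (hinv : IsMat (M 10) A⁻¹) :
    IsMat (rankBody.exec env M 10)
      (A + (β / 2 * p v) • Matrix.vecMulVec (feature x *ᵥ dev p v) (feature x *ᵥ dev p v))⁻¹ := by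
  simp only [rankBody, Cmd.exec_seq]
  set u := feature x *ᵥ dev p v with hu
  set M₁ := devFeature.exec env M with hM₁
  have e27 : IsParam (M₁ 27) u := by
    intro k i
    rw [hM₁, devFeature, fill₂ M (by norm_num) rfl h1 h2 (by norm_num), hu, feature_mulVec]
    simp [eval_sub, eval_mul, eval_entry, eval_eqInd, h5, hp k, hx i, dev,
      Pi.single_apply, Fin.ext_iff]
  have f0 : M₁ 0 = M 0 := Cmd.exec_frame _ _ _ rfl
  have f10 : M₁ 10 = M 10 := Cmd.exec_frame _ _ _ rfl
  have f26 : M₁ 26 = M 26 := Cmd.exec_frame _ _ _ rfl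
  rw [← f0] at hM
  rw [← f10] at hinv
  rw [← f26] at hp
  clear_value M₁
  set M₂ := invDev.exec env M₁ with hM₂
  have e28 : IsParam (M₂ 28) (A⁻¹ *ᵥ u) := by
    intro k i
    rw [hM₂, invDev, fill₂ M₁ (by norm_num) rfl h1 h2 (by norm_num), mulVec_prod_apply]
    simp [Expr.eval, BinOp.eval, eval_entry, h1, h2,
      Finset.sum_range, hinv k i _ _, e27 _ _]
  have f0 : M₂ 0 = M₁ 0 := Cmd.exec_frame _ _ _ rfl
  have f10 : M₂ 10 = M₁ 10 := Cmd.exec_frame _ _ _ rfl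
  have f26 : M₂ 26 = M₁ 26 := Cmd.exec_frame _ _ _ rfl
  have f27 : M₂ 27 = M₁ 27 := Cmd.exec_frame _ _ _ rfl
  rw [← f0] at hM
  rw [← f10] at hinv
  rw [← f26] at hp
  rw [← f27] at e27
  clear_value M₂
  set M₃ := rankCoef.exec env M₂ with hM₃
  have e29 : M₃ 29 [] = β / 2 * p v / (1 + β / 2 * p v * (u ⬝ᵥ A⁻¹ *ᵥ u)) := by
    rw [hM₃, rankCoef, fill₀ M₂ (by norm_num) rfl, dotProduct, Fintype.sum_prod_type]
    simp [Expr.eval, BinOp.eval, eval_div, eval_entry, eval_param,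
      h1, h2, h5, hM, Finset.sum_range, e27 _ _, e28 _ _, hp v]
  have f10 : M₃ 10 = M₂ 10 := Cmd.exec_frame _ _ _ rfl
  have f28 : M₃ 28 = M₂ 28 := Cmd.exec_frame _ _ _ rfl
  rw [← f10] at hinv
  rw [← f28] at e28
  clear_value M₃
  set M₄ := rankNew.exec env M₃ with hM₄
  intro k i l j
  rw [rankCopy, fill₄ M₄ (by norm_num) rfl h1 h2 h1 h2 (by norm_num) (by norm_num) (by norm_num)]
  simp only [eval_entry, Function.update_apply, List.map]
  norm_num
  rw [hM₄, rankNew, fill₄ M₃ (by norm_num) rfl h1 h2 h1 h2 (by norm_num) (by norm_num)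
    (by norm_num), hA.inv_add_vecMulVec hl (mul_nonneg (by linarith) (hp0 v))]
  simp [eval_sub, eval_mul, eval_entry, e28 _ _, e29, hinv k i l j,
    Matrix.vecMulVec_apply]

theorem rankLoop_spec {lam β : ℝ} (hl : 0 < lam) (hA : Dominates lam A) (hβ : 0 ≤ β)
    {p : Fin K → ℝ} (hp0 : ∀ k, 0 ≤ p k) (h1 : env 1 = K) (h2 : env 2 = d)
    (hx : IsVec (M 1) x.ofLp) (hM : M 0 [1] = β) (hp : IsVec (M 26) p)
    (hinv : IsMat (M 10) A⁻¹) :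
    IsMat (rankLoop.exec env M 10) (hessPartial A (β / 2) p x K)⁻¹ := by
  have h := Cmd.forLoop_induction (v := 5) (n := 1) (c := rankBody) (env := env) (M := M)
    (Inv := fun j M' => M' 0 = M 0 ∧ M' 1 = M 1 ∧ M' 26 = M 26 ∧
      IsMat (M' 10) (hessPartial A (β / 2) p x j)⁻¹)
    ⟨rfl, rfl, rfl, by rwa [hessPartial_zero]⟩
    (fun j hj M' ⟨i1, i2, i3, i4⟩ => by
      obtain ⟨v, rfl⟩ : ∃ v : Fin K, j = v := ⟨⟨j, h1 ▸ hj⟩, rfl⟩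
      refine ⟨(Cmd.exec_frame _ _ _ rfl).trans i1, (Cmd.exec_frame _ _ _ rfl).trans i2,
        (Cmd.exec_frame _ _ _ rfl).trans i3, ?_⟩
      rw [hessPartial_succ]
      exact rankBody_spec hl (hA.hessPartial (by linarith) hp0 x v v.2.le) hβ hp0
        (by simpa using h1) (by simpa using h2) (by simp) (i2 ▸ hx) (by rw [i1, hM]) (i3 ▸ hp) i4)
  rw [h1] at h
  exact h.2.2.2

/-- The softmax is computed twice after the loop: at the last iterate, to form the estimator, and at
the prediction of that estimator, where gradient and Hessian are taken. -/
theorem gafUpdate_spec [NeZero K] {lam β : ℝ} (hl : 0 < lam) (hA : Dominates lam A) (hβ : 0 ≤ β)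
    {b : Param K d} {y : Fin K} (h1 : env 1 = K) (h2 : env 2 = d) (h3 : env 3 = m)
    (h4 : env 4 = y) (hx : IsVec (M 1) x.ofLp) (hM : M 0 [1] = β) (hinv : IsMat (M 10) A⁻¹)
    (hb : IsParam (M 11) b.ofLp) (hU : IsInvFeature (M 13) A x)
    (hW : IsTable (M 14) (sampleCov A x)) {θ : Param K d}
    (hθ : θ = argminStep A b x y (predIter A b x y m)) :
    IsParam (gafUpdate.exec env M 12) θ.ofLp ∧
    IsParam (gafUpdate.exec env M 11) (b + gradient (paramLoss x y) θ - β • WithLp.toLp 2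
        (Matrix.mulVec (hessian (paramLoss x y) θ) θ.ofLp)).ofLp ∧
    IsMat (gafUpdate.exec env M 10) (A + (β / 2) • hessian (paramLoss x y) θ)⁻¹ := by
  simp only [gafUpdate, Cmd.exec_seq]
  set M₁ := linGrad.exec env M with hM₁
  have e22 : IsParam (M₁ 22) (linearPart b x y) := by
    intro k i
    rw [hM₁, linGrad, fill₂ M (by norm_num) rfl h1 h2 (by norm_num)]
    simp only [eval_sub, eval_mul, eval_entry, eval_eqInd, List.map, Function.update_apply]
    by_cases h : k = y
    · subst h; simp [h4, hb k i, hx i, linearPart]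
    · have h' : (k : ℕ) ≠ y := fun h' => h (Fin.ext h')
      simp [h4, hb k i, hx i, linearPart, h, h']
  have f0 : M₁ 0 = M 0 := Cmd.exec_frame _ _ _ rfl
  have f1 : M₁ 1 = M 1 := Cmd.exec_frame _ _ _ rfl
  have f10 : M₁ 10 = M 10 := Cmd.exec_frame _ _ _ rfl
  have f13 : M₁ 13 = M 13 := Cmd.exec_frame _ _ _ rfl
  have f14 : M₁ 14 = M 14 := Cmd.exec_frame _ _ _ rfl
  rw [← f0] at hM
  rw [← f1] at hx
  rw [← f10] at hinv
  rw [← f13] at hU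
  rw [← f14] at hW
  clear_value M₁
  set M₂ := invGrad.exec env M₁ with hM₂
  have e23 : IsParam (M₂ 23) (A⁻¹ *ᵥ linearPart b x y) := by
    intro k i
    rw [hM₂, invGrad, fill₂ M₁ (by norm_num) rfl h1 h2 (by norm_num), mulVec_prod_apply]
    simp [Expr.eval, BinOp.eval, eval_entry, h1, h2,
      Finset.sum_range, hinv k i _ _, e22 _ _]
  have f0 : M₂ 0 = M₁ 0 := Cmd.exec_frame _ _ _ rfl
  have f1 : M₂ 1 = M₁ 1 := Cmd.exec_frame _ _ _ rfl
  have f10 : M₂ 10 = M₁ 10 := Cmd.exec_frame _ _ _ rfl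
  have f13 : M₂ 13 = M₁ 13 := Cmd.exec_frame _ _ _ rfl
  have f14 : M₂ 14 = M₁ 14 := Cmd.exec_frame _ _ _ rfl
  have f22 : M₂ 22 = M₁ 22 := Cmd.exec_frame _ _ _ rfl
  rw [← f0] at hM
  rw [← f1] at hx
  rw [← f10] at hinv
  rw [← f13] at hU
  rw [← f14] at hW
  rw [← f22] at e22
  clear_value M₂
  set M₃ := predGrad.exec env M₂ with hM₃
  have e24 : IsVec (M₃ 24) fun k => ∑ i, x i * (A⁻¹ *ᵥ linearPart b x y) (k, i) := by
    intro k
    rw [hM₃, predGrad, fill₁ M₂ (by norm_num) rfl h1]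
    simp [Expr.eval, BinOp.eval, eval_entry, h2, Finset.sum_range,
      hx _, e23 k _]
  clear_value M₃
  set M₄ := initIter.exec env M₃ with hM₄
  have e25 : IsVec (p := K) (M₄ 25) 0 := by
    intro k
    rw [hM₄, initIter, fill₁ M₃ (by norm_num) rfl h1]
    simp [Expr.eval]
  have f24 : M₄ 24 = M₃ 24 := Cmd.exec_frame _ _ _ rfl
  have f14 : M₄ 14 = M₂ 14 := by
    rw [hM₄, Cmd.exec_frame _ _ _ rfl, hM₃, Cmd.exec_frame _ _ _ rfl]
  rw [← f24] at e24
  rw [← f14] at hW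
  clear_value M₄
  set M₅ := iterLoop.exec env M₄ with hM₅
  replace e25 : IsVec (M₅ 25) (predIter A b x y m) := iterLoop_spec h1 h3 hW e24 e25
  clear_value M₅
  set M₆ := softIter.exec env M₅ with hM₆
  have e26 : IsVec (M₆ 26) (softmax (predIter A b x y m)) := softIter_spec h1 e25
  have fr : ∀ a, predGrad.writes a = false → initIter.writes a = false →
      iterLoop.writes a = false → softIter.writes a = false → M₆ a = M₂ a := by
    intro a a1 a2 a3 a4
    rw [hM₆, Cmd.exec_frame _ _ _ a4, hM₅, Cmd.exec_frame _ _ _ a3, hM₄, Cmd.exec_frame _ _ _ a2,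
      hM₃, Cmd.exec_frame _ _ _ a1]
  rw [← fr 0 rfl rfl rfl rfl] at hM
  rw [← fr 1 rfl rfl rfl rfl] at hx
  rw [← fr 10 rfl rfl rfl rfl] at hinv
  rw [← fr 13 rfl rfl rfl rfl] at hU
  rw [← fr 22 rfl rfl rfl rfl] at e22
  rw [← fr 23 rfl rfl rfl rfl] at e23
  clear_value M₆
  set M₇ := estimator.exec env M₆ with hM₇
  have e12 : IsParam (M₇ 12) θ.ofLp := by
    intro k i
    rw [hM₇, estimator, fill₂ M₆ (by norm_num) rfl h1 h2 (by norm_num), hθ, argminStep_apply]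
    simp only [Expr.eval, BinOp.eval, eval_entry]
    simp [h1, Finset.sum_range, e23 k i, hU k i _, e26 _]
  have f1 : M₇ 1 = M₆ 1 := Cmd.exec_frame _ _ _ rfl
  clear_value M₇
  set M₈ := predEst.exec env M₇ with hM₈
  have e25 : IsVec (M₈ 25) (linPred θ x) := by
    intro k
    rw [hM₈, predEst, fill₁ M₇ (by norm_num) rfl h1, linPred_apply]
    rw [← f1] at hx
    simp [Expr.eval, BinOp.eval, eval_entry, h2, Finset.sum_range,
      hx _, e12 k _]
  have f12 : M₈ 12 = M₇ 12 := Cmd.exec_frame _ _ _ rfl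
  rw [← f12] at e12
  clear_value M₈
  set M₉ := softIter.exec env M₈ with hM₉
  replace e26 : IsVec (M₉ 26) (softmax (linPred θ x)) := softIter_spec h1 e25
  have f12 : M₉ 12 = M₈ 12 := Cmd.exec_frame _ _ _ rfl
  have f25 : M₉ 25 = M₈ 25 := Cmd.exec_frame _ _ _ rfl
  have fr : ∀ a, estimator.writes a = false → predEst.writes a = false →
      softIter.writes a = false → M₉ a = M₆ a := by
    intro a a1 a2 a3
    rw [hM₉, Cmd.exec_frame _ _ _ a3, hM₈, Cmd.exec_frame _ _ _ a2, hM₇, Cmd.exec_frame _ _ _ a1]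
  rw [← fr 0 rfl rfl rfl] at hM
  rw [← fr 1 rfl rfl rfl] at hx
  rw [← fr 10 rfl rfl rfl] at hinv
  rw [← fr 22 rfl rfl rfl] at e22
  rw [← f12] at e12
  rw [← f25] at e25
  clear_value M₉
  set M₁₀ := linNew.exec env M₉ with hM₁₀
  have e11 : IsParam (M₁₀ 11) (b + gradient (paramLoss x y) θ - β • WithLp.toLp 2
        (Matrix.mulVec (hessian (paramLoss x y) θ) θ.ofLp)).ofLp := by
    intro k i
    rw [linNew_eq, hM₁₀, linNew, fill₂ M₉ (by norm_num) rfl h1 h2 (by norm_num)]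
    simp only [Expr.eval, BinOp.eval, eval_sub, eval_entry, eval_param]
    simp [h1, Finset.sum_range, e22 k i, hx i, hM, e26 _, e25 _]
  have f0 : M₁₀ 0 = M₉ 0 := Cmd.exec_frame _ _ _ rfl
  have f1 : M₁₀ 1 = M₉ 1 := Cmd.exec_frame _ _ _ rfl
  have f10 : M₁₀ 10 = M₉ 10 := Cmd.exec_frame _ _ _ rfl
  have f12 : M₁₀ 12 = M₉ 12 := Cmd.exec_frame _ _ _ rfl
  have f26 : M₁₀ 26 = M₉ 26 := Cmd.exec_frame _ _ _ rfl
  rw [← f0] at hM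
  rw [← f1] at hx
  rw [← f10] at hinv
  rw [← f12] at e12
  rw [← f26] at e26
  clear_value M₁₀
  refine ⟨?_, ?_, ?_⟩
  · rw [Cmd.exec_frame rankLoop env M₁₀ rfl]; exact e12
  · rw [Cmd.exec_frame rankLoop env M₁₀ rfl]; exact e11
  · rw [hessian_paramLoss, ← hessPartial_last A (β / 2) (fun k => (softmax_pos _ k).le)
      (sum_softmax _)]
    exact rankLoop_spec hl hA hβ (fun k => (softmax_pos _ k).le) h1 h2 hx hM e26 hinv

end Specs

/-! ### The cost of the program -/

section Cost

/-- All sums run over variables from `5` on, and up to a size parameter. -/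
def Expr.sized : Expr → Bool
  | .cell _ _ => true
  | .const _ => true
  | .index _ => true
  | .un _ e => e.sized
  | .bin _ e₁ e₂ => e₁.sized && e₂.sized
  | .sum v n e => decide (5 ≤ v) && decide (n < 5) && e.sized

def Expr.cost (env : ℕ → ℕ) : Expr → ℕ
  | .cell _ _ => 2
  | .const _ => 1
  | .index _ => 1
  | .un _ e => e.cost env + 1
  | .bin _ e₁ e₂ => e₁.cost env + (e₂.cost env + 1)
  | .sum _ n e => 1 + (1 + env n * (1 + (e.cost env + 1)))

variable {env : ℕ → ℕ}

theorem Expr.cost_compile : ∀ (e : Expr) (T : ℕ) (env' : ℕ → ℕ), e.sized →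
    (∀ i < 5, env' i = env i) → (e.compile T).cost env' = e.cost env := by
  intro e
  induction e with
  | cell a idx => intros; rfl
  | const q => intros; rfl
  | index e => intros; rfl
  | un f e ih =>
    intro T env' h he
    rw [compile, Cmd.cost, ih T env' h he, Expr.cost, Cmd.cost]
  | bin f e₁ e₂ ih₁ ih₂ =>
    intro T env' h he
    rw [sized, Bool.and_eq_true] at h
    rw [compile, Cmd.cost, Cmd.cost, ih₁ T env' h.1 he, ih₂ (T + 1) env' h.2 he, Expr.cost, Cmd.cost]
  | sum v n e ih =>
    intro T env' h he
    simp only [sized, Bool.and_eq_true, decide_eq_true_eq] at h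
    have h1 : ∀ i, (e.compile (T + 1)).cost (Function.update env' v i) = e.cost env := fun i =>
      ih (T + 1) _ h.2 fun j hj => by
        rw [Function.update_of_ne (by omega), he j hj]
    rw [compile, Cmd.cost, Cmd.cost, Cmd.cost, Expr.cost]
    simp only [Cmd.cost, h1, Index.eval, Finset.sum_const, Finset.card_range, smul_eq_mul,
      he n h.1.2]

def loopsCost (env : ℕ → ℕ) (c : ℕ) : List (ℕ × ℕ) → ℕ
  | [] => c
  | (_, n) :: vs => 1 + env n * (1 + loopsCost env c vs)

/-- An equality, since loop bounds are size parameters in variables below 5 while loop and summation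
variables are at least 5; no iteration changes a bound. -/
theorem cost_fill {vs : List (ℕ × ℕ)} {a : ℕ} {e : Expr} {env' : ℕ → ℕ} (h : e.sized)
    (hvs : vs.all fun v => decide (5 ≤ v.1) && decide (v.2 < 5)) (he : ∀ i < 5, env' i = env i) :
    (fill vs a e).cost env' = loopsCost env (e.cost env + 2) vs := by
  have key : ∀ (vs : List (ℕ × ℕ)) (idx : List Index) (env' : ℕ → ℕ),
      (vs.all fun v => decide (5 ≤ v.1) && decide (v.2 < 5)) → (∀ i < 5, env' i = env i) →
      (loops vs (assign a idx e)).cost env' = loopsCost env (e.cost env + 2) vs := by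
    intro vs idx
    induction vs with
    | nil =>
      intro env' _ he
      simp only [loops, assign, Cmd.cost, loopsCost, e.cost_compile 100 env' h he]
    | cons v vs ih =>
      intro env' hvs he
      simp only [List.all_cons, Bool.and_eq_true, decide_eq_true_eq] at hvs
      have h1 : ∀ i, (loops vs (assign a idx e)).cost (Function.update env' v.1 i) =
          loopsCost env (e.cost env + 2) vs := fun i => ih _ hvs.2 fun j hj => by
        rw [Function.update_of_ne (by omega), he j hj]
      obtain ⟨v, n⟩ := v
      simp only [loops, Cmd.cost, h1, Index.eval, Finset.sum_const, Finset.card_range, smul_eq_mul,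
        he n hvs.1.2, loopsCost]
  exact key vs _ env' hvs he

theorem cost_seq (c₁ c₂ : Cmd) (env : ℕ → ℕ) :
    (Cmd.seq c₁ c₂).cost env = c₁.cost env + c₂.cost env := by rw [Cmd.cost]

theorem cost_forLoop {n c₀ : ℕ} {c : Cmd} (hn : n < 5)
    (hc : ∀ i, c.cost (Function.update env 5 i) = c₀) :
    (Cmd.forLoop 5 (.var n) c).cost env = 1 + env n * (1 + c₀) := by
  simp only [Cmd.cost, hc, Index.eval, Finset.sum_const, Finset.card_range, smul_eq_mul]

namespace Expr

theorem cost_sub (e₁ e₂ : Expr) : (e₁ - e₂).cost env = e₁.cost env + (e₂.cost env + 1) := rfl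
theorem cost_div (e₁ e₂ : Expr) : (e₁ / e₂).cost env = e₁.cost env + (e₂.cost env + 1) := rfl

end Expr

open EfficientGAF.Expr

variable {env' : ℕ → ℕ} {K d m : ℕ}

theorem cost_initInv (he : ∀ i < 5, env' i = env i) (h1 : env 1 = K) (h2 : env 2 = d) :
    initInv.cost env' = 1 + K * 2 + K * d * 2 + K ^ 2 * d * 2 + K ^ 2 * d ^ 2 * 9 := by
  rw [initInv, cost_fill rfl rfl he]
  simp only [loopsCost, Expr.cost, cost_div, eqInd, param, h1, h2]
  ring

theorem cost_sampleBody (he : ∀ i < 5, env' i = env i) (h1 : env 1 = K) (h3 : env 3 = m) :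
    sampleBody.cost env' = 5 + K * 13 + K ^ 2 * 16 + m * 4 + m * K * 16 := by
  simp only [sampleBody, cost_seq]
  rw [pivot, cost_fill rfl rfl he,
    schurNew, cost_fill rfl rfl he,
    schurCopy, cost_fill rfl rfl he,
    sampleNew, cost_fill rfl rfl he,
    sampleCopy, cost_fill rfl rfl he]
  simp only [loopsCost, Expr.cost, cost_sub, cost_div, entry, h1, h3]
  ring

theorem cost_iterBody (he : ∀ i < 5, env' i = env i) (h1 : env 1 = K) :
    (Cmd.seq softIter stepIter).cost env' = 2 + K * 19 + K ^ 2 * 12 := by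
  rw [cost_seq, softIter, cost_fill rfl rfl he,
    stepIter, cost_fill rfl rfl he]
  simp only [loopsCost, Expr.cost, cost_div, entry, h1]
  ring

theorem cost_rankBody (he : ∀ i < 5, env' i = env i) (h1 : env 1 = K) (h2 : env 2 = d) :
    rankBody.cost env' = 26 + K * 12 + K * d * 26 + K ^ 2 * d * 8 + K ^ 2 * d ^ 2 * 26 := by
  simp only [rankBody, cost_seq]
  rw [devFeature, cost_fill rfl rfl he,
    invDev, cost_fill rfl rfl he,
    rankCoef, cost_fill rfl rfl he,
    rankNew, cost_fill rfl rfl he,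
    rankCopy, cost_fill rfl rfl he]
  simp only [loopsCost, Expr.cost, cost_sub, cost_div, entry, eqInd, param, h1, h2]
  ring

theorem update_five (env : ℕ → ℕ) (i : ℕ) : ∀ j < 5, Function.update env 5 i j = env j :=
  fun _ hj => Function.update_of_ne (by omega) _ _

theorem cost_gafPredict (h1 : env 1 = K) (h2 : env 2 = d) (h3 : env 3 = m) :
    gafPredict.cost env = 8 + K * 37 + K * d * 9 + K * m * 22 + K ^ 2 * 23 + K ^ 2 * d * 12 +
      K ^ 2 * d ^ 2 * 7 + K ^ 2 * m * 16 + K ^ 3 * 16 + m * 7 := by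
  have he : ∀ i < 5, env i = env i := fun _ _ => rfl
  simp only [gafPredict, cost_seq]
  rw [sampleLoop, cost_forLoop (by norm_num) fun i => cost_sampleBody (update_five env i) h1 h3,
    invFeature, cost_fill rfl rfl he,
    covariance, cost_fill rfl rfl he,
    mean, cost_fill rfl rfl he,
    copyCov, cost_fill rfl rfl he,
    initSample, cost_fill rfl rfl he,
    expSum, cost_fill rfl rfl he,
    output, cost_fill rfl rfl he]
  simp only [loopsCost, Expr.cost, cost_sub, cost_div, entry, param, h1, h2,
    h3]
  ring

theorem cost_gafUpdate (h1 : env 1 = K) (h2 : env 2 = d) (h3 : env 3 = m) :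
    gafUpdate.cost env = 11 + K * 67 + K * d * 62 + K * m * 19 + K ^ 2 * 22 + K ^ 2 * d * 44 +
      K ^ 2 * d ^ 2 * 7 + K ^ 2 * m * 12 + K ^ 3 * d * 8 + K ^ 3 * d ^ 2 * 26 + m * 3 := by
  have he : ∀ i < 5, env i = env i := fun _ _ => rfl
  simp only [gafUpdate, cost_seq]
  rw [iterLoop, cost_forLoop (by norm_num) fun i => cost_iterBody (update_five env i) h1,
    rankLoop, cost_forLoop (by norm_num) fun i => cost_rankBody (update_five env i) h1 h2,
    linGrad, cost_fill rfl rfl he,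
    invGrad, cost_fill rfl rfl he,
    predGrad, cost_fill rfl rfl he,
    initIter, cost_fill rfl rfl he,
    softIter, cost_fill rfl rfl he,
    estimator, cost_fill rfl rfl he,
    predEst, cost_fill rfl rfl he,
    linNew, cost_fill rfl rfl he]
  simp only [loopsCost, Expr.cost, cost_sub, cost_div, entry, eqInd, param, h1, h2,
    h3]
  ring

/-- As all sizes are at least one, each monomial in the cost of a round is dominated by `K³ d²` or
by `K² m`. -/
theorem totalCost_gafLearner_le {n : ℕ} (hn : 1 ≤ n) (hK : 1 ≤ K) (hd : 1 ≤ d) (hm : 1 ≤ m)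
    (y : Fin n → Fin K) :
    gafLearner.totalCost d m y ≤ 500 * (n * K ^ 3 * d ^ 2 + K ^ 2 * n * m) := by
  have hX : ∀ a ≤ 3, ∀ b ≤ 2, K ^ a * d ^ b ≤ K ^ 3 * d ^ 2 := fun _ ha _ hb =>
    Nat.mul_le_mul (Nat.pow_le_pow_right hK ha) (Nat.pow_le_pow_right hd hb)
  have hY : ∀ a ≤ 2, K ^ a * m ≤ K ^ 2 * m := fun _ ha =>
    Nat.mul_le_mul_right _ (Nat.pow_le_pow_right hK ha)
  have m00 := hX 0 (by norm_num) 0 (by norm_num)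
  have m01 := hX 0 (by norm_num) 1 (by norm_num)
  have m10 := hX 1 (by norm_num) 0 (by norm_num)
  have m11 := hX 1 (by norm_num) 1 (by norm_num)
  have m20 := hX 2 (by norm_num) 0 (by norm_num)
  have m21 := hX 2 (by norm_num) 1 (by norm_num)
  have m22 := hX 2 (by norm_num) 2 (by norm_num)
  have m30 := hX 3 (by norm_num) 0 (by norm_num)
  have m31 := hX 3 (by norm_num) 1 (by norm_num)
  have k0 := hY 0 (by norm_num)
  have k1 := hY 1 (by norm_num)
  simp only [pow_zero, pow_one, one_mul, mul_one] at m00 m01 m10 m11 m20 m21 m30 m31 k0 k1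
  have hround : ∀ t : Fin n, d + m * K + gafLearner.predict.cost (sizeEnv n K d m 0) + K + 1
      + gafLearner.update.cost (sizeEnv n K d m (y t)) ≤ 400 * (K ^ 3 * d ^ 2 + K ^ 2 * m) := by
    intro t
    rw [gafLearner, cost_gafPredict (K := K) (d := d) (m := m) rfl rfl rfl,
      cost_gafUpdate (K := K) (d := d) (m := m) rfl rfl rfl, mul_comm m K]
    linarith
  have hsum := Finset.sum_le_sum fun t (_ : t ∈ Finset.univ) => hround t
  rw [Finset.sum_const, Finset.card_univ, Fintype.card_fin, smul_eq_mul] at hsum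
  have hstart : 7 + gafLearner.start.cost (sizeEnv n K d m 0) ≤ 23 * (K ^ 3 * d ^ 2) := by
    rw [gafLearner, cost_initInv (env := sizeEnv n K d m 0) (K := K) (d := d) (fun _ _ => rfl) rfl
      rfl]
    linarith
  have hn' : K ^ 3 * d ^ 2 ≤ n * (K ^ 3 * d ^ 2) := Nat.le_mul_of_pos_left _ hn
  rw [Learner.totalCost]
  have : 0 ≤ n * (K ^ 2 * m) := Nat.zero_le _
  linarith

end Cost

/-! ### The run carried out by the program -/

section Run

variable {n K d m : ℕ} {lam β μ : ℝ} {x : Fin n → EuclideanSpace ℝ (Fin d)} {y : Fin n → Fin K}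

/-- The state `(A_t, b_t, θ_{t+1})` after a round that ends with the estimator `θ`. -/
noncomputable def nextState (β : ℝ) (A : Matrix (Fin K × Fin d) (Fin K × Fin d) ℝ) (b : Param K d)
    (x : EuclideanSpace ℝ (Fin d)) (y : Fin K) (θ : Param K d) :
    Matrix (Fin K × Fin d) (Fin K × Fin d) ℝ × Param K d × Param K d :=
  (A + (β / 2) • hessian (paramLoss x y) θ,
    b + gradient (paramLoss x y) θ
      - β • WithLp.toLp 2 (Matrix.mulVec (hessian (paramLoss x y) θ) θ.ofLp), θ)

/-- The states of the algorithm with `m` fixed-point iterations for each argmin. -/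
noncomputable def gafState (m : ℕ) (lam β : ℝ) (x : Fin n → EuclideanSpace ℝ (Fin d))
    (y : Fin n → Fin K) : ℕ → Matrix (Fin K × Fin d) (Fin K × Fin d) ℝ × Param K d × Param K d
  | 0 => (lam • 1, 0, 0)
  | t + 1 => if h : t < n then
      let s := gafState m lam β x y t
      nextState β s.1 s.2.1 (x ⟨t, h⟩) (y ⟨t, h⟩) (argminStep s.1 s.2.1 (x ⟨t, h⟩) (y ⟨t, h⟩)
        (predIter s.1 s.2.1 (x ⟨t, h⟩) (y ⟨t, h⟩) m))
    else gafState m lam β x y t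

theorem gafState_succ (t : Fin n) : gafState m lam β x y (t + 1) =
    nextState β (gafState m lam β x y t).1 (gafState m lam β x y t).2.1 (x t) (y t)
      (argminStep (gafState m lam β x y t).1 (gafState m lam β x y t).2.1 (x t) (y t)
        (predIter (gafState m lam β x y t).1 (gafState m lam β x y t).2.1 (x t) (y t) m)) := by
  rw [gafState, dif_pos t.2]

theorem gafState_dominates [NeZero K] (hβ : 0 ≤ β) :
    ∀ t ≤ n, Dominates lam (gafState m lam β x y t).1 := by
  intro t
  induction t with
  | zero => intro _; exact dominates_smul_one lam
  | succ t ih =>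
    intro ht
    rw [gafState_succ ⟨t, ht⟩, nextState, hessian_paramLoss]
    exact (ih (by omega)).add_hessian (by linarith) (fun k => (softmax_pos _ k).le)
      (sum_softmax _) _

/-- The minimizer demanded by the definition is the fixed point, and the computed estimator is the
result of `m` iterations towards it. -/
theorem gafState_isRun [NeZero K] {R : ℝ} (hl : 0 < lam) (hβ : 0 ≤ β) (hR : 0 < R)
    (hRl : 32 * R ^ 2 ≤ lam) (hx : ∀ t, ‖x t‖ ≤ R) (hm : 1 ≤ m) :
    IsRun lam β (Real.exp (-m) / R) x y (fun t => (gafState m lam β x y t).1)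
      (fun t => (gafState m lam β x y t).2.1) fun t => (gafState m lam β x y t).2.2 where
  A_zero := rfl
  b_zero := rfl
  θ_zero := rfl
  θ_succ t := by
    have hA := gafState_dominates (m := m) (lam := lam) (x := x) (y := y) hβ t t.2.le
    have hx2 : 32 * ‖x t‖ ^ 2 ≤ lam := by
      have := pow_le_pow_left₀ (norm_nonneg _) (hx t) 2
      linarith
    obtain ⟨θs, h⟩ := exists_argminStep_fixed hl hA (gafState m lam β x y t).2.1 hx2 (y t)
    refine ⟨θs, isMin_of_fixed hl hA h, ?_⟩
    rw [gafState_succ]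
    exact norm_argminStep_predIter_sub_le hl hA hR (hx t) hRl h hm
  b_succ t := by simp only [gafState_succ]; rfl
  A_succ t := by simp only [gafState_succ]; rfl

theorem storeVec_of_ne {k : ℕ} (M : Memory) {a b : ℕ} (v : Fin k → ℝ) (h : b ≠ a) :
    storeVec M a v b = M b := Function.update_of_ne h _ _

theorem isVec_storeVec {k : ℕ} (M : Memory) (a : ℕ) (v : Fin k → ℝ) :
    IsVec (storeVec M a v a) v := fun i => by simp [storeVec]

theorem storeMat_of_ne {p q : ℕ} (M : Memory) {a b : ℕ} (v : Fin p → Fin q → ℝ) (h : b ≠ a) :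
    storeMat M a v b = M b := Function.update_of_ne h _ _

theorem isTable_storeMat {p q : ℕ} (M : Memory) (a : ℕ) (v : Fin p → Fin q → ℝ) :
    IsTable (storeMat M a v a) v := fun i j => by simp [storeMat]

/-- The memory between the rounds. -/
theorem memory_gafLearner [NeZero K] (hl : 0 < lam) (hβ : 0 ≤ β) (g : Fin n → Fin m → Fin K → ℝ) :
    ∀ t ≤ n, gafLearner.memory lam β μ x y g t 0 [1] = β ∧
      gafLearner.memory lam β μ x y g t 0 [2] = μ ∧
      IsMat (gafLearner.memory lam β μ x y g t 10) (gafState m lam β x y t).1⁻¹ ∧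
      IsParam (gafLearner.memory lam β μ x y g t 11) (gafState m lam β x y t).2.1.ofLp ∧
      IsParam (gafLearner.memory lam β μ x y g t 12) (gafState m lam β x y t).2.2.ofLp := by
  intro t
  induction t with
  | zero =>
    intro _
    have hfr : ∀ a, initInv.writes a = false → gafLearner.memory lam β μ x y g 0 a =
        storeVec (fun _ _ => 0) 0 ![lam, β, μ] a := fun a h => Cmd.exec_frame _ _ _ h
    rw [hfr 0 rfl, hfr 11 rfl, hfr 12 rfl]
    have h0 := isVec_storeVec (fun _ _ => 0) 0 ![lam, β, μ]
    exact ⟨h0 1, h0 2, initInv_spec rfl rfl (h0 0), fun _ _ => rfl, fun _ _ => rfl⟩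
  | succ t ih =>
    intro ht
    obtain ⟨i1, i2, i3, i4, i5⟩ := ih (by omega)
    have hA := gafState_dominates (m := m) (lam := lam) (x := x) (y := y) hβ t (by omega)
    rw [gafState_succ ⟨t, ht⟩]
    rw [Learner.memory, dif_pos (show t < n from ht)]
    generalize gafLearner.memory lam β μ x y g t = M at i1 i2 i3 i4 i5 ⊢
    generalize gafState m lam β x y t = s at i1 i2 i3 i4 i5 hA ⊢
    set M₁ := storeMat (storeVec M 1 (x ⟨t, ht⟩).ofLp) 2 (g ⟨t, ht⟩) with hM₁
    have hfr : ∀ a, a ≠ 1 → a ≠ 2 → M₁ a = M a := fun a h1 h2 => by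
      rw [hM₁, storeMat_of_ne _ _ h2, storeVec_of_ne _ _ h1]
    have hx : IsVec (M₁ 1) (x ⟨t, ht⟩).ofLp := by
      rw [hM₁, storeMat_of_ne _ _ (by norm_num)]; exact isVec_storeVec _ _ _
    have hg : IsTable (M₁ 2) (g ⟨t, ht⟩) := isTable_storeMat _ _ _
    rw [← hfr 0 (by norm_num) (by norm_num)] at i1 i2
    rw [← hfr 10 (by norm_num) (by norm_num)] at i3
    rw [← hfr 11 (by norm_num) (by norm_num)] at i4
    rw [← hfr 12 (by norm_num) (by norm_num)] at i5
    clear_value M₁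
    obtain ⟨-, hU, hW⟩ := gafPredict_spec (env := sizeEnv n K d m 0) rfl rfl rfl i3 i5 hx hg i2
    change gafUpdate.exec _ (gafPredict.exec _ M₁) 0 [1] = β ∧
      gafUpdate.exec _ (gafPredict.exec _ M₁) 0 [2] = μ ∧
      IsMat (gafUpdate.exec _ (gafPredict.exec _ M₁) 10) _ ∧
      IsParam (gafUpdate.exec _ (gafPredict.exec _ M₁) 11) _ ∧
      IsParam (gafUpdate.exec _ (gafPredict.exec _ M₁) 12) _
    have hfr : ∀ a, gafPredict.writes a = false →
      gafPredict.exec (sizeEnv n K d m 0) M₁ a = M₁ a := fun a h => Cmd.exec_frame _ _ _ h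
    rw [← hfr 0 rfl] at i1 i2
    rw [← hfr 1 rfl] at hx
    rw [← hfr 10 rfl] at i3
    rw [← hfr 11 rfl] at i4
    generalize gafPredict.exec (sizeEnv n K d m 0) M₁ = M₂ at i1 i2 hx i3 i4 hU hW ⊢
    obtain ⟨j1, j2, j3⟩ := gafUpdate_spec (env := sizeEnv n K d m (y ⟨t, ht⟩)) (m := m) hl hA hβ rfl
      rfl rfl rfl hx i1 i3 i4 hU hW rfl
    rw [Cmd.exec_frame (a := 0) gafUpdate _ _ rfl]
    exact ⟨i1, i2, j3, j2, j1⟩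

theorem gafLearner_implements [NeZero K] {R : ℝ} (hl : 0 < lam) (hβ : 0 ≤ β) (hR : 0 < R)
    (hRl : 32 * R ^ 2 ≤ lam) (hx : ∀ t, ‖x t‖ ≤ R) (hm : 1 ≤ m) :
    gafLearner.Implements m lam β μ (Real.exp (-m) / R) x y := by
  refine ⟨_, _, _, fun t => schurFactor (sampleCov (gafState m lam β x y t).1 (x t)),
    gafState_isRun hl hβ hR hRl hx hm, fun t => ?_, fun g t => ?_⟩
  · have hA := gafState_dominates (m := m) (lam := lam) (x := x) (y := y) hβ t t.2.le
    refine schurFactor_mul_transpose (sampleCov_symm hA _) fun u => ?_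
    rw [dot_sampleCov]
    exact hA.dot_inv_nonneg hl _
  · obtain ⟨-, i2, i3, -, i5⟩ := memory_gafLearner (μ := μ) (x := x) (y := y) hl hβ g t t.2.le
    funext k
    rw [Learner.output]
    generalize gafLearner.memory lam β μ x y g t = M at i2 i3 i5 ⊢
    refine (gafPredict_spec (env := sizeEnv n K d m 0) rfl rfl rfl ?_ ?_ ?_ ?_ ?_).1 k
    · rwa [storeMat_of_ne _ _ (by norm_num), storeVec_of_ne _ _ (by norm_num)]
    · rwa [storeMat_of_ne _ _ (by norm_num), storeVec_of_ne _ _ (by norm_num)]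
    · rw [storeMat_of_ne _ _ (by norm_num)]; exact isVec_storeVec _ _ _
    · exact isTable_storeMat _ _ _
    · rwa [storeMat_of_ne _ _ (by norm_num), storeVec_of_ne _ _ (by norm_num)]

end Run

end EfficientGAF

/-! ### The main theorem -/

theorem mainTheorem3 :
    ∃ (C : ℝ) (P : EfficientGAF.Learner), 0 < C ∧
      ∀ (n K d : ℕ) (B R δ lam β : ℝ) (μ : ℕ → ℝ)
        (x : Fin n → EuclideanSpace ℝ (Fin d)) (y : Fin n → Fin K),
        1 ≤ n → 1 ≤ K → 1 ≤ d → 0 < B → 0 < R → 0 < δ → δ < 1 → (∀ t, ‖x t‖ ≤ R) →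
        lam = 32 * d * K * R ^ 2 → β = (Real.log K / 2 + B * R + 1)⁻¹ →
        (∀ m : ℕ, μ m = (Real.log (n / δ) / m) ^ (1 / 3 : ℝ)) →
        (∀ m : ℕ, 1 ≤ m →
          P.Implements m lam β (μ m) (Real.exp (-m) / R) x y ∧
          (P.totalCost d m y : ℝ) ≤ C * (n * K ^ 3 * d ^ 2 + K ^ 2 * n * m)) ∧
        (∀ m : ℕ, 1 ≤ m → μ m ≤ 1 →
          EfficientGAF.RegretGuarantee P m lam β (μ m) (Real.exp (-m) / R) δ B
            (C * (EfficientGAF.logisticBound n K d B R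
              + n * (K / m * Real.log (n / δ)) ^ (1 / 3 : ℝ)) + C) x y) ∧
        (∀ m : ℕ, m = ⌈(n : ℝ) ^ 3 * Real.log (n / δ)⌉₊ →
          EfficientGAF.RegretGuarantee P m lam β (μ m) (Real.exp (-m) / R) δ B
            (C * EfficientGAF.logisticBound n K d B R + C) x y ∧
          (P.totalCost d m y : ℝ) ≤
            C * (n * K ^ 3 * d ^ 2 + K ^ 2 * n ^ 4 * Real.log (n / δ))) := by
  -- The cost constant 500 is doubled to absorb the rounding of `m` in the last claim; the regret
  -- bounds need only 32.
  refine ⟨1000, EfficientGAF.gafLearner, by norm_num, ?_⟩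
  intro n K d B R δ lam β μ x y hn hK hd hB hR hδ hδ1 hx hlam hβ hμ
  have : NeZero K := ⟨by omega⟩
  have : NeZero d := ⟨by omega⟩
  have hn' : (1 : ℝ) ≤ n := by exact_mod_cast hn
  have hK' : (1 : ℝ) ≤ K := by exact_mod_cast hK
  have hd' : (1 : ℝ) ≤ d := by exact_mod_cast hd
  have hRl : 32 * R ^ 2 ≤ lam := by
    have h1 : (1 : ℝ) ≤ d * K := one_le_mul_of_one_le_of_one_le hd' hK'
    rw [hlam]
    nlinarith [sq_nonneg R]
  have hl : 0 < lam := lt_of_lt_of_le (by positivity) hRl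
  have hβ0 : 0 ≤ β := by
    have := Real.log_nonneg hK'
    rw [hβ]; positivity
  have himp : ∀ m : ℕ, 1 ≤ m → ∀ μ, EfficientGAF.gafLearner.Implements m lam β μ
      (Real.exp (-m) / R) x y := fun m hm μ =>
    EfficientGAF.gafLearner_implements hl hβ0 hR hRl hx hm
  have hcost : ∀ m : ℕ, 1 ≤ m → (EfficientGAF.gafLearner.totalCost d m y : ℝ) ≤
      500 * (n * K ^ 3 * d ^ 2 + K ^ 2 * n * m) := fun m hm => by
    exact_mod_cast EfficientGAF.totalCost_gafLearner_le hn hK hd hm y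
  have hreg := fun (m : ℕ) (hm : 1 ≤ m) => EfficientGAF.regretGuarantee (C := 1000) (by norm_num) hn
    hB hR hδ hδ1 hx hlam hβ (hμ m) hm (himp m hm (μ m))
  refine ⟨fun m hm => ⟨himp m hm _, (hcost m hm).trans ?_⟩, fun m hm hμ1 => (hreg m hm).1 hμ1,
    fun m hm => ?_⟩
  · have : (0 : ℝ) ≤ n * K ^ 3 * d ^ 2 + K ^ 2 * n * m := by positivity
    linarith
  · have hL : 0 < Real.log (n / δ) := Real.log_pos (by rw [lt_div_iff₀ hδ]; linarith)
    have hpos : 0 < (n : ℝ) ^ 3 * Real.log (n / δ) := by positivity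
    have hm1 : 1 ≤ m := by rw [hm]; exact Nat.ceil_pos.2 hpos
    refine ⟨(hreg m hm1).2 (by rw [hm]; exact Nat.le_ceil _), (hcost m hm1).trans ?_⟩
    -- The ceiling adds at most 1 to `m`, hence `K² n` to the cost, which the first term dominates.
    have hm2 : (m : ℝ) ≤ (n : ℝ) ^ 3 * Real.log (n / δ) + 1 := by
      rw [hm]; exact (Nat.ceil_lt_add_one hpos.le).le
    have h1 : (K : ℝ) ^ 2 * n * m ≤ K ^ 2 * n * ((n : ℝ) ^ 3 * Real.log (n / δ) + 1) :=
      mul_le_mul_of_nonneg_left hm2 (by positivity)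
    have h2 : (K : ℝ) ^ 2 * n ≤ n * K ^ 3 * d ^ 2 := by
      have h3 : (1 : ℝ) ≤ K * d ^ 2 := one_le_mul_of_one_le_of_one_le hK' (one_le_pow₀ hd')
      have h4 := mul_le_mul_of_nonneg_left h3 (show (0 : ℝ) ≤ K ^ 2 * n by positivity)
      linarith
    have h5 : (0 : ℝ) ≤ K ^ 2 * n ^ 4 * Real.log (n / δ) := by positivity
    linarith
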